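/- Let $\alpha,\beta>0$. Let $R=\{|x|\le\alpha,\ |y|\le\beta\}\subset\mathbb R^2$, let $W$ be the union of the two closed half discs of radius $\beta$ centred at $(\pm\alpha,0)$ that lie in $|x|\ge\alpha$, and let $S$ be the interior of $R\cup W$ (the Bunimovich stadium). On $W$ put $w=|x|-\alpha$; let $\Delta=-\partial_x^2-\partial_y^2$, let $\|\cdot\|$ be the norm of $L^2(S)$, let $\partial_N$ be the outward normal derivative on $\partial S$ (in the sense of traces; it exists in $L^2(\partial S)$ for every $u\in H^2(S)$), and let $dl$ be arc length. There is a constant $C>0$, depending only on the ratio $\alpha/\beta$, such that the following holds for all $\alpha,\beta>0$ with this ratio. (1) Let $\lambda\in\mathbb R$, let $u\in H^2(S)$ be complex-valued with $u|_{\partial S}=0$ and $\|u\|=1$, and let $f=(\Delta-\lambda^2)u$. Then $$\beta^4\|f\|^2+\beta^2\int_{\partial S\cap W}w\,|\partial_Nu|^2\,dl\ \ge\ C,$$ $$\beta^4\|f\|^2+(\beta\lambda)^8\|u\|_{L^2(W)}^2\ \ge\ C,$$ and, if $\beta\lambda\ge1$, $$(\beta\lambda)^2\,\beta^4\|f\|^2+(\beta\lambda)^4\|u\|_{L^2(W)}^2\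 \ge\ C.$$ (2) Let $\lambda_k\to\infty$ be real, and let $u_k\in H^2(S)$ satisfy $u_k|_{\partial S}=0$, $\|u_k\|=1$ and $(\Delta-\lambda_k^2)u_k=f_k$. If $\|f_k\|=o(1)$, then for all sufficiently large $k$ $$\beta\,\|w^{1/2}\partial_Nu_k\|_{L^2(\partial S\cap W)}\ge C\qquad\text{and}\qquad \|u_k\|_{L^2(W)}\ge C(\beta\lambda_k)^{-4}.$$ If $\|f_k\|=o(\lambda_k^{-2})$ (for example, if the $u_k$ are eigenfunctions, $f_k=0$), then for all sufficiently large $k$ $$\|u_k\|_{L^2(W)}\ge C(\beta\lambda_k)^{-2}.$$ -/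

import Mathlib

open MeasureTheory Filter Topology Asymptotics
open scoped ContDiff

noncomputable section

namespace Stadium

/-! ### Geometry -/

/-- The central rectangle `R`. -/
def rectangle (α β : ℝ) : Set (ℝ × ℝ) :=
  {p | |p.1| ≤ α ∧ |p.2| ≤ β}

/-- The wings `W`: the two closed half discs of radius `β` centred at `(± α, 0)`
which lie outside the rectangle. -/
def wings (α β : ℝ) : Set (ℝ × ℝ) :=
  {p | α ≤ |p.1| ∧ (|p.1| - α) ^ 2 + p.2 ^ 2 ≤ β ^ 2}

/-- The Bunimovich stadium `R ∪ W`, as an open planar domain. -/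
def stadium (α β : ℝ) : Set (ℝ × ℝ) :=
  interior (rectangle α β ∪ wings α β)

/-- The auxiliary coordinate `w = |x| - α` in the wings. -/
def wingCoord (α : ℝ) (p : ℝ × ℝ) : ℝ := |p.1| - α

/-- Arc length `dl` on the boundary of the stadium: the top and bottom sides, parametrized by `x`,
and the right and left semicircles, parametrized by the angle, with speed `β`. -/
def boundaryMeasure (α β : ℝ) : Measure (ℝ × ℝ) :=
  Measure.map (fun x : ℝ => (x, β)) (volume.restrict (Set.Icc (-α) α))
  + Measure.map (fun x : ℝ => (x, -β)) (volume.restrict (Set.Icc (-α) α))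
  + ENNReal.ofReal β • Measure.map (fun θ : ℝ => (α + β * Real.cos θ, β * Real.sin θ))
      (volume.restrict (Set.Icc (-(Real.pi / 2)) (Real.pi / 2)))
  + ENNReal.ofReal β • Measure.map (fun θ : ℝ => (-(α + β * Real.cos θ), β * Real.sin θ))
      (volume.restrict (Set.Icc (-(Real.pi / 2)) (Real.pi / 2)))

/-- The outward unit normal at a boundary point `(x, y)`: it is `((x, y) - (c, 0)) / β`, where
`c` is the point of `[-α, α]` closest to `x`. -/
def outwardNormal (α β : ℝ) (p : ℝ × ℝ) : ℝ × ℝ :=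
  ((p.1 - max (-α) (min p.1 α)) / β, p.2 / β)

/-! ### Sobolev spaces and traces -/

/-- The `L²` norm with respect to the measure `μ`. -/
def l2Norm (μ : Measure (ℝ × ℝ)) (g : ℝ × ℝ → ℂ) : ℝ := (eLpNorm g 2 μ).toReal

/-- `g` is the weak derivative of `u` on `Ω` in the direction `e`, tested against
smooth functions with compact support in `Ω`. -/
def IsWeakPartial (Ω : Set (ℝ × ℝ)) (e : ℝ × ℝ) (u g : ℝ × ℝ → ℂ) : Prop :=
  ∀ φ : ℝ × ℝ → ℝ, ContDiff ℝ ∞ φ → HasCompactSupport φ → tsupport φ ⊆ Ω →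
    ∫ p in Ω, fderiv ℝ φ p e • u p = -∫ p in Ω, φ p • g p

/-- `u ∈ L²(Ω)` has the weak gradient `(ux, uy)`, which lies in `L²(Ω)`. -/
structure HasWeakGrad (Ω : Set (ℝ × ℝ)) (u ux uy : ℝ × ℝ → ℂ) : Prop where
  memLp : MemLp u 2 (volume.restrict Ω)
  memLp_x : MemLp ux 2 (volume.restrict Ω)
  memLp_y : MemLp uy 2 (volume.restrict Ω)
  partial_x : IsWeakPartial Ω (1, 0) u ux
  partial_y : IsWeakPartial Ω (0, 1) u uy

/-- The Sobolev space `H¹(Ω)`. -/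
def MemH1 (Ω : Set (ℝ × ℝ)) (u : ℝ × ℝ → ℂ) : Prop :=
  ∃ ux uy, HasWeakGrad Ω u ux uy

/-- The Sobolev space `H²(Ω)`. -/
def MemH2 (Ω : Set (ℝ × ℝ)) (u : ℝ × ℝ → ℂ) : Prop :=
  ∃ ux uy, HasWeakGrad Ω u ux uy ∧ MemH1 Ω ux ∧ MemH1 Ω uy

/-- `g ∈ L²(∂S)` is the boundary trace of `v ∈ H¹(S)`: there are functions smooth up to the
boundary which converge to `v` in `H¹(S)` and whose boundary values converge to `g` in
`L²(∂S)`. -/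
def HasTrace (α β : ℝ) (v g : ℝ × ℝ → ℂ) : Prop :=
  MemLp g 2 (boundaryMeasure α β) ∧
  ∃ vx vy, HasWeakGrad (stadium α β) v vx vy ∧
  ∃ φ : ℕ → ℝ × ℝ → ℂ, (∀ n, ContDiff ℝ ∞ (φ n)) ∧
    Tendsto (fun n => eLpNorm (fun p => φ n p - v p) 2 (volume.restrict (stadium α β)))
      atTop (𝓝 0) ∧
    Tendsto (fun n => eLpNorm (fun p => fderiv ℝ (φ n) p (1, 0) - vx p) 2
      (volume.restrict (stadium α β))) atTop (𝓝 0) ∧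
    Tendsto (fun n => eLpNorm (fun p => fderiv ℝ (φ n) p (0, 1) - vy p) 2
      (volume.restrict (stadium α β))) atTop (𝓝 0) ∧
    Tendsto (fun n => eLpNorm (fun p => φ n p - g p) 2 (boundaryMeasure α β)) atTop (𝓝 0)

/-- `g` is the outward normal derivative `∂_N u` on the boundary of the stadium: the normal
component of the trace of the gradient of `u`. -/
def IsNormalDeriv (α β : ℝ) (u g : ℝ × ℝ → ℂ) : Prop :=
  ∃ ux uy tx ty, HasWeakGrad (stadium α β) u ux uy ∧
    HasTrace α β ux tx ∧ HasTrace α β uy ty ∧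
    ∀ᵐ p ∂(boundaryMeasure α β),
      g p = ((outwardNormal α β p).1 : ℂ) * tx p + ((outwardNormal α β p).2 : ℂ) * ty p

/-! ### Quasimodes -/

/-- `u ∈ H²(S)` is `L²`-normalized, vanishes on the boundary of the stadium, and satisfies
`(Δ - lam²) u = f`, where `Δ = -∂ₓ² - ∂ᵧ²`. -/
structure IsDirichletQuasimode (α β lam : ℝ) (u f : ℝ × ℝ → ℂ) : Prop where
  memH2 : MemH2 (stadium α β) u
  equation : ∃ ux uy uxx uxy uyx uyy,
    HasWeakGrad (stadium α β) u ux uy ∧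
    HasWeakGrad (stadium α β) ux uxx uxy ∧
    HasWeakGrad (stadium α β) uy uyx uyy ∧
    ∀ᵐ p ∂(volume.restrict (stadium α β)),
      -uxx p - uyy p - (lam : ℂ) ^ 2 * u p = f p
  dirichlet : HasTrace α β u 0
  normalized : l2Norm (volume.restrict (stadium α β)) u = 1

/-- The norm in `L²(S)`. -/
def normS (α β : ℝ) (g : ℝ × ℝ → ℂ) : ℝ := l2Norm (volume.restrict (stadium α β)) g

/-- The norm in `L²(W)`. -/
def normW (α β : ℝ) (g : ℝ × ℝ → ℂ) : ℝ := l2Norm (volume.restrict (wings α β)) g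

/-- The norm in `L²(∂S ∩ W)`. -/
def normBdryW (α β : ℝ) (g : ℝ × ℝ → ℂ) : ℝ :=
  l2Norm ((boundaryMeasure α β).restrict (wings α β)) g

/-- A sequence of frequencies `lam k → ∞` with corresponding `L²`-normalized
`u k ∈ H²(S)`, zero on the boundary, with `(Δ - (lam k)²) (u k) = f k`. -/
def IsQuasimodeSequence (α β : ℝ) (lam : ℕ → ℝ) (u f : ℕ → ℝ × ℝ → ℂ) : Prop :=
  Tendsto lam atTop atTop ∧ ∀ k, IsDirichletQuasimode α β (lam k) (u k) (f k)

end Stadium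

end

/-! Write `σ` for the signed horizontal distance to `[-α, α]`, `N = (n₁, n₂)` for the outward normal
and `g = ∂_N u`. The stadium is `σ² + y² < β²`, and on its boundary `N = (σ, y)/β`. In particular
`n₁ = 0` on the straight sides, so a horizontal multiplier produces boundary terms on the wings
only.

Boundary control. Poincaré in `x` bounds `‖∂ₓu‖` below by a multiple of `1/(α+β)`. The Rellich
identity for `x∂ₓ`, combined with the energy identity, cancels `λ²` and `‖∂_yu‖²` and leaves
`2‖∂ₓu‖²` equal to `∫ n₁ x |g|²` plus terms in `f`. Since `|n₁ x| ≤ (α+β)|σ|/β` on the boundary,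
`‖∂ₓu‖²` is controlled by `∫ w|g|²` over the arcs and `‖f‖²` (`QuasimodeData.sq_le_boundary`). This
gives the first estimate.

From the boundary to the interior of the wings. The field `|σ|(σ, y)` has normal component `β|σ|` on
the boundary and is supported in the wings. Its Rellich identity, with the energy identity for the
weight `|σ|`, bounds `∫ w|g|²` by `λ²‖u‖²_W`, products of `‖∂ₓu‖` with `‖u‖_W` and `‖∂_yu‖_W`, and
terms in `f` (`QuasimodeData.boundary_le`). A vertical integration by parts over the wings gives
`‖∂_yu‖²_W ≤ ‖u‖_W ‖∂_y²u‖`, with no contribution from the lines `|x| = α`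
(`QuasimodeData.wing_uy_sq_le`). Finally `‖∂_y²u‖ ≤ ‖Δu‖ ≤ ‖f‖ + λ²`, because on a convex domain
with Dirichlet condition the integral of the Hessian determinant is half the curvature integral of
`|g|²`, hence nonnegative (`DirichletData.hessian_nonneg`).

Absorbing `‖∂ₓu‖` by Young's inequality yields, in dimensionless form, `β⁴‖f‖² + (1 + β²λ²)‖u‖_W ≥
c` (`wing_lower_bound`). Squaring the second term gives the power `(βλ)⁴` for `βλ ≥ 1`. Without that
assumption, Poincaré and the energy identity bound `βλ` below unless `f` is large, which leads to
`(βλ)⁸`. The sequence statements follow because the term in `f` tends to zero.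

All identities are first proved for functions with bounded partial derivatives and then passed to
`H²` by density and the trace inequality. -/

noncomputable section

namespace Stadium

/-! ### The signed horizontal distance to the central segment. -/

/-- The signed horizontal distance from `x` to the interval `[-α, α]`. -/
def wingOffset (α x : ℝ) : ℝ := x - max (-α) (min x α)

section Offset

variable {α : ℝ}

lemma wingOffset_of_abs_le {x : ℝ} (hx : |x| ≤ α) : wingOffset α x = 0 := by
  obtain ⟨h1, h2⟩ := abs_le.1 hx
  simp [wingOffset, min_eq_left h2, max_eq_right h1]

lemma wingOffset_of_le (hα : 0 < α) {x : ℝ} (hx : α ≤ x) : wingOffset α x = x - α := by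
  rw [wingOffset, min_eq_right hx, max_eq_right (by linarith)]

lemma wingOffset_of_le_neg (hα : 0 < α) {x : ℝ} (hx : x ≤ -α) : wingOffset α x = x + α := by
  rw [wingOffset, min_eq_left (by linarith), max_eq_left hx]; ring

lemma abs_wingOffset (hα : 0 < α) (x : ℝ) : |wingOffset α x| = max (|x| - α) 0 := by
  rcases le_total (|x|) α with h | h
  · rw [wingOffset_of_abs_le h, max_eq_right (by linarith), abs_zero]
  · rw [max_eq_left (by linarith)]
    rcases le_abs.1 h with h' | h'
    · rw [wingOffset_of_le hα h', abs_of_nonneg (by linarith), abs_of_nonneg (by linarith)]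
    · rw [wingOffset_of_le_neg hα (by linarith), abs_of_nonpos (by linarith),
        abs_of_nonpos (by linarith)]; ring

lemma abs_wingOffset_of_le (hα : 0 < α) {x : ℝ} (hx : α ≤ |x|) :
    |wingOffset α x| = |x| - α := by
  rw [abs_wingOffset hα, max_eq_left (by linarith)]

lemma wingOffset_ne_zero_iff (hα : 0 < α) {x : ℝ} : wingOffset α x ≠ 0 ↔ α < |x| := by
  rw [← abs_pos, abs_wingOffset hα]; simp

lemma continuous_wingOffset : Continuous (wingOffset α) := by
  unfold wingOffset; fun_prop

/-- The derivative of `wingOffset α` off the points `± α`. -/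
def wingIndicator (α x : ℝ) : ℝ := if α < |x| then 1 else 0

lemma hasDerivAt_wingOffset (hα : 0 < α) {x : ℝ} (hx : |x| ≠ α) :
    HasDerivAt (wingOffset α) (wingIndicator α x) x := by
  rcases lt_or_gt_of_ne hx with h | h
  · have : wingOffset α =ᶠ[𝓝 x] fun _ => 0 := by
      filter_upwards [continuous_abs.continuousAt.eventually_lt continuousAt_const h] with z hz
      exact wingOffset_of_abs_le hz.le
    rw [wingIndicator, if_neg (by linarith)]
    exact (hasDerivAt_const x (0 : ℝ)).congr_of_eventuallyEq this
  · rw [wingIndicator, if_pos h]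
    rcases lt_abs.1 h with h' | h'
    · have : wingOffset α =ᶠ[𝓝 x] fun z => z - α := by
        filter_upwards [lt_mem_nhds h'] with z hz
        exact wingOffset_of_le hα hz.le
      exact ((hasDerivAt_id x).sub_const α).congr_of_eventuallyEq this
    · have : wingOffset α =ᶠ[𝓝 x] fun z => z + α := by
        filter_upwards [gt_mem_nhds (show x < -α by linarith)] with z hz
        exact wingOffset_of_le_neg hα hz.le
      exact ((hasDerivAt_id x).add_const α).congr_of_eventuallyEq this

lemma measurable_wingIndicator : Measurable (wingIndicator α) := by
  unfold wingIndicator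
  exact Measurable.ite (measurableSet_lt measurable_const continuous_abs.measurable)
    measurable_const measurable_const

lemma wingIndicator_mem (x : ℝ) : wingIndicator α x = 0 ∨ wingIndicator α x = 1 := by
  unfold wingIndicator; split_ifs <;> simp

lemma wingIndicator_nonneg (x : ℝ) : 0 ≤ wingIndicator α x := by
  rcases wingIndicator_mem (α := α) x with h | h <;> simp [h]

lemma abs_wingIndicator_le (x : ℝ) : |wingIndicator α x| ≤ 1 := by
  rcases wingIndicator_mem (α := α) x with h | h <;> simp [h]

lemma wingIndicator_mul_wingOffset (x : ℝ) :
    wingIndicator α x * wingOffset α x = wingOffset α x := by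
  unfold wingIndicator
  split_ifs with h
  · simp
  · simp [wingOffset_of_abs_le (not_lt.1 h)]

/-- The distance to an interval is a convex function. This is the source of the star-shapedness of
the stadium. -/
lemma abs_wingOffset_convex (hα : 0 < α) {x b t : ℝ} (ht : 0 ≤ t) (ht' : t ≤ 1) :
    |wingOffset α (t * x + (1 - t) * b)| ≤ t * |wingOffset α x| + (1 - t) * |wingOffset α b| := by
  have h1 := abs_add_le (t * x) ((1 - t) * b)
  rw [abs_mul, abs_mul, abs_of_nonneg ht, abs_of_nonneg (sub_nonneg.2 ht')] at h1
  have hx : |x| - α ≤ |wingOffset α x| := by rw [abs_wingOffset hα]; exact le_max_left _ _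
  have hb : |b| - α ≤ |wingOffset α b| := by rw [abs_wingOffset hα]; exact le_max_left _ _
  have h2 := mul_le_mul_of_nonneg_left hx ht
  have h3 := mul_le_mul_of_nonneg_left hb (sub_nonneg.2 ht')
  rw [abs_wingOffset hα (t * x + (1 - t) * b)]
  refine max_le (by linarith) ?_
  have := mul_nonneg ht (abs_nonneg (wingOffset α x))
  have := mul_nonneg (sub_nonneg.2 ht') (abs_nonneg (wingOffset α b))
  linarith

end Offset

/-! ### The stadium as a sublevel set. -/

section Geometry

variable {α β : ℝ}

/-- The union is the closed `β`-neighbourhood of the segment `[-α, α] × {0}`, so a single inequality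
replaces the case distinction between rectangle and wings. -/
lemma mem_rectangle_union_wings_iff (hα : 0 < α) (hβ : 0 < β) (p : ℝ × ℝ) :
    p ∈ rectangle α β ∪ wings α β ↔ wingOffset α p.1 ^ 2 + p.2 ^ 2 ≤ β ^ 2 := by
  rcases le_total (|p.1|) α with h | h
  · rw [wingOffset_of_abs_le h]
    constructor
    · rintro (⟨-, h2⟩ | ⟨h1, h2⟩)
      · have := sq_le_sq' (by linarith [abs_nonneg p.2]) h2
        rw [sq_abs] at this; simpa using this
      · have : |p.1| - α = 0 := by linarith
        simpa [this] using h2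
    · intro h2
      refine Or.inl ⟨h, ?_⟩
      exact abs_le_of_sq_le_sq (by simpa using h2) hβ.le
  · have e : wingOffset α p.1 ^ 2 = (|p.1| - α) ^ 2 := by
      rw [← sq_abs, abs_wingOffset_of_le hα h]
    rw [e]
    constructor
    · rintro (⟨h1, h2⟩ | ⟨h1, h2⟩)
      · have h3 : |p.1| - α = 0 := by linarith
        have := sq_le_sq' (by linarith [abs_nonneg p.2]) h2
        rw [sq_abs] at this; simpa [h3] using this
      · exact h2
    · exact fun h2 => Or.inr ⟨h, h2⟩

lemma mem_stadium_iff (hα : 0 < α) (hβ : 0 < β) (p : ℝ × ℝ) :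
    p ∈ stadium α β ↔ wingOffset α p.1 ^ 2 + p.2 ^ 2 < β ^ 2 := by
  have hset : rectangle α β ∪ wings α β = {p | wingOffset α p.1 ^ 2 + p.2 ^ 2 ≤ β ^ 2} :=
    Set.ext (mem_rectangle_union_wings_iff hα hβ)
  have hc : Continuous fun p : ℝ × ℝ => wingOffset α p.1 ^ 2 + p.2 ^ 2 :=
    ((continuous_wingOffset.comp continuous_fst).pow 2).add (continuous_snd.pow 2)
  rw [stadium, hset]
  constructor
  · intro hp
    have hle : wingOffset α p.1 ^ 2 + p.2 ^ 2 ≤ β ^ 2 := by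
      have := interior_subset hp
      exact this
    refine lt_of_le_of_ne hle fun heq => ?_
    -- If equality held at an interior point, a slight dilation by `t > 1` would remain in the
    -- closed set; but such a dilation strictly increases `σ² + y²`.
    have hcont : Tendsto (fun t : ℝ => t • p) (𝓝[>] 1) (𝓝 p) := by
      have : ContinuousAt (fun t : ℝ => t • p) 1 := by fun_prop
      simpa using this.tendsto.mono_left nhdsWithin_le_nhds
    have hev := hcont.eventually (isOpen_interior.mem_nhds hp)
    obtain ⟨t, ht, ht1⟩ := (hev.and self_mem_nhdsWithin).exists
    have ht1 : 1 < t := ht1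
    have hle' : wingOffset α (t * p.1) ^ 2 + (t * p.2) ^ 2 ≤ β ^ 2 := by
      have := interior_subset ht
      exact this
    have h1 : |wingOffset α p.1| ≤ |wingOffset α (t * p.1)| := by
      rw [abs_wingOffset hα, abs_wingOffset hα]
      refine max_le_max (sub_le_sub_right ?_ _) le_rfl
      rw [abs_mul, abs_of_pos (by linarith : 0 < t)]
      nlinarith [abs_nonneg p.1]
    have h2 := sq_le_sq.2 h1
    -- Off the axis the growth comes from `y²`. On the axis equality forces `|x| > α`, and the
    -- growth comes from `σ²`.
    by_cases hy : p.2 = 0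
    · rw [hy] at heq hle'
      have hw : |wingOffset α p.1| ≠ 0 := by
        intro h0; rw [abs_eq_zero] at h0; rw [h0] at heq; nlinarith
      have hx : α < |p.1| := (wingOffset_ne_zero_iff hα).1 (abs_ne_zero.1 hw)
      have h3 : |wingOffset α p.1| < |wingOffset α (t * p.1)| := by
        have : |p.1| < |t * p.1| := by
          rw [abs_mul, abs_of_pos (by linarith : 0 < t)]; nlinarith
        rw [abs_wingOffset_of_le hα hx.le, abs_wingOffset_of_le hα (by linarith)]; linarith
      have := sq_lt_sq.2 h3
      linarith
    · have h3 : 0 < p.2 ^ 2 := by positivity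
      have h4 : 1 < t ^ 2 := one_lt_pow₀ ht1 two_ne_zero
      rw [mul_pow] at hle'
      nlinarith
  · intro hp
    exact interior_maximal (fun q (hq : _ < _) => le_of_lt hq)
      (isOpen_lt hc continuous_const) hp

lemma isOpen_stadium : IsOpen (stadium α β) := isOpen_interior

lemma measurableSet_stadium : MeasurableSet (stadium α β) := isOpen_stadium.measurableSet

lemma measurableSet_wings : MeasurableSet (wings α β) := by
  refine IsClosed.measurableSet ?_
  exact (isClosed_le continuous_const continuous_fst.abs).inter
    (isClosed_le (((continuous_fst.abs.sub continuous_const).pow 2).add (continuous_snd.pow 2))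
      continuous_const)

lemma bounds_of_le (hα : 0 < α) (hβ : 0 < β) {p : ℝ × ℝ}
    (h : wingOffset α p.1 ^ 2 + p.2 ^ 2 ≤ β ^ 2) :
    |wingOffset α p.1| ≤ β ∧ |p.1| ≤ α + β ∧ |p.2| ≤ β := by
  have h1 : |wingOffset α p.1| ≤ β := abs_le_of_sq_le_sq (by nlinarith) hβ.le
  refine ⟨h1, ?_, abs_le_of_sq_le_sq (by nlinarith) hβ.le⟩
  rw [abs_wingOffset hα] at h1
  linarith [le_max_left (|p.1| - α) 0]

lemma bounds_of_mem (hα : 0 < α) (hβ : 0 < β) {p : ℝ × ℝ} (h : p ∈ stadium α β) :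
    |wingOffset α p.1| ≤ β ∧ |p.1| ≤ α + β ∧ |p.2| ≤ β :=
  bounds_of_le hα hβ ((mem_stadium_iff hα hβ p).1 h).le

lemma norm_le_of_le (hα : 0 < α) (hβ : 0 < β) {p : ℝ × ℝ}
    (h : wingOffset α p.1 ^ 2 + p.2 ^ 2 ≤ β ^ 2) : ‖p‖ ≤ α + β := by
  obtain ⟨-, h1, h2⟩ := bounds_of_le hα hβ h
  exact max_le h1 (by rw [Real.norm_eq_abs]; linarith)

lemma norm_le_of_mem (hα : 0 < α) (hβ : 0 < β) {p : ℝ × ℝ} (h : p ∈ stadium α β) :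
    ‖p‖ ≤ α + β :=
  norm_le_of_le hα hβ ((mem_stadium_iff hα hβ p).1 h).le

lemma stadium_subset_closedBall (hα : 0 < α) (hβ : 0 < β) :
    stadium α β ⊆ Metric.closedBall 0 (α + β) := fun p hp => by
  simpa using norm_le_of_mem hα hβ hp

lemma volume_stadium_lt_top (hα : 0 < α) (hβ : 0 < β) : volume (stadium α β) < ⊤ :=
  (measure_mono (stadium_subset_closedBall hα hβ)).trans_lt measure_closedBall_lt_top

lemma isFiniteMeasure_stadium (hα : 0 < α) (hβ : 0 < β) :
    IsFiniteMeasure (volume.restrict (stadium α β)) :=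
  ⟨by simpa using volume_stadium_lt_top hα hβ⟩

lemma ae_mem_stadium : ∀ᵐ p ∂(volume.restrict (stadium α β)), p ∈ stadium α β :=
  ae_restrict_mem measurableSet_stadium

/-- A contraction towards a point near the origin maps the stadium into itself. -/
lemma ball_subset_stadium (hα : 0 < α) (hβ : 0 < β) {p : ℝ × ℝ} (hp : p ∈ stadium α β)
    {t : ℝ} (ht : 0 ≤ t) (ht' : t < 1) :
    Metric.ball (t • p) ((1 - t) * min α β) ⊆ stadium α β := by
  intro q hq
  have ht1 : 0 < 1 - t := by linarith
  -- `q` is the convex combination `t p + (1 - t) b`, and `b` lies in a square inside the rectangle,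
  -- where `σ = 0`.
  set b : ℝ × ℝ := (1 - t)⁻¹ • (q - t • p) with hb
  have hbn : ‖b‖ < min α β := by
    rw [mem_ball_iff_norm] at hq
    rw [hb, norm_smul, norm_inv, Real.norm_of_nonneg ht1.le, inv_mul_lt_iff₀ ht1]
    exact hq
  have hq1 : q.1 = t * p.1 + (1 - t) * b.1 := by
    simp only [hb, Prod.smul_fst, Prod.fst_sub, smul_eq_mul]; field_simp; ring
  have hq2 : q.2 = t * p.2 + (1 - t) * b.2 := by
    simp only [hb, Prod.smul_snd, Prod.snd_sub, smul_eq_mul]; field_simp; ring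
  have hb1 : |b.1| ≤ α := (norm_fst_le b).trans (hbn.le.trans (min_le_left _ _))
  have hb2 : |b.2| < β := (norm_snd_le b).trans_lt (hbn.trans_le (min_le_right _ _))
  rw [mem_stadium_iff hα hβ] at hp ⊢
  have h1 := abs_wingOffset_convex hα (x := p.1) (b := b.1) ht ht'.le
  rw [wingOffset_of_abs_le hb1, abs_zero, mul_zero, add_zero, ← hq1] at h1
  have h2 : wingOffset α q.1 ^ 2 ≤ t ^ 2 * wingOffset α p.1 ^ 2 := by
    rw [← sq_abs, ← sq_abs (wingOffset α p.1), ← mul_pow]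
    exact pow_le_pow_left₀ (abs_nonneg _) h1 2
  have h3 : b.2 ^ 2 < β ^ 2 := sq_lt_sq' (by linarith [(abs_lt.1 hb2).1]) (abs_lt.1 hb2).2
  have h4 : t * wingOffset α p.1 ^ 2 + t * p.2 ^ 2 ≤ t * β ^ 2 := by nlinarith
  have h5 : t ^ 2 * wingOffset α p.1 ^ 2 ≤ t * wingOffset α p.1 ^ 2 := by
    have : t ^ 2 ≤ t := by nlinarith
    exact mul_le_mul_of_nonneg_right this (sq_nonneg _)
  have h6 : q.2 ^ 2 ≤ t * p.2 ^ 2 + (1 - t) * b.2 ^ 2 := by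
    have : t * p.2 ^ 2 + (1 - t) * b.2 ^ 2 - q.2 ^ 2 = t * (1 - t) * (p.2 - b.2) ^ 2 := by
      rw [hq2]; ring
    have := mul_nonneg (mul_nonneg ht ht1.le) (sq_nonneg (p.2 - b.2))
    linarith
  nlinarith

/-- The two sets differ only on the lines `|x| = α` and on the arcs, and each vertical slice of the
latter has at most two points. -/
lemma wings_inter_ae (hα : 0 < α) (hβ : 0 < β) :
    wings α β =ᵐ[volume] (stadium α β ∩ {p : ℝ × ℝ | α < |p.1|} : Set (ℝ × ℝ)) := by
  have hnull : volume {p : ℝ × ℝ | α ≤ |p.1| ∧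
      (|p.1| = α ∨ p.2 ^ 2 = β ^ 2 - (|p.1| - α) ^ 2)} = 0 := by
    have h1 : volume {p : ℝ × ℝ | |p.1| = α} = 0 := by
      have : {p : ℝ × ℝ | |p.1| = α} ⊆ ({α, -α} : Set ℝ) ×ˢ Set.univ := by
        rintro p hp
        rcases (abs_eq hα.le).1 hp with h | h <;> simp [h]
      refine measure_mono_null this ?_
      rw [Measure.volume_eq_prod, Measure.prod_prod, (Set.toFinite _).measure_zero, zero_mul]
    have h2 : volume {p : ℝ × ℝ | p.2 ^ 2 = β ^ 2 - (|p.1| - α) ^ 2} = 0 := by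
      rw [Measure.volume_eq_prod, Measure.measure_prod_null]
      · refine Eventually.of_forall fun x => ?_
        refine Set.Finite.measure_zero ?_ _
        refine (Set.toFinite {√(β ^ 2 - (|x| - α) ^ 2), -√(β ^ 2 - (|x| - α) ^ 2)}).subset ?_
        intro y hy
        have hy' : y ^ 2 = β ^ 2 - (|x| - α) ^ 2 := hy
        rw [← hy', Real.sqrt_sq_eq_abs]
        rcases abs_choice y with h | h <;> simp [h]
      · exact (isClosed_eq (by fun_prop) (by fun_prop)).measurableSet
    refine measure_mono_null ?_ (measure_union_null h1 h2)
    rintro p ⟨-, h | h⟩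
    · exact Or.inl h
    · exact Or.inr h
  have h0 : ∀ᵐ p : ℝ × ℝ, ¬(α ≤ |p.1| ∧
      (|p.1| = α ∨ p.2 ^ 2 = β ^ 2 - (|p.1| - α) ^ 2)) := by
    rw [ae_iff]; simpa only [not_not] using hnull
  filter_upwards [h0] with p hp
  apply propext
  change p ∈ wings α β ↔ p ∈ stadium α β ∧ α < |p.1|
  rw [mem_stadium_iff hα hβ]
  constructor
  · rintro ⟨h1, h2⟩
    have h3 : wingOffset α p.1 ^ 2 = (|p.1| - α) ^ 2 := by
      rw [← sq_abs, abs_wingOffset_of_le hα h1]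
    rw [h3]
    refine ⟨lt_of_le_of_ne h2 fun h => hp ⟨h1, Or.inr (by linarith)⟩,
      lt_of_le_of_ne h1 fun h => hp ⟨h1, Or.inl h.symm⟩⟩
  · rintro ⟨h1, h2⟩
    have h3 : wingOffset α p.1 ^ 2 = (|p.1| - α) ^ 2 := by
      rw [← sq_abs, abs_wingOffset_of_le hα h2.le]
    rw [h3] at h1
    exact ⟨h2.le, h1.le⟩

end Geometry

end Stadium

end

noncomputable section

namespace Stadium

/-! ### Integration over the boundary. -/

section BoundaryMeasure

variable {α β : ℝ}

instance isFiniteMeasure_boundaryMeasure : IsFiniteMeasure (boundaryMeasure α β) := by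
  unfold boundaryMeasure
  have h : ∀ (γ : ℝ → ℝ × ℝ) (a b : ℝ),
      IsFiniteMeasure (Measure.map γ (volume.restrict (Set.Icc a b))) :=
    fun γ a b => inferInstance
  have h' : ∀ (c : ℝ) (γ : ℝ → ℝ × ℝ) (a b : ℝ),
      IsFiniteMeasure (ENNReal.ofReal c • Measure.map γ (volume.restrict (Set.Icc a b))) :=
    fun c γ a b => Measure.smul_finite _ ENNReal.ofReal_ne_top
  infer_instance

lemma ae_boundaryMeasure (hα : 0 < α) :
    ∀ᵐ p ∂(boundaryMeasure α β), wingOffset α p.1 ^ 2 + p.2 ^ 2 = β ^ 2 := by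
  have hc : Continuous fun p : ℝ × ℝ => wingOffset α p.1 ^ 2 + p.2 ^ 2 :=
    ((continuous_wingOffset.comp continuous_fst).pow 2).add (continuous_snd.pow 2)
  have hm : MeasurableSet {p : ℝ × ℝ | wingOffset α p.1 ^ 2 + p.2 ^ 2 = β ^ 2} :=
    (isClosed_eq hc continuous_const).measurableSet
  have key : ∀ (γ : ℝ → ℝ × ℝ) (a b : ℝ), Continuous γ →
      (∀ t ∈ Set.Icc a b, wingOffset α (γ t).1 ^ 2 + (γ t).2 ^ 2 = β ^ 2) →
      ∀ᵐ p ∂(Measure.map γ (volume.restrict (Set.Icc a b))),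
        wingOffset α p.1 ^ 2 + p.2 ^ 2 = β ^ 2 := by
    intro γ a b hγ h
    rw [ae_map_iff hγ.aemeasurable hm]
    filter_upwards [ae_restrict_mem measurableSet_Icc] with t ht using h t ht
  unfold boundaryMeasure
  simp only [ae_add_measure_iff]
  have harc : ∀ θ ∈ Set.Icc (-(Real.pi / 2)) (Real.pi / 2),
      0 ≤ Real.cos θ := fun θ hθ => Real.cos_nonneg_of_mem_Icc hθ
  have hline : ∀ x ∈ Set.Icc (-α) α, wingOffset α x = 0 :=
    fun x hx => wingOffset_of_abs_le (abs_le.2 hx)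
  -- For `β ≤ 0` the factor `ENNReal.ofReal β` is zero, so the arcs carry no mass.
  rcases le_or_gt β 0 with hβ | hβ
  · refine ⟨⟨⟨key _ _ _ (by fun_prop) fun x hx => ?_, key _ _ _ (by fun_prop) fun x hx => ?_⟩, ?_⟩,
      ?_⟩
    · simp [hline x hx]
    · simp [hline x hx]
    · simp [ENNReal.ofReal_of_nonpos hβ]
    · simp [ENNReal.ofReal_of_nonpos hβ]
  · refine ⟨⟨⟨key _ _ _ (by fun_prop) fun x hx => ?_, key _ _ _ (by fun_prop) fun x hx => ?_⟩,
      Measure.ae_smul_measure (key _ _ _ (by fun_prop) fun θ hθ => ?_) _⟩,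
      Measure.ae_smul_measure (key _ _ _ (by fun_prop) fun θ hθ => ?_) _⟩
    · simp [hline x hx]
    · simp [hline x hx]
    · have := mul_nonneg hβ.le (harc θ hθ)
      simp only
      rw [wingOffset_of_le hα (by linarith)]
      linear_combination β ^ 2 * Real.sin_sq_add_cos_sq θ
    · have := mul_nonneg hβ.le (harc θ hθ)
      simp only
      rw [wingOffset_of_le_neg hα (by linarith)]
      linear_combination β ^ 2 * Real.sin_sq_add_cos_sq θ

variable {E : Type*} [NormedAddCommGroup E]

lemma integrable_boundaryMeasure (hα : 0 < α) (hβ : 0 < β) {f : ℝ × ℝ → E} (hf : Continuous f) :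
    Integrable f (boundaryMeasure α β) := by
  obtain ⟨C, hC⟩ := (isCompact_closedBall (0 : ℝ × ℝ) (α + β)).exists_bound_of_continuousOn
    hf.continuousOn
  refine Integrable.of_bound hf.aestronglyMeasurable C ?_
  filter_upwards [ae_boundaryMeasure hα] with p hp
  exact hC p (by simpa using norm_le_of_le hα hβ hp.le)

lemma integral_boundaryMeasure [NormedSpace ℝ E] (hα : 0 < α) (hβ : 0 < β) {f : ℝ × ℝ → E} (hf : Continuous f) :
    ∫ p, f p ∂(boundaryMeasure α β) =
      (∫ x in (-α)..α, f (x, β)) + (∫ x in (-α)..α, f (x, -β))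
      + β • (∫ θ in (-(Real.pi / 2))..(Real.pi / 2),
          f (α + β * Real.cos θ, β * Real.sin θ))
      + β • (∫ θ in (-(Real.pi / 2))..(Real.pi / 2),
          f (-(α + β * Real.cos θ), β * Real.sin θ)) := by
  have hi := integrable_boundaryMeasure hα hβ hf
  have key : ∀ (γ : ℝ → ℝ × ℝ) (a b : ℝ), a ≤ b → Continuous γ →
      ∫ p, f p ∂(Measure.map γ (volume.restrict (Set.Icc a b))) = ∫ t in a..b, f (γ t) := by
    intro γ a b hab hγ
    rw [integral_map hγ.aemeasurable hf.aestronglyMeasurable, integral_Icc_eq_integral_Ioc,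
      intervalIntegral.integral_of_le hab]
  have hpi := Real.pi_pos
  unfold boundaryMeasure at hi ⊢
  rw [integral_add_measure hi.left_of_add_measure hi.right_of_add_measure,
    integral_add_measure hi.left_of_add_measure.left_of_add_measure
      hi.left_of_add_measure.right_of_add_measure,
    integral_add_measure hi.left_of_add_measure.left_of_add_measure.left_of_add_measure
      hi.left_of_add_measure.left_of_add_measure.right_of_add_measure,
    integral_smul_measure, integral_smul_measure, ENNReal.toReal_ofReal hβ.le,
    key _ _ _ (by linarith) (by fun_prop), key _ _ _ (by linarith) (by fun_prop),
    key _ _ _ (by linarith) (by fun_prop), key _ _ _ (by linarith) (by fun_prop)]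

lemma continuous_outwardNormal_fst : Continuous fun p : ℝ × ℝ => (outwardNormal α β p).1 := by
  unfold outwardNormal; fun_prop

lemma continuous_outwardNormal_snd : Continuous fun p : ℝ × ℝ => (outwardNormal α β p).2 := by
  unfold outwardNormal; fun_prop

lemma outwardNormal_fst (p : ℝ × ℝ) : (outwardNormal α β p).1 = wingOffset α p.1 / β := rfl

lemma outwardNormal_snd (p : ℝ × ℝ) : (outwardNormal α β p).2 = p.2 / β := rfl

end BoundaryMeasure

/-! ### The divergence theorem on the stadium. -/

section Green

variable {α β : ℝ} {E : Type*} [NormedAddCommGroup E]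

/-- `f` is continuous and has the locally bounded partial derivatives `fx` and `fy`, where the
horizontal derivative may fail to exist on the lines `x = ± α`. -/
structure HasPartials [NormedSpace ℝ E] (α : ℝ) (f fx fy : ℝ × ℝ → E) : Prop where
  continuous : Continuous f
  deriv_x : ∀ x y : ℝ, |x| ≠ α → HasDerivAt (fun s => f (s, y)) (fx (x, y)) x
  deriv_y : ∀ x y : ℝ, HasDerivAt (fun s => f (x, s)) (fy (x, y)) y
  meas_x : StronglyMeasurable fx
  meas_y : StronglyMeasurable fy
  bounded : ∀ r, ∃ M, ∀ p, ‖p‖ ≤ r → ‖fx p‖ ≤ M ∧ ‖fy p‖ ≤ M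

lemma integrableOn_stadium_of_bounded (hα : 0 < α) (hβ : 0 < β) {g : ℝ × ℝ → E}
    (hg : StronglyMeasurable g) (hb : ∃ M, ∀ p, ‖p‖ ≤ α + β → ‖g p‖ ≤ M) :
    IntegrableOn g (stadium α β) := by
  obtain ⟨M, hM⟩ := hb
  have := isFiniteMeasure_stadium hα hβ
  refine Integrable.of_bound hg.aestronglyMeasurable M ?_
  filter_upwards [ae_mem_stadium] with p hp using hM p (norm_le_of_mem hα hβ hp)

variable [NormedSpace ℝ E] [CompleteSpace E]

/-- The fundamental theorem of calculus allows a countable exceptional set, here `{α, -α}`. This is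
why kinks of the weights on these lines are harmless. -/
lemma HasPartials.integral_slice_x {f fx fy : ℝ × ℝ → E} (h : HasPartials α f fx fy)
    {k : ℝ} (hk : 0 ≤ k) (y : ℝ) :
    ∫ x in Set.Ioo (-k) k, fx (x, y) = f (k, y) - f (-k, y) := by
  rw [← integral_Ioc_eq_integral_Ioo, ← intervalIntegral.integral_of_le (by linarith)]
  refine integral_eq_of_hasDerivAt_off_countable_of_le (fun s => f (s, y)) _ (by linarith)
    (s := {α, -α}) (Set.toFinite _).countable
    (h.continuous.comp (by fun_prop)).continuousOn ?_ ?_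
  · rintro x ⟨-, hx⟩
    refine h.deriv_x x y fun h' => hx ?_
    rcases (abs_eq (by rw [← h']; exact abs_nonneg _)).1 h' with h' | h' <;> simp [h']
  · obtain ⟨M, hM⟩ := h.bounded (max k |y|)
    rw [intervalIntegrable_iff_integrableOn_Icc_of_le (by linarith)]
    refine Measure.integrableOn_of_bounded (M := M) (by simp)
      (h.meas_x.comp_measurable measurable_prodMk_right).aestronglyMeasurable ?_
    filter_upwards [ae_restrict_mem measurableSet_Icc] with x hx
    exact (hM (x, y) (max_le_max (abs_le.2 hx) le_rfl)).1

lemma HasPartials.integral_slice_y {f fx fy : ℝ × ℝ → E} (h : HasPartials α f fx fy)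
    {k : ℝ} (hk : 0 ≤ k) (x : ℝ) :
    ∫ y in Set.Ioo (-k) k, fy (x, y) = f (x, k) - f (x, -k) := by
  rw [← integral_Ioc_eq_integral_Ioo, ← intervalIntegral.integral_of_le (by linarith)]
  refine intervalIntegral.integral_eq_sub_of_hasDerivAt (f := fun s => f (x, s))
    (fun y _ => h.deriv_y x y) ?_
  obtain ⟨M, hM⟩ := h.bounded (max |x| k)
  rw [intervalIntegrable_iff_integrableOn_Icc_of_le (by linarith)]
  refine Measure.integrableOn_of_bounded (M := M) (by simp)
    (h.meas_y.comp_measurable measurable_prodMk_left).aestronglyMeasurable ?_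
  filter_upwards [ae_restrict_mem measurableSet_Icc] with y hy
  exact (hM (x, y) (max_le_max le_rfl (abs_le.2 hy))).2

lemma preimage_slice_x (hα : 0 < α) (hβ : 0 < β) {y : ℝ} (hy : y ∈ Set.Ioo (-β) β) :
    (fun x : ℝ => (x, y)) ⁻¹' stadium α β =
      Set.Ioo (-(α + √(β ^ 2 - y ^ 2))) (α + √(β ^ 2 - y ^ 2)) := by
  have h0 : 0 < β ^ 2 - y ^ 2 := by nlinarith [hy.1, hy.2]
  have h1 := Real.sqrt_pos.2 h0
  ext x
  rw [Set.mem_preimage, mem_stadium_iff hα hβ, ← sq_abs, abs_wingOffset hα, Set.mem_Ioo, ← abs_lt]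
  simp only
  rw [← lt_sub_iff_add_lt, ← Real.lt_sqrt (le_max_right _ _), max_lt_iff, sub_lt_iff_lt_add']
  exact and_iff_left h1

lemma preimage_slice_y (hα : 0 < α) (hβ : 0 < β) (x : ℝ) :
    (fun y : ℝ => (x, y)) ⁻¹' stadium α β =
      Set.Ioo (-√(β ^ 2 - wingOffset α x ^ 2)) (√(β ^ 2 - wingOffset α x ^ 2)) := by
  ext y
  rw [Set.mem_preimage, mem_stadium_iff hα hβ, Set.mem_Ioo, ← abs_lt,
    Real.lt_sqrt (abs_nonneg _), sq_abs]
  exact lt_sub_iff_add_lt'.symm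

lemma cos_nonneg_of_mem_uIcc :
    ∀ θ ∈ Set.uIcc (-(Real.pi / 2)) (Real.pi / 2), 0 ≤ Real.cos θ := by
  intro θ hθ
  rw [Set.uIcc_of_le (by linarith [Real.pi_pos])] at hθ
  exact Real.cos_nonneg_of_mem_Icc hθ

lemma integral_stadium_deriv_x (hα : 0 < α) (hβ : 0 < β) {f fx fy : ℝ × ℝ → E}
    (h : HasPartials α f fx fy) :
    ∫ p in stadium α β, fx p =
      ∫ y in (-β)..β, (f (α + √(β ^ 2 - y ^ 2), y) - f (-(α + √(β ^ 2 - y ^ 2)), y)) := by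
  have hi : IntegrableOn fx (stadium α β) := integrableOn_stadium_of_bounded hα hβ h.meas_x <| by
    obtain ⟨M, hM⟩ := h.bounded (α + β)
    exact ⟨M, fun p hp => (hM p hp).1⟩
  rw [← integrable_indicator_iff measurableSet_stadium] at hi
  rw [← integral_indicator measurableSet_stadium, Measure.volume_eq_prod,
    integral_prod_symm _ (by rwa [← Measure.volume_eq_prod]),
    intervalIntegral.integral_of_le (by linarith), integral_Ioc_eq_integral_Ioo,
    ← integral_indicator measurableSet_Ioo]
  congr 1
  ext y
  have e : (fun x => (stadium α β).indicator fx (x, y)) =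
      ((fun x : ℝ => (x, y)) ⁻¹' stadium α β).indicator fun x => fx (x, y) := rfl
  rw [e]
  by_cases hy : y ∈ Set.Ioo (-β) β
  · rw [Set.indicator_of_mem hy, preimage_slice_x hα hβ hy, integral_indicator measurableSet_Ioo,
      h.integral_slice_x (by positivity)]
  · rw [Set.indicator_of_notMem hy]
    have : (fun x : ℝ => (x, y)) ⁻¹' stadium α β = ∅ := by
      refine Set.eq_empty_of_forall_notMem fun x hx => hy ?_
      have := (mem_stadium_iff hα hβ _).1 hx
      exact abs_lt.1 (abs_lt_of_sq_lt_sq (by nlinarith [sq_nonneg (wingOffset α x)]) hβ.le)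
    simp [this]

lemma sqrt_eq_zero_of_not_mem (hα : 0 < α) {x : ℝ} (hβ : 0 < β)
    (hx : x ∉ Set.Ioo (-(α + β)) (α + β)) :
    √(β ^ 2 - wingOffset α x ^ 2) = 0 := by
  refine Real.sqrt_eq_zero_of_nonpos ?_
  rw [Set.mem_Ioo, ← abs_lt, not_lt] at hx
  rw [← sq_abs (wingOffset α x), abs_wingOffset_of_le hα (by linarith)]
  nlinarith

lemma integral_stadium_deriv_y (hα : 0 < α) (hβ : 0 < β) {f fx fy : ℝ × ℝ → E}
    (h : HasPartials α f fx fy) :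
    ∫ p in stadium α β, fy p =
      ∫ x in (-(α + β))..(α + β), (f (x, √(β ^ 2 - wingOffset α x ^ 2))
        - f (x, -√(β ^ 2 - wingOffset α x ^ 2))) := by
  have hi : IntegrableOn fy (stadium α β) := integrableOn_stadium_of_bounded hα hβ h.meas_y <| by
    obtain ⟨M, hM⟩ := h.bounded (α + β)
    exact ⟨M, fun p hp => (hM p hp).2⟩
  rw [← integrable_indicator_iff measurableSet_stadium] at hi
  rw [← integral_indicator measurableSet_stadium, Measure.volume_eq_prod,
    integral_prod _ (by rwa [← Measure.volume_eq_prod]),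
    intervalIntegral.integral_of_le (by linarith), integral_Ioc_eq_integral_Ioo,
    ← integral_indicator measurableSet_Ioo]
  congr 1
  ext x
  have e : (fun y => (stadium α β).indicator fy (x, y)) =
      ((fun y : ℝ => (x, y)) ⁻¹' stadium α β).indicator fun y => fy (x, y) := rfl
  rw [e, preimage_slice_y hα hβ, integral_indicator measurableSet_Ioo,
      h.integral_slice_y (by positivity)]
  by_cases hx : x ∈ Set.Ioo (-(α + β)) (α + β)
  · rw [Set.indicator_of_mem hx]
  · rw [Set.indicator_of_notMem hx, sqrt_eq_zero_of_not_mem hα hβ hx]; simp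

/-- The divergence theorem on the stadium, for horizontal vector fields. -/
theorem HasPartials.green_x (hα : 0 < α) (hβ : 0 < β) {f fx fy : ℝ × ℝ → E}
    (h : HasPartials α f fx fy) :
    ∫ p in stadium α β, fx p =
      ∫ p, (outwardNormal α β p).1 • f p ∂(boundaryMeasure α β) := by
  have hf := h.continuous
  rw [integral_stadium_deriv_x hα hβ h, integral_boundaryMeasure hα hβ
    (f := fun p => (outwardNormal α β p).1 • f p) (continuous_outwardNormal_fst.smul hf)]
  have hpi := Real.pi_pos
  have hside : ∀ y : ℝ, ∫ x in (-α)..α, (outwardNormal α β (x, y)).1 • f (x, y) = 0 := by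
    intro y
    rw [← intervalIntegral.integral_zero (E := E) (μ := volume) (a := -α) (b := α)]
    refine intervalIntegral.integral_congr fun x hx => ?_
    rw [Set.uIcc_of_le (by linarith)] at hx
    simp [outwardNormal_fst, wingOffset_of_abs_le (abs_le.2 hx)]
  have hcos := cos_nonneg_of_mem_uIcc
  -- The substitution `y = β sin θ` parametrizes the ends of the horizontal slices by the arcs. Its
  -- Jacobian `β cos θ` is `β |n₁|`.
  have hsub : ∀ g : ℝ → E, Continuous g → ∫ y in (-β)..β, g y =
      ∫ θ in (-(Real.pi / 2))..(Real.pi / 2), (β * Real.cos θ) • g (β * Real.sin θ) := by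
    intro g hg
    have := intervalIntegral.integral_deriv_smul_comp (a := -(Real.pi / 2)) (b := Real.pi / 2)
      (f := fun θ => β * Real.sin θ) (f' := fun θ => β * Real.cos θ) (g := g)
      (fun θ _ => (Real.hasDerivAt_sin θ).const_mul β) (by fun_prop) hg
    simp only [Real.sin_neg, Real.sin_pi_div_two, mul_neg, mul_one] at this
    exact this.symm
  have hright : ∫ y in (-β)..β, f (α + √(β ^ 2 - y ^ 2), y) =
      β • ∫ θ in (-(Real.pi / 2))..(Real.pi / 2),
        (outwardNormal α β (α + β * Real.cos θ, β * Real.sin θ)).1 •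
          f (α + β * Real.cos θ, β * Real.sin θ) := by
    rw [hsub _ (by fun_prop), ← intervalIntegral.integral_smul]
    refine intervalIntegral.integral_congr fun θ hθ => ?_
    have h1 := mul_nonneg hβ.le (hcos θ hθ)
    have h2 : √(β ^ 2 - (β * Real.sin θ) ^ 2) = β * Real.cos θ := by
      rw [← Real.sqrt_sq h1]; congr 1
      linear_combination (-β ^ 2) * Real.sin_sq_add_cos_sq θ
    simp only [outwardNormal_fst]
    rw [h2, wingOffset_of_le hα (by linarith), smul_smul]
    congr 1
    field_simp; ring
  have hleft : ∫ y in (-β)..β, f (-(α + √(β ^ 2 - y ^ 2)), y) =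
      -(β • ∫ θ in (-(Real.pi / 2))..(Real.pi / 2),
        (outwardNormal α β (-(α + β * Real.cos θ), β * Real.sin θ)).1 •
          f (-(α + β * Real.cos θ), β * Real.sin θ)) := by
    rw [hsub _ (by fun_prop), ← intervalIntegral.integral_smul, ← intervalIntegral.integral_neg]
    refine intervalIntegral.integral_congr fun θ hθ => ?_
    have h1 := mul_nonneg hβ.le (hcos θ hθ)
    have h2 : √(β ^ 2 - (β * Real.sin θ) ^ 2) = β * Real.cos θ := by
      rw [← Real.sqrt_sq h1]; congr 1
      linear_combination (-β ^ 2) * Real.sin_sq_add_cos_sq θ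
    simp only [outwardNormal_fst]
    rw [h2, wingOffset_of_le_neg hα (by linarith), smul_smul, ← neg_smul]
    congr 1
    field_simp; ring
  have hc : ∀ g : ℝ → E, Continuous g → IntervalIntegrable g volume (-β) β :=
    fun g hg => hg.intervalIntegrable _ _
  rw [intervalIntegral.integral_sub (hc _ (by fun_prop)) (hc _ (by fun_prop)), hside, hside,
    hright, hleft]
  simp

/-- The divergence theorem on the stadium, for vertical vector fields. -/
theorem HasPartials.green_y (hα : 0 < α) (hβ : 0 < β) {f fx fy : ℝ × ℝ → E}
    (h : HasPartials α f fx fy) :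
    ∫ p in stadium α β, fy p =
      ∫ p, (outwardNormal α β p).2 • f p ∂(boundaryMeasure α β) := by
  have hf := h.continuous
  rw [integral_stadium_deriv_y hα hβ h, integral_boundaryMeasure hα hβ
    (f := fun p => (outwardNormal α β p).2 • f p) (continuous_outwardNormal_snd.smul hf)]
  have hpi := Real.pi_pos
  have hcos := cos_nonneg_of_mem_uIcc
  have hw := continuous_wingOffset (α := α)
  set T : ℝ → E := fun x => f (x, √(β ^ 2 - wingOffset α x ^ 2)) with hT
  set B : ℝ → E := fun x => f (x, -√(β ^ 2 - wingOffset α x ^ 2)) with hB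
  have hTc : Continuous T := by fun_prop
  have hBc : Continuous B := by fun_prop
  have hc : ∀ (g : ℝ → E) (a b : ℝ), Continuous g → IntervalIntegrable g volume a b :=
    fun g a b hg => hg.intervalIntegrable _ _
  have hsplit : ∀ g : ℝ → E, Continuous g → ∫ x in (-(α + β))..(α + β), g x =
      (∫ x in (-(α + β))..(-α), g x) + (∫ x in (-α)..α, g x) + ∫ x in α..(α + β), g x := by
    intro g hg
    rw [intervalIntegral.integral_add_adjacent_intervals (hc _ _ _ hg) (hc _ _ _ hg),
      intervalIntegral.integral_add_adjacent_intervals (hc _ _ _ hg) (hc _ _ _ hg)]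
  have hside : ∀ s : ℝ, ∫ x in (-α)..α, (outwardNormal α β (x, s * β)).2 • f (x, s * β) =
      s • ∫ x in (-α)..α, f (x, s * √(β ^ 2 - wingOffset α x ^ 2)) := by
    intro s
    rw [← intervalIntegral.integral_smul]
    refine intervalIntegral.integral_congr fun x hx => ?_
    rw [Set.uIcc_of_le (by linarith)] at hx
    simp only [outwardNormal_snd]
    rw [wingOffset_of_abs_le (abs_le.2 hx)]
    simp [hβ.ne', Real.sqrt_sq hβ.le]
  have hside1 : ∫ x in (-α)..α, (outwardNormal α β (x, β)).2 • f (x, β) = ∫ x in (-α)..α, T x := by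
    simpa using hside 1
  have hside2 : ∫ x in (-α)..α, (outwardNormal α β (x, -β)).2 • f (x, -β) =
      -∫ x in (-α)..α, B x := by
    simpa using hside (-1)
  -- The sign `s = ±1` selects the right or the left semicircle.
  have harc : ∀ s : ℝ, |s| = 1 → β • ∫ θ in (-(Real.pi / 2))..(Real.pi / 2),
      (outwardNormal α β (s * (α + β * Real.cos θ), β * Real.sin θ)).2 •
        f (s * (α + β * Real.cos θ), β * Real.sin θ) =
      s • ((∫ x in (s * α)..(s * (α + β)), T x) - ∫ x in (s * α)..(s * (α + β)), B x) := by
    intro s hs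
    have hs2 : s * s = 1 := by rw [← abs_mul_abs_self, hs, one_mul]
    have hwing : ∀ θ ∈ Set.uIcc (-(Real.pi / 2)) (Real.pi / 2),
        wingOffset α (s * (α + β * Real.cos θ)) ^ 2 = (β * Real.cos θ) ^ 2 := by
      intro θ hθ
      have h1 := mul_nonneg hβ.le (hcos θ hθ)
      rw [← sq_abs, abs_wingOffset_of_le hα, abs_mul, hs, abs_of_nonneg (by linarith)]
      · congr 1; ring
      · rw [abs_mul, hs, abs_of_nonneg (by linarith)]; linarith
    have hd : ∀ θ, HasDerivAt (fun θ => s * (α + β * Real.cos θ)) (-(s * (β * Real.sin θ))) θ := by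
      intro θ
      exact ((((Real.hasDerivAt_cos θ).const_mul β).const_add α).const_mul s).congr_deriv
        (by ring)
    -- Each semicircle is cut at `θ = 0`: its upper half lies on the graph used in `T`, its lower
    -- half on the graph used in `B`.
    rw [← intervalIntegral.integral_smul,
      ← intervalIntegral.integral_add_adjacent_intervals (b := 0)
        (Continuous.intervalIntegrable (by simp only [outwardNormal_snd]; fun_prop) _ _)
        (Continuous.intervalIntegrable (by simp only [outwardNormal_snd]; fun_prop) _ _)]
    have hup : ∫ θ in (0 : ℝ)..(Real.pi / 2), β •
        (outwardNormal α β (s * (α + β * Real.cos θ), β * Real.sin θ)).2 •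
          f (s * (α + β * Real.cos θ), β * Real.sin θ) =
        s • ∫ x in (s * α)..(s * (α + β)), T x := by
      have := intervalIntegral.integral_deriv_smul_comp (a := 0) (b := Real.pi / 2)
        (f := fun θ => s * (α + β * Real.cos θ)) (f' := fun θ => -(s * (β * Real.sin θ))) (g := T)
        (fun θ _ => hd θ) (by fun_prop) hTc
      simp only [Real.cos_zero, Real.cos_pi_div_two, mul_zero, add_zero, mul_one] at this
      rw [intervalIntegral.integral_symm (s * (α + β)), ← this, ← intervalIntegral.integral_neg,
        ← intervalIntegral.integral_smul]
      refine intervalIntegral.integral_congr fun θ hθ => ?_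
      rw [Set.uIcc_of_le (by linarith)] at hθ
      have hθ' : θ ∈ Set.uIcc (-(Real.pi / 2)) (Real.pi / 2) := by
        rw [Set.uIcc_of_le (by linarith)]; exact ⟨by linarith [hθ.1], hθ.2⟩
      have h1 : 0 ≤ β * Real.sin θ :=
        mul_nonneg hβ.le (Real.sin_nonneg_of_nonneg_of_le_pi hθ.1 (by linarith [hθ.2]))
      have h2 : √(β ^ 2 - (β * Real.cos θ) ^ 2) = β * Real.sin θ := by
        rw [← Real.sqrt_sq h1]; congr 1
        linear_combination (-β ^ 2) * Real.sin_sq_add_cos_sq θ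
      simp only [outwardNormal_snd, hT, Function.comp_apply]
      rw [hwing θ hθ', h2, smul_smul, ← neg_smul, smul_smul]
      congr 1
      have : s * - -(s * (β * Real.sin θ)) = s * s * (β * Real.sin θ) := by ring
      rw [this, hs2]; field_simp
    have hdown : ∫ θ in (-(Real.pi / 2))..(0 : ℝ), β •
        (outwardNormal α β (s * (α + β * Real.cos θ), β * Real.sin θ)).2 •
          f (s * (α + β * Real.cos θ), β * Real.sin θ) =
        -(s • ∫ x in (s * α)..(s * (α + β)), B x) := by
      have := intervalIntegral.integral_deriv_smul_comp (a := -(Real.pi / 2)) (b := 0)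
        (f := fun θ => s * (α + β * Real.cos θ)) (f' := fun θ => -(s * (β * Real.sin θ))) (g := B)
        (fun θ _ => hd θ) (by fun_prop) hBc
      simp only [Real.cos_zero, Real.cos_neg, Real.cos_pi_div_two, mul_zero, add_zero,
        mul_one] at this
      rw [← this, ← intervalIntegral.integral_smul, ← intervalIntegral.integral_neg]
      refine intervalIntegral.integral_congr fun θ hθ => ?_
      rw [Set.uIcc_of_le (by linarith)] at hθ
      have hθ' : θ ∈ Set.uIcc (-(Real.pi / 2)) (Real.pi / 2) := by
        rw [Set.uIcc_of_le (by linarith)]; exact ⟨hθ.1, by linarith [hθ.2]⟩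
      have h1 : 0 ≤ -(β * Real.sin θ) := by
        have := Real.sin_nonpos_of_nonpos_of_neg_pi_le hθ.2 (by linarith [hθ.1])
        nlinarith
      have h2 : √(β ^ 2 - (β * Real.cos θ) ^ 2) = -(β * Real.sin θ) := by
        rw [← Real.sqrt_sq h1]; congr 1
        linear_combination (-β ^ 2) * Real.sin_sq_add_cos_sq θ
      simp only [outwardNormal_snd, hB, Function.comp_apply]
      rw [hwing θ hθ', h2, neg_neg, smul_smul, smul_smul, ← neg_smul]
      congr 1
      have : -(s * -(s * (β * Real.sin θ))) = s * s * (β * Real.sin θ) := by ring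
      rw [this, hs2]; field_simp
    rw [hup, hdown, smul_sub]; abel
  have harc1 := harc 1 (by simp)
  have harc2 := harc (-1) (by simp)
  simp only [one_mul, one_smul, neg_mul, neg_smul] at harc1 harc2
  rw [hside1, hside2, harc1, harc2, intervalIntegral.integral_sub (hc _ _ _ hTc) (hc _ _ _ hBc),
    hsplit T hTc, hsplit B hBc, intervalIntegral.integral_symm (-(α + β)) (-α),
    intervalIntegral.integral_symm (-(α + β)) (-α)]
  abel

end Green

end Stadium

end

noncomputable section

namespace Stadium

open scoped RealInnerProductSpace

/-! ### Weighted real pairings and convergence in `L²`. -/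

section Pairing

variable {μ : Measure (ℝ × ℝ)}

/-- A real weight which is measurable and bounded almost everywhere. -/
structure IsBddWeight (μ : Measure (ℝ × ℝ)) (c : ℝ × ℝ → ℝ) (M : ℝ) : Prop where
  meas : AEStronglyMeasurable c μ
  bound : ∀ᵐ p ∂μ, |c p| ≤ M

/-- The real part of the weighted sesquilinear pairing of `f` and `g`. -/
def pairing (μ : Measure (ℝ × ℝ)) (c : ℝ × ℝ → ℝ) (f g : ℝ × ℝ → ℂ) : ℝ :=
  ∫ p, c p * ⟪f p, g p⟫ ∂μ

lemma IsBddWeight.memLp_smul {c : ℝ × ℝ → ℝ} {M : ℝ} (hc : IsBddWeight μ c M) {f : ℝ × ℝ → ℂ}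
    (hf : MemLp f 2 μ) : MemLp (fun p => c p • f p) 2 μ := by
  refine MemLp.of_le_mul (c := M) hf (hc.meas.smul hf.1) ?_
  filter_upwards [hc.bound] with p hp
  rw [norm_smul]
  exact mul_le_mul_of_nonneg_right hp (norm_nonneg _)

lemma IsBddWeight.eLpNorm_smul_le {c : ℝ × ℝ → ℝ} {M : ℝ} (hc : IsBddWeight μ c M)
    (f : ℝ × ℝ → ℂ) :
    eLpNorm (fun p => c p • f p) 2 μ ≤ ENNReal.ofReal M * eLpNorm f 2 μ := by
  refine eLpNorm_le_mul_eLpNorm_of_ae_le_mul ?_ 2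
  filter_upwards [hc.bound] with p hp
  rw [norm_smul]
  exact mul_le_mul_of_nonneg_right hp (norm_nonneg _)

/-- Cauchy–Schwarz and continuity under `L²` limits are then inherited from the Hilbert space `L²`.
-/
lemma pairing_eq_inner {c : ℝ × ℝ → ℝ} {M : ℝ} (hc : IsBddWeight μ c M) {f g : ℝ × ℝ → ℂ}
    (hf : MemLp f 2 μ) (hg : MemLp g 2 μ) :
    pairing μ c f g = ⟪(hc.memLp_smul hf).toLp, hg.toLp⟫ := by
  rw [L2.inner_def, pairing]
  refine integral_congr_ae ?_
  filter_upwards [(hc.memLp_smul hf).coeFn_toLp, hg.coeFn_toLp] with p h1 h2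
  rw [h1, h2, real_inner_smul_left]

lemma integrable_pairing {c : ℝ × ℝ → ℝ} {M : ℝ} (hc : IsBddWeight μ c M) {f g : ℝ × ℝ → ℂ}
    (hf : MemLp f 2 μ) (hg : MemLp g 2 μ) : Integrable (fun p => c p * ⟪f p, g p⟫) μ := by
  have := L2.integrable_inner (𝕜 := ℝ) (hc.memLp_smul hf).toLp hg.toLp
  refine this.congr ?_
  filter_upwards [(hc.memLp_smul hf).coeFn_toLp, hg.coeFn_toLp] with p h1 h2
  rw [h1, h2, real_inner_smul_left]

lemma l2Norm_nonneg (f : ℝ × ℝ → ℂ) : 0 ≤ l2Norm μ f := ENNReal.toReal_nonneg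

lemma l2Norm_congr {f g : ℝ × ℝ → ℂ} (h : f =ᵐ[μ] g) : l2Norm μ f = l2Norm μ g := by
  rw [l2Norm, l2Norm, eLpNorm_congr_ae h]

lemma abs_pairing_le {c : ℝ × ℝ → ℝ} {M : ℝ} (hM : 0 ≤ M) (hc : IsBddWeight μ c M)
    {f g : ℝ × ℝ → ℂ} (hf : MemLp f 2 μ) (hg : MemLp g 2 μ) :
    |pairing μ c f g| ≤ M * l2Norm μ f * l2Norm μ g := by
  rw [pairing_eq_inner hc hf hg]
  refine (abs_real_inner_le_norm _ _).trans ?_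
  rw [Lp.norm_toLp, Lp.norm_toLp]
  refine mul_le_mul_of_nonneg_right ?_ ENNReal.toReal_nonneg
  rw [l2Norm, ← ENNReal.toReal_ofReal hM, ← ENNReal.toReal_mul]
  exact ENNReal.toReal_mono (ENNReal.mul_ne_top ENNReal.ofReal_ne_top hf.2.ne)
    (hc.eLpNorm_smul_le f)

lemma pairing_comm (c : ℝ × ℝ → ℝ) (f g : ℝ × ℝ → ℂ) : pairing μ c f g = pairing μ c g f := by
  simp only [pairing, real_inner_comm]

lemma isBddWeight_one : IsBddWeight μ (fun _ => 1) 1 :=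
  ⟨aestronglyMeasurable_const, by simp⟩

lemma pairing_one_self {f : ℝ × ℝ → ℂ} (hf : MemLp f 2 μ) :
    pairing μ (fun _ => 1) f f = l2Norm μ f ^ 2 := by
  rw [pairing_eq_inner isBddWeight_one hf hf]
  have : (isBddWeight_one.memLp_smul hf).toLp = hf.toLp := by
    rw [MemLp.toLp_eq_toLp_iff]; simp
  rw [this, real_inner_self_eq_norm_sq, Lp.norm_toLp, l2Norm]

lemma pairing_congr {c c' : ℝ × ℝ → ℝ} {f f' g g' : ℝ × ℝ → ℂ} (hc : c =ᵐ[μ] c')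
    (hf : f =ᵐ[μ] f') (hg : g =ᵐ[μ] g') : pairing μ c f g = pairing μ c' f' g' := by
  refine integral_congr_ae ?_
  filter_upwards [hc, hf, hg] with p h1 h2 h3
  rw [h1, h2, h3]

lemma pairing_mono {c c' : ℝ × ℝ → ℝ} {M M' : ℝ} (hc : IsBddWeight μ c M)
    (hc' : IsBddWeight μ c' M') {f : ℝ × ℝ → ℂ} (hf : MemLp f 2 μ) (h : ∀ᵐ p ∂μ, c p ≤ c' p) :
    pairing μ c f f ≤ pairing μ c' f f := by
  refine integral_mono_ae (integrable_pairing hc hf hf) (integrable_pairing hc' hf hf) ?_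
  filter_upwards [h] with p hp
  exact mul_le_mul_of_nonneg_right hp real_inner_self_nonneg

lemma pairing_nonneg {c : ℝ × ℝ → ℝ} {f : ℝ × ℝ → ℂ} (h : ∀ᵐ p ∂μ, 0 ≤ c p) :
    0 ≤ pairing μ c f f := by
  refine integral_nonneg_of_ae ?_
  filter_upwards [h] with p hp
  exact mul_nonneg hp real_inner_self_nonneg

lemma pairing_smul_left (c d : ℝ × ℝ → ℝ) (f g : ℝ × ℝ → ℂ) :
    pairing μ c (fun p => d p • f p) g = pairing μ (fun p => c p * d p) f g := by
  simp only [pairing, real_inner_smul_left, mul_assoc]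

lemma pairing_smul_right (c d : ℝ × ℝ → ℝ) (f g : ℝ × ℝ → ℂ) :
    pairing μ c f (fun p => d p • g p) = pairing μ (fun p => c p * d p) f g := by
  simp only [pairing, real_inner_smul_right, mul_assoc]

lemma pairing_const_mul (a : ℝ) (c : ℝ × ℝ → ℝ) (f g : ℝ × ℝ → ℂ) :
    pairing μ (fun p => a * c p) f g = a * pairing μ c f g := by
  simp only [pairing, mul_assoc, integral_const_mul]

lemma pairing_add_left {c : ℝ × ℝ → ℝ} {M : ℝ} (hc : IsBddWeight μ c M) {f f' g : ℝ × ℝ → ℂ}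
    (hf : MemLp f 2 μ) (hf' : MemLp f' 2 μ) (hg : MemLp g 2 μ) :
    pairing μ c (fun p => f p + f' p) g = pairing μ c f g + pairing μ c f' g := by
  simp only [pairing, inner_add_left, mul_add]
  exact integral_add (integrable_pairing hc hf hg) (integrable_pairing hc hf' hg)

lemma pairing_sub_left {c : ℝ × ℝ → ℝ} {M : ℝ} (hc : IsBddWeight μ c M) {f f' g : ℝ × ℝ → ℂ}
    (hf : MemLp f 2 μ) (hf' : MemLp f' 2 μ) (hg : MemLp g 2 μ) :
    pairing μ c (fun p => f p - f' p) g = pairing μ c f g - pairing μ c f' g := by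
  simp only [pairing, inner_sub_left, mul_sub]
  exact integral_sub (integrable_pairing hc hf hg) (integrable_pairing hc hf' hg)

lemma pairing_add_right {c : ℝ × ℝ → ℝ} {M : ℝ} (hc : IsBddWeight μ c M) {f g g' : ℝ × ℝ → ℂ}
    (hf : MemLp f 2 μ) (hg : MemLp g 2 μ) (hg' : MemLp g' 2 μ) :
    pairing μ c f (fun p => g p + g' p) = pairing μ c f g + pairing μ c f g' := by
  rw [pairing_comm, pairing_add_left hc hg hg' hf, pairing_comm, pairing_comm c g']

lemma pairing_add_weight {c c' : ℝ × ℝ → ℝ} {M M' : ℝ} (hc : IsBddWeight μ c M)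
    (hc' : IsBddWeight μ c' M') {f g : ℝ × ℝ → ℂ} (hf : MemLp f 2 μ) (hg : MemLp g 2 μ) :
    pairing μ (fun p => c p + c' p) f g = pairing μ c f g + pairing μ c' f g := by
  simp only [pairing, add_mul]
  exact integral_add (integrable_pairing hc hf hg) (integrable_pairing hc' hf hg)

/-- Convergence in `L²(μ)`. -/
structure TendstoL2 (μ : Measure (ℝ × ℝ)) (F : ℕ → ℝ × ℝ → ℂ) (f : ℝ × ℝ → ℂ) : Prop where
  memLp : ∀ n, MemLp (F n) 2 μ
  memLp_lim : MemLp f 2 μ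
  tendsto : Tendsto (fun n => eLpNorm (fun p => F n p - f p) 2 μ) atTop (𝓝 0)

lemma TendstoL2.tendsto_toLp {F : ℕ → ℝ × ℝ → ℂ} {f : ℝ × ℝ → ℂ} (h : TendstoL2 μ F f) :
    Tendsto (fun n => (h.memLp n).toLp) atTop (𝓝 h.memLp_lim.toLp) :=
  (Lp.tendsto_Lp_iff_tendsto_eLpNorm'' _ h.memLp _ h.memLp_lim).2 h.tendsto

lemma TendstoL2.smul {F : ℕ → ℝ × ℝ → ℂ} {f : ℝ × ℝ → ℂ} (h : TendstoL2 μ F f)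
    {c : ℝ × ℝ → ℝ} {M : ℝ} (hc : IsBddWeight μ c M) :
    TendstoL2 μ (fun n p => c p • F n p) (fun p => c p • f p) := by
  refine ⟨fun n => hc.memLp_smul (h.memLp n), hc.memLp_smul h.memLp_lim, ?_⟩
  have h0 := ENNReal.Tendsto.const_mul h.tendsto
    (Or.inr (ENNReal.ofReal_ne_top (r := M)))
  rw [mul_zero] at h0
  refine tendsto_of_tendsto_of_tendsto_of_le_of_le tendsto_const_nhds h0 (fun _ => zero_le)
    fun n => ?_
  simp only [← smul_sub]
  exact hc.eLpNorm_smul_le _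

lemma TendstoL2.add {F G : ℕ → ℝ × ℝ → ℂ} {f g : ℝ × ℝ → ℂ} (h : TendstoL2 μ F f)
    (h' : TendstoL2 μ G g) : TendstoL2 μ (fun n p => F n p + G n p) (fun p => f p + g p) := by
  refine ⟨fun n => (h.memLp n).add (h'.memLp n), h.memLp_lim.add h'.memLp_lim, ?_⟩
  have h0 := h.tendsto.add h'.tendsto
  rw [add_zero] at h0
  refine tendsto_of_tendsto_of_tendsto_of_le_of_le tendsto_const_nhds h0 (fun _ => zero_le)
    fun n => ?_
  have e : (fun p => F n p + G n p - (f p + g p)) =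
      (fun p => F n p - f p) + fun p => G n p - g p := by
    ext p; simp only [Pi.add_apply]; ring
  rw [e]
  exact eLpNorm_add_le ((h.memLp n).1.sub h.memLp_lim.1) ((h'.memLp n).1.sub h'.memLp_lim.1)
    one_le_two

lemma TendstoL2.sub {F G : ℕ → ℝ × ℝ → ℂ} {f g : ℝ × ℝ → ℂ} (h : TendstoL2 μ F f)
    (h' : TendstoL2 μ G g) : TendstoL2 μ (fun n p => F n p - G n p) (fun p => f p - g p) := by
  refine ⟨fun n => (h.memLp n).sub (h'.memLp n), h.memLp_lim.sub h'.memLp_lim, ?_⟩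
  have h0 := h.tendsto.add h'.tendsto
  rw [add_zero] at h0
  refine tendsto_of_tendsto_of_tendsto_of_le_of_le tendsto_const_nhds h0 (fun _ => zero_le)
    fun n => ?_
  have e : (fun p => F n p - G n p - (f p - g p)) =
      (fun p => F n p - f p) - fun p => G n p - g p := by
    ext p; simp only [Pi.sub_apply]; ring
  rw [e]
  exact eLpNorm_sub_le ((h.memLp n).1.sub h.memLp_lim.1) ((h'.memLp n).1.sub h'.memLp_lim.1)
    one_le_two

lemma TendstoL2.const {f : ℝ × ℝ → ℂ} (hf : MemLp f 2 μ) : TendstoL2 μ (fun _ => f) f :=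
  ⟨fun _ => hf, hf, by simp⟩

lemma TendstoL2.congr {F : ℕ → ℝ × ℝ → ℂ} {f f' : ℝ × ℝ → ℂ} (h : TendstoL2 μ F f)
    (hf : f =ᵐ[μ] f') : TendstoL2 μ F f' := by
  refine ⟨h.memLp, (memLp_congr_ae hf).1 h.memLp_lim, ?_⟩
  convert h.tendsto using 2 with n
  refine eLpNorm_congr_ae ?_
  filter_upwards [hf] with p hp
  rw [hp]

lemma TendstoL2.congr_seq {F F' : ℕ → ℝ × ℝ → ℂ} {f : ℝ × ℝ → ℂ} (h : TendstoL2 μ F f)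
    (hF : ∀ n, F n =ᵐ[μ] F' n) : TendstoL2 μ F' f := by
  refine ⟨fun n => (memLp_congr_ae (hF n)).1 (h.memLp n), h.memLp_lim, ?_⟩
  convert h.tendsto using 2 with n
  refine eLpNorm_congr_ae ?_
  filter_upwards [hF n] with p hp
  rw [hp]

lemma TendstoL2.smul_seq {F : ℕ → ℝ × ℝ → ℂ} {f : ℝ × ℝ → ℂ} {c : ℕ → ℝ}
    (hc : Tendsto c atTop (𝓝 1)) (h : TendstoL2 μ F f) :
    TendstoL2 μ (fun n p => c n • F n p) f := by
  have hm : ∀ n, MemLp (fun p => c n • F n p) 2 μ := fun n => (h.memLp n).const_smul (c n)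
  refine ⟨hm, h.memLp_lim, (Lp.tendsto_Lp_iff_tendsto_eLpNorm'' _ hm _ h.memLp_lim).1 ?_⟩
  have := hc.smul h.tendsto_toLp
  rw [one_smul] at this
  exact this

lemma TendstoL2.pairing {F G : ℕ → ℝ × ℝ → ℂ} {f g : ℝ × ℝ → ℂ} (h : TendstoL2 μ F f)
    (h' : TendstoL2 μ G g) {c : ℝ × ℝ → ℝ} {M : ℝ} (hc : IsBddWeight μ c M) :
    Tendsto (fun n => pairing μ c (F n) (G n)) atTop (𝓝 (pairing μ c f g)) := by
  rw [pairing_eq_inner hc h.memLp_lim h'.memLp_lim]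
  simp_rw [fun n => pairing_eq_inner hc (h.memLp n) (h'.memLp n)]
  exact (h.smul hc).tendsto_toLp.inner h'.tendsto_toLp

end Pairing

/-! ### Calculus of functions with bounded partial derivatives. -/

section Partials

variable {α β : ℝ} {E : Type*} [NormedAddCommGroup E]

lemma exists_bound_of_continuous {f : ℝ × ℝ → E} (hf : Continuous f) (r : ℝ) :
    ∃ M, ∀ p, ‖p‖ ≤ r → ‖f p‖ ≤ M := by
  obtain ⟨C, hC⟩ := (isCompact_closedBall (0 : ℝ × ℝ) r).exists_bound_of_continuousOn
    hf.continuousOn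
  exact ⟨C, fun p hp => hC p (by simpa using hp)⟩

variable [NormedSpace ℝ E]

lemma HasPartials.of_contDiff {f : ℝ × ℝ → E} (hf : ContDiff ℝ 1 f) :
    HasPartials α f (fun p => fderiv ℝ f p (1, 0)) (fun p => fderiv ℝ f p (0, 1)) := by
  have hc : ∀ e, Continuous fun p => fderiv ℝ f p e := fun e =>
    (hf.continuous_fderiv one_ne_zero).clm_apply continuous_const
  have hd : ∀ p, HasFDerivAt f (fderiv ℝ f p) p := fun p =>
    (hf.differentiable one_ne_zero p).hasFDerivAt
  refine ⟨hf.continuous, fun x y _ => ?_, fun x y => ?_, (hc _).stronglyMeasurable,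
    (hc _).stronglyMeasurable, fun r => ?_⟩
  · exact (hd (x, y)).comp_hasDerivAt x ((hasDerivAt_id x).prodMk (hasDerivAt_const x y))
  · exact (hd (x, y)).comp_hasDerivAt y ((hasDerivAt_const y x).prodMk (hasDerivAt_id y))
  · obtain ⟨M, hM⟩ := exists_bound_of_continuous (hc (1, 0)) r
    obtain ⟨M', hM'⟩ := exists_bound_of_continuous (hc (0, 1)) r
    exact ⟨max M M', fun p hp => ⟨(hM p hp).trans (le_max_left _ _),
      (hM' p hp).trans (le_max_right _ _)⟩⟩

lemma HasPartials.congr {f f' fx fx' fy fy' : ℝ × ℝ → E} (h : HasPartials α f fx fy)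
    (hf : ∀ p, f p = f' p) (hx : ∀ p, fx p = fx' p) (hy : ∀ p, fy p = fy' p) :
    HasPartials α f' fx' fy' := by
  obtain rfl := funext hf
  obtain rfl := funext hx
  obtain rfl := funext hy
  exact h

lemma HasPartials.add {f g fx gx fy gy : ℝ × ℝ → E} (hf : HasPartials α f fx fy)
    (hg : HasPartials α g gx gy) :
    HasPartials α (fun p => f p + g p) (fun p => fx p + gx p) (fun p => fy p + gy p) := by
  refine ⟨hf.continuous.add hg.continuous, fun x y h => (hf.deriv_x x y h).add (hg.deriv_x x y h),
    fun x y => (hf.deriv_y x y).add (hg.deriv_y x y), hf.meas_x.add hg.meas_x,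
    hf.meas_y.add hg.meas_y, fun r => ?_⟩
  obtain ⟨M, hM⟩ := hf.bounded r
  obtain ⟨M', hM'⟩ := hg.bounded r
  exact ⟨M + M', fun p hp => ⟨norm_add_le_of_le (hM p hp).1 (hM' p hp).1,
    norm_add_le_of_le (hM p hp).2 (hM' p hp).2⟩⟩

lemma HasPartials.sub {f g fx gx fy gy : ℝ × ℝ → E} (hf : HasPartials α f fx fy)
    (hg : HasPartials α g gx gy) :
    HasPartials α (fun p => f p - g p) (fun p => fx p - gx p) (fun p => fy p - gy p) := by
  refine ⟨hf.continuous.sub hg.continuous, fun x y h => (hf.deriv_x x y h).sub (hg.deriv_x x y h),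
    fun x y => (hf.deriv_y x y).sub (hg.deriv_y x y), hf.meas_x.sub hg.meas_x,
    hf.meas_y.sub hg.meas_y, fun r => ?_⟩
  obtain ⟨M, hM⟩ := hf.bounded r
  obtain ⟨M', hM'⟩ := hg.bounded r
  exact ⟨M + M', fun p hp => ⟨norm_sub_le_of_le (hM p hp).1 (hM' p hp).1,
    norm_sub_le_of_le (hM p hp).2 (hM' p hp).2⟩⟩

lemma HasPartials.smul {c cx cy : ℝ × ℝ → ℝ} {f fx fy : ℝ × ℝ → E} (hc : HasPartials α c cx cy)
    (hf : HasPartials α f fx fy) :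
    HasPartials α (fun p => c p • f p) (fun p => c p • fx p + cx p • f p)
      (fun p => c p • fy p + cy p • f p) := by
  refine ⟨hc.continuous.smul hf.continuous,
    fun x y h => (hc.deriv_x x y h).smul (hf.deriv_x x y h),
    fun x y => (hc.deriv_y x y).smul (hf.deriv_y x y),
    (hc.continuous.stronglyMeasurable.smul hf.meas_x).add
      (hc.meas_x.smul hf.continuous.stronglyMeasurable),
    (hc.continuous.stronglyMeasurable.smul hf.meas_y).add
      (hc.meas_y.smul hf.continuous.stronglyMeasurable), fun r => ?_⟩
  obtain ⟨M, hM⟩ := hc.bounded r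
  obtain ⟨M', hM'⟩ := hf.bounded r
  obtain ⟨A, hA⟩ := exists_bound_of_continuous hc.continuous r
  obtain ⟨B, hB⟩ := exists_bound_of_continuous hf.continuous r
  refine ⟨A * M' + M * B, fun p hp => ⟨norm_add_le_of_le ?_ ?_, norm_add_le_of_le ?_ ?_⟩⟩ <;>
    rw [norm_smul]
  · exact mul_le_mul (hA p hp) (hM' p hp).1 (norm_nonneg _) ((norm_nonneg _).trans (hA p hp))
  · exact mul_le_mul (hM p hp).1 (hB p hp) (norm_nonneg _) ((norm_nonneg _).trans (hM p hp).1)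
  · exact mul_le_mul (hA p hp) (hM' p hp).2 (norm_nonneg _) ((norm_nonneg _).trans (hA p hp))
  · exact mul_le_mul (hM p hp).2 (hB p hp) (norm_nonneg _) ((norm_nonneg _).trans (hM p hp).2)

lemma HasPartials.inner {f g fx gx fy gy : ℝ × ℝ → ℂ} (hf : HasPartials α f fx fy)
    (hg : HasPartials α g gx gy) :
    HasPartials α (fun p => ⟪f p, g p⟫) (fun p => ⟪f p, gx p⟫ + ⟪fx p, g p⟫)
      (fun p => ⟪f p, gy p⟫ + ⟪fy p, g p⟫) := by
  refine ⟨hf.continuous.inner hg.continuous,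
    fun x y h => (hf.deriv_x x y h).inner ℝ (hg.deriv_x x y h),
    fun x y => (hf.deriv_y x y).inner ℝ (hg.deriv_y x y),
    (hf.continuous.stronglyMeasurable.inner hg.meas_x).add
      (hf.meas_x.inner hg.continuous.stronglyMeasurable),
    (hf.continuous.stronglyMeasurable.inner hg.meas_y).add
      (hf.meas_y.inner hg.continuous.stronglyMeasurable), fun r => ?_⟩
  obtain ⟨M, hM⟩ := hf.bounded r
  obtain ⟨M', hM'⟩ := hg.bounded r
  obtain ⟨A, hA⟩ := exists_bound_of_continuous hf.continuous r
  obtain ⟨B, hB⟩ := exists_bound_of_continuous hg.continuous r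
  refine ⟨A * M' + M * B, fun p hp => ⟨norm_add_le_of_le ?_ ?_, norm_add_le_of_le ?_ ?_⟩⟩ <;>
    refine (norm_inner_le_norm _ _).trans ?_
  · exact mul_le_mul (hA p hp) (hM' p hp).1 (norm_nonneg _) ((norm_nonneg _).trans (hA p hp))
  · exact mul_le_mul (hM p hp).1 (hB p hp) (norm_nonneg _) ((norm_nonneg _).trans (hM p hp).1)
  · exact mul_le_mul (hA p hp) (hM' p hp).2 (norm_nonneg _) ((norm_nonneg _).trans (hA p hp))
  · exact mul_le_mul (hM p hp).2 (hB p hp) (norm_nonneg _) ((norm_nonneg _).trans (hM p hp).2)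

lemma hasPartials_const (a : E) : HasPartials α (fun _ => a) (fun _ => 0) (fun _ => 0) :=
  (HasPartials.of_contDiff contDiff_const).congr (fun _ => rfl) (by simp) (by simp)

lemma hasPartials_fst : HasPartials α (fun p => p.1) (fun _ => 1) (fun _ => 0) :=
  (HasPartials.of_contDiff contDiff_fst).congr (fun _ => rfl) (by simp [fderiv_fst])
    (by simp [fderiv_fst])

lemma hasPartials_snd : HasPartials α (fun p => p.2) (fun _ => 0) (fun _ => 1) :=
  (HasPartials.of_contDiff contDiff_snd).congr (fun _ => rfl) (by simp [fderiv_snd])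
    (by simp [fderiv_snd])

lemma HasPartials.of_fst {c c' : ℝ → ℝ} (hc : Continuous c)
    (hd : ∀ x, |x| ≠ α → HasDerivAt c (c' x) x) (hm : Measurable c') {M : ℝ}
    (hb : ∀ x, |c' x| ≤ M) :
    HasPartials α (fun p => c p.1) (fun p => c' p.1) (fun _ => 0) := by
  refine ⟨hc.comp continuous_fst, fun x y h => hd x h, fun x y => hasDerivAt_const y (c x),
    (hm.comp measurable_fst).stronglyMeasurable, stronglyMeasurable_const,
    fun r => ⟨M, fun p _ => ⟨hb _, ?_⟩⟩⟩
  simpa using (abs_nonneg _).trans (hb 0)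

lemma hasPartials_wingOffset (hα : 0 < α) :
    HasPartials α (fun p => wingOffset α p.1) (fun p => wingIndicator α p.1) (fun _ => 0) :=
  .of_fst continuous_wingOffset (fun _ h => hasDerivAt_wingOffset hα h) measurable_wingIndicator
    abs_wingIndicator_le

/-- The derivative of `|wingOffset α|` off the points `± α`. -/
def wingSign (α x : ℝ) : ℝ := SignType.sign (wingOffset α x)

lemma measurable_wingSign : Measurable (wingSign α) := by
  have h1 : MeasurableSet {x | 0 < wingOffset α x} :=
    measurableSet_lt measurable_const continuous_wingOffset.measurable
  have h2 : MeasurableSet {x | wingOffset α x < 0} :=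
    measurableSet_lt continuous_wingOffset.measurable measurable_const
  have : wingSign α = fun x => if 0 < wingOffset α x then 1 else
      if wingOffset α x < 0 then -1 else 0 := by
    ext x; simp only [wingSign, sign_apply]; split_ifs <;> simp
  rw [this]
  exact Measurable.ite h1 measurable_const (Measurable.ite h2 measurable_const measurable_const)

lemma abs_wingSign_le (x : ℝ) : |wingSign α x| ≤ 1 := by
  unfold wingSign
  cases SignType.sign (wingOffset α x) <;> simp

lemma wingSign_mul_wingOffset (x : ℝ) : wingSign α x * wingOffset α x = |wingOffset α x| :=
  sign_mul_self _

lemma wingIndicator_mul_wingSign (x : ℝ) :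
    wingIndicator α x * wingSign α x = wingSign α x := by
  unfold wingIndicator
  split_ifs with h
  · simp
  · simp [wingSign, wingOffset_of_abs_le (not_lt.1 h)]

lemma hasPartials_abs_wingOffset (hα : 0 < α) :
    HasPartials α (fun p => |wingOffset α p.1|) (fun p => wingSign α p.1) (fun _ => 0) := by
  refine .of_fst continuous_wingOffset.abs (fun x hx => ?_) measurable_wingSign abs_wingSign_le
  rcases lt_or_gt_of_ne hx with h | h
  · have : (fun x => |wingOffset α x|) =ᶠ[𝓝 x] fun _ => 0 := by
      filter_upwards [continuous_abs.continuousAt.eventually_lt continuousAt_const h] with z hz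
      rw [wingOffset_of_abs_le hz.le, abs_zero]
    have e : wingSign α x = 0 := by simp [wingSign, wingOffset_of_abs_le h.le]
    rw [e]
    exact (hasDerivAt_const x (0 : ℝ)).congr_of_eventuallyEq this
  · have h0 := (wingOffset_ne_zero_iff hα).2 h
    have := (hasDerivAt_abs h0).comp x (hasDerivAt_wingOffset hα hx)
    refine this.congr_deriv ?_
    simp [wingIndicator, if_pos h, wingSign]

/-- This is the horizontal component of the multiplier `|σ|(σ, y)`, which lives on the wings. -/
lemma hasPartials_wingOffset_mul_abs (hα : 0 < α) :
    HasPartials α (fun p => wingOffset α p.1 * |wingOffset α p.1|)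
      (fun p => 2 * |wingOffset α p.1|) (fun _ => 0) := by
  refine ((hasPartials_wingOffset hα).smul (hasPartials_abs_wingOffset hα)).congr (fun _ => rfl)
    (fun p => ?_) (by simp)
  have h1 := wingSign_mul_wingOffset (α := α) p.1
  have h2 : wingIndicator α p.1 * |wingOffset α p.1| = |wingOffset α p.1| := by
    rw [← h1, mul_left_comm, wingIndicator_mul_wingOffset]
  simp only [smul_eq_mul]
  rw [h2, mul_comm, h1]; ring

end Partials

end Stadium

end

noncomputable section

namespace Stadium

/-! ### Dilation followed by mollification. -/

section Mollification

open scoped Convolution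

/-- Convolution with a normalized bump function does not increase the `L²` norm. -/
lemma eLpNorm_normed_convolution_le (η : ContDiffBump (0 : ℝ × ℝ)) {g : ℝ × ℝ → ℂ}
    (hg : AEStronglyMeasurable g volume) :
    eLpNorm (η.normed volume ⋆[ContinuousLinearMap.lsmul ℝ ℝ, volume] g) 2 volume
      ≤ eLpNorm g 2 volume := by
  -- A strongly measurable representative gives the joint measurability that Tonelli requires.
  wlog hg' : StronglyMeasurable g generalizing g
  · have h := this hg.stronglyMeasurable_mk.aestronglyMeasurable hg.stronglyMeasurable_mk
    rwa [eLpNorm_congr_ae hg.ae_eq_mk, convolution_congr _ (ae_eq_refl _) hg.ae_eq_mk]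
  -- The normalized bump is the density of a probability measure, so the convolution is an average
  -- of translates of `g`. Jensen, Tonelli and translation invariance then give the bound.
  set w : ℝ × ℝ → NNReal := fun q => (η.normed volume q).toNNReal with hw
  have hwm : Measurable w := (η.continuous_normed.measurable).real_toNNReal
  set ν : Measure (ℝ × ℝ) := volume.withDensity fun q => (w q : ENNReal) with hν
  have hprob : IsProbabilityMeasure ν := by
    refine ⟨?_⟩
    rw [hν, withDensity_apply _ MeasurableSet.univ, Measure.restrict_univ]
    have := ofReal_integral_eq_lintegral_ofReal η.integrable_normed
      (μ := volume) (Eventually.of_forall fun q => η.nonneg_normed q)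
    rw [η.integral_normed, ENNReal.ofReal_one] at this
    exact this.symm
  have hconv : ∀ x, (η.normed volume ⋆[ContinuousLinearMap.lsmul ℝ ℝ, volume] g) x =
      ∫ q, g (x - q) ∂ν := by
    intro x
    rw [hν, integral_withDensity_eq_integral_smul hwm, convolution_def]
    refine integral_congr_ae (Eventually.of_forall fun q => ?_)
    simp only [hw, NNReal.smul_def, Real.coe_toNNReal _ (η.nonneg_normed q)]
    rfl
  have hpt : ∀ x, ‖(η.normed volume ⋆[ContinuousLinearMap.lsmul ℝ ℝ, volume] g) x‖ₑ ^ (2 : ℝ) ≤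
      ∫⁻ q, ‖g (x - q)‖ₑ ^ (2 : ℝ) ∂ν := by
    intro x
    have hm : AEStronglyMeasurable (fun q => g (x - q)) ν :=
      (hg'.comp_measurable (measurable_const.sub measurable_id)).aestronglyMeasurable
    rw [hconv]
    have h1 : ‖∫ q, g (x - q) ∂ν‖ₑ ≤ eLpNorm (fun q => g (x - q)) 1 ν := by
      rw [eLpNorm_one_eq_lintegral_enorm]; exact enorm_integral_le_lintegral_enorm _
    have h2 := h1.trans (eLpNorm_le_eLpNorm_of_exponent_le one_le_two hm)
    rw [eLpNorm_eq_lintegral_rpow_enorm_toReal two_ne_zero ENNReal.ofNat_ne_top] at h2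
    have h3 := ENNReal.rpow_le_rpow h2 (zero_le_two (α := ℝ))
    rwa [ENNReal.toReal_ofNat, ← ENNReal.rpow_mul, one_div, inv_mul_cancel₀ two_ne_zero,
      ENNReal.rpow_one] at h3
  rw [eLpNorm_eq_lintegral_rpow_enorm_toReal two_ne_zero ENNReal.ofNat_ne_top,
    eLpNorm_eq_lintegral_rpow_enorm_toReal two_ne_zero ENNReal.ofNat_ne_top,
    ENNReal.toReal_ofNat]
  refine ENNReal.rpow_le_rpow ?_ (by norm_num)
  calc ∫⁻ x, ‖(η.normed volume ⋆[ContinuousLinearMap.lsmul ℝ ℝ, volume] g) x‖ₑ ^ (2 : ℝ)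
      ≤ ∫⁻ x, (∫⁻ q, ‖g (x - q)‖ₑ ^ (2 : ℝ) ∂ν) ∂volume := lintegral_mono hpt
    _ = ∫⁻ q, (∫⁻ x, ‖g (x - q)‖ₑ ^ (2 : ℝ) ∂volume) ∂ν := by
        refine lintegral_lintegral_swap ?_
        exact ((hg'.comp_measurable (measurable_fst.sub measurable_snd)).enorm.pow_const
          _).aemeasurable
    _ = ∫⁻ _q, (∫⁻ x, ‖g x‖ₑ ^ (2 : ℝ) ∂volume) ∂ν :=
        lintegral_congr fun q => lintegral_sub_right_eq_self (fun x => ‖g x‖ₑ ^ (2 : ℝ)) q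
    _ = ∫⁻ x, ‖g x‖ₑ ^ (2 : ℝ) := by simp

/-- A bump function at the origin whose support shrinks as `n → ∞`. -/
def shrinkingBump (r : ℝ) (hr : 0 < r) (n : ℕ) : ContDiffBump (0 : ℝ × ℝ) where
  rIn := r / (n + 2) / 2 / 2
  rOut := r / (n + 2) / 2
  rIn_pos := by positivity
  rIn_lt_rOut := half_lt_self (by positivity)

/-- The dilation factor used to approximate functions on a star-shaped domain. -/
def dilation (n : ℕ) : ℝ := 1 - 1 / ((n : ℝ) + 2)

lemma half_le_dilation (n : ℕ) : 1 / 2 ≤ dilation n := by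
  have : 1 / ((n : ℝ) + 2) ≤ 1 / 2 :=
    one_div_le_one_div_of_le two_pos (by linarith [n.cast_nonneg (α := ℝ)])
  unfold dilation; linarith

lemma dilation_lt_one (n : ℕ) : dilation n < 1 := by
  have : 0 < 1 / ((n : ℝ) + 2) := by positivity
  unfold dilation; linarith

lemma tendsto_one_div_add_two : Tendsto (fun n : ℕ => 1 / ((n : ℝ) + 2)) atTop (𝓝 0) :=
  tendsto_const_nhds.div_atTop (tendsto_atTop_add_const_right _ _ tendsto_natCast_atTop_atTop)

lemma tendsto_dilation : Tendsto dilation atTop (𝓝 1) := by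
  have := tendsto_one_div_add_two.const_sub 1
  rwa [sub_zero] at this

/-- Mollifications of dilations of `g`. -/
def dilatedMollification (r : ℝ) (hr : 0 < r) (g : ℝ × ℝ → ℂ) (n : ℕ) (p : ℝ × ℝ) : ℂ :=
  ((shrinkingBump r hr n).normed volume ⋆[ContinuousLinearMap.lsmul ℝ ℝ, volume] g)
    (dilation n • p)

variable {r : ℝ} {hr : 0 < r}

lemma contDiff_dilatedMollification {g : ℝ × ℝ → ℂ} (hg : LocallyIntegrable g) (n : ℕ) :
    ContDiff ℝ ∞ (dilatedMollification r hr g n) := by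
  have h := ((shrinkingBump r hr n).hasCompactSupport_normed (μ := volume)).contDiff_convolution_left
    (μ := volume) (n := ⊤) (ContinuousLinearMap.lsmul ℝ ℝ)
    (shrinkingBump r hr n).contDiff_normed hg
  exact h.comp (contDiff_const_smul _)

lemma dilatedMollification_sub {g h : ℝ × ℝ → ℂ} (hg : LocallyIntegrable g)
    (hh : LocallyIntegrable h) (n : ℕ) (p : ℝ × ℝ) :
    dilatedMollification r hr (g - h) n p =
      dilatedMollification r hr g n p - dilatedMollification r hr h n p := by
  have hex : ∀ g : ℝ × ℝ → ℂ, LocallyIntegrable g →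
      ConvolutionExists ((shrinkingBump r hr n).normed volume) g (ContinuousLinearMap.lsmul ℝ ℝ)
        volume := fun g hg =>
    (shrinkingBump r hr n).hasCompactSupport_normed.convolutionExists_left _
      (shrinkingBump r hr n).continuous_normed hg
  have e : g = (g - h) + h := by simp
  have := (hex _ (hg.sub hh)).distrib_add (hex _ hh)
  rw [← e] at this
  simp only [dilatedMollification, this, Pi.add_apply]
  ring

/-- The dilation factors are at least `1/2`, so the planar Jacobian is at least `1/4`. The resulting
constant `4 ^ (1 / 2)` does not depend on `n`. -/
lemma eLpNorm_comp_dilation_le (n : ℕ) {h : ℝ × ℝ → ℂ} (hh : AEStronglyMeasurable h volume) :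
    eLpNorm (fun p => h (dilation n • p)) 2 volume ≤ 4 ^ (1 / 2 : ℝ) * eLpNorm h 2 volume := by
  have hd := half_le_dilation n
  have hmap := Measure.map_addHaar_smul (volume : Measure (ℝ × ℝ))
    (r := dilation n) (by linarith)
  have hsm : AEStronglyMeasurable h (Measure.map (fun p : ℝ × ℝ => dilation n • p) volume) := by
    rw [hmap]; exact hh.smul_measure _
  have := eLpNorm_map_measure (p := 2) hsm (measurable_const_smul (dilation n)).aemeasurable
  change _ = eLpNorm (fun p => h (dilation n • p)) 2 volume at this
  rw [← this, hmap, eLpNorm_smul_measure_of_ne_top ENNReal.ofNat_ne_top, smul_eq_mul]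
  refine mul_le_mul' ?_ le_rfl
  · refine (ENNReal.rpow_le_rpow (y := 4) ?_ ENNReal.toReal_nonneg).trans (by simp)
    rw [show (4 : ENNReal) = ENNReal.ofReal 4 by simp]
    refine ENNReal.ofReal_le_ofReal ?_
    rw [Module.finrank_prod, Module.finrank_self, abs_of_nonneg (by positivity)]
    rw [inv_le_comm₀ (by positivity) (by norm_num)]
    nlinarith

lemma eLpNorm_dilatedMollification_le {g : ℝ × ℝ → ℂ} (hg : LocallyIntegrable g) (n : ℕ) :
    eLpNorm (dilatedMollification r hr g n) 2 volume ≤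
      4 ^ (1 / 2 : ℝ) * eLpNorm g 2 volume := by
  have hc : Continuous ((shrinkingBump r hr n).normed volume
      ⋆[ContinuousLinearMap.lsmul ℝ ℝ, volume] g) :=
    (shrinkingBump r hr n).hasCompactSupport_normed.continuous_convolution_left _
      (shrinkingBump r hr n).continuous_normed hg
  refine (eLpNorm_comp_dilation_le n hc.aestronglyMeasurable).trans ?_
  gcongr
  exact eLpNorm_normed_convolution_le _ hg.aestronglyMeasurable

/-- On a bounded set both the bump radius and the displacement caused by the dilation are of order
`1 / n`, so uniform continuity applies to each. -/
lemma norm_dilatedMollification_sub_le {h : ℝ × ℝ → ℂ} (hh : UniformContinuous h) (R : ℝ)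
    {ε : ℝ} (hε : 0 < ε) : ∀ᶠ n in atTop, ∀ p : ℝ × ℝ, ‖p‖ ≤ R →
      ‖dilatedMollification r hr h n p - h p‖ ≤ ε := by
  obtain ⟨δ, hδ, H⟩ := Metric.uniformContinuous_iff.1 hh (ε / 2) (half_pos hε)
  have hlim : Tendsto (fun n : ℕ => (r + |R|) * (1 / ((n : ℝ) + 2))) atTop (𝓝 0) := by
    simpa using tendsto_one_div_add_two.const_mul (r + |R|)
  filter_upwards [hlim.eventually (gt_mem_nhds hδ)] with n hn p hp
  have hpos : 0 < 1 / ((n : ℝ) + 2) := by positivity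
  have h1 : dist (dilatedMollification r hr h n p) (h (dilation n • p)) ≤ ε / 2 := by
    refine ContDiffBump.dist_normed_convolution_le hh.continuous.aestronglyMeasurable
      fun x hx => (H (hx.trans ?_)).le
    have e : (shrinkingBump r hr n).rOut = r * (1 / ((n : ℝ) + 2)) / 2 := by
      simp [shrinkingBump, div_eq_mul_inv]
    rw [e]
    nlinarith [mul_nonneg (abs_nonneg R) hpos.le, mul_pos hr hpos]
  have h2 : dist (h (dilation n • p)) (h p) < ε / 2 := by
    refine H ?_
    have e : dilation n • p - p = -((1 / ((n : ℝ) + 2)) • p) := by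
      rw [dilation, sub_smul, one_smul]; abel
    rw [dist_eq_norm, e, norm_neg, norm_smul, Real.norm_of_nonneg hpos.le]
    have := mul_le_mul_of_nonneg_left (hp.trans (le_abs_self R)) hpos.le
    nlinarith
  rw [← dist_eq_norm]
  linarith [dist_triangle (dilatedMollification r hr h n p) (h (dilation n • p)) (h p)]

/-- The operators are bounded on `L²` uniformly in `n` and converge uniformly on bounded sets for
continuous compactly supported functions, which are dense. -/
lemma tendsto_dilatedMollification {g : ℝ × ℝ → ℂ} (hg : MemLp g 2 volume) {s : Set (ℝ × ℝ)}
    {R : ℝ} (hs : MeasurableSet s) (hsR : ∀ p ∈ s, ‖p‖ ≤ R) :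
    TendstoL2 (volume.restrict s) (dilatedMollification r hr g) g := by
  have hgl : LocallyIntegrable g := hg.locallyIntegrable one_le_two
  have hmem : ∀ n, MemLp (dilatedMollification r hr g n) 2 volume := fun n =>
    ⟨(contDiff_dilatedMollification hgl n).continuous.aestronglyMeasurable,
      (eLpNorm_dilatedMollification_le hgl n).trans_lt
        (ENNReal.mul_lt_top (by finiteness) hg.2)⟩
  refine ⟨fun n => (hmem n).restrict s, hg.restrict s, ?_⟩
  have hvs : volume s < ⊤ := by
    refine (measure_mono (t := Metric.closedBall 0 R) fun p hp => ?_).trans_lt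
      measure_closedBall_lt_top
    simpa using hsR p hp
  rw [ENNReal.tendsto_nhds_zero]
  intro ε hε
  set K : ENNReal := 4 ^ (1 / 2 : ℝ) with hK
  have hKtop : K ≠ ⊤ := by rw [hK]; finiteness
  obtain ⟨δ, hδ, hδε⟩ : ∃ δ : ENNReal, 0 < δ ∧ K * δ + δ ≤ ε / 2 := by
    have : Tendsto (fun δ : ENNReal => K * δ + δ) (𝓝[>] 0) (𝓝 0) := by
      have h1 : Tendsto (fun δ : ENNReal => K * δ + δ) (𝓝 0) (𝓝 (K * 0 + 0)) :=
        (ENNReal.Tendsto.const_mul tendsto_id (Or.inr hKtop)).add tendsto_id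
      rw [mul_zero, add_zero] at h1
      exact h1.mono_left nhdsWithin_le_nhds
    have h2 := (ENNReal.tendsto_nhds_zero.1 this (ε / 2) (ENNReal.half_pos hε.ne')).and
      self_mem_nhdsWithin
    have : (𝓝[>] (0 : ENNReal)).NeBot := by
      exact nhdsGT_neBot_of_exists_gt ⟨1, zero_lt_one⟩
    obtain ⟨δ, h3, h4⟩ := h2.exists
    exact ⟨δ, h4, h3⟩
  obtain ⟨h, hhc, hgh, hcont, hhm⟩ := hg.exists_hasCompactSupport_eLpNorm_sub_le
    ENNReal.ofNat_ne_top hδ.ne'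
  have hhl : LocallyIntegrable h := hhm.locallyIntegrable one_le_two
  have hun := hhc.uniformContinuous_of_continuous hcont
  obtain ⟨τ, hτ, hτε⟩ : ∃ τ : ℝ, 0 < τ ∧
      volume s ^ (2 : ENNReal).toReal⁻¹ * ENNReal.ofReal τ ≤ ε / 2 := by
    have h1 : Tendsto (fun τ : ℝ => volume s ^ (2 : ENNReal).toReal⁻¹ * ENNReal.ofReal τ) (𝓝[>] 0)
        (𝓝 0) := by
      have h2 : Tendsto (fun τ : ℝ => volume s ^ (2 : ENNReal).toReal⁻¹ * ENNReal.ofReal τ) (𝓝 0)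
          (𝓝 (volume s ^ (2 : ENNReal).toReal⁻¹ * ENNReal.ofReal 0)) :=
        ENNReal.Tendsto.const_mul (ENNReal.tendsto_ofReal tendsto_id)
          (Or.inr (ENNReal.rpow_ne_top_of_nonneg (by positivity) hvs.ne))
      rw [ENNReal.ofReal_zero, mul_zero] at h2
      exact h2.mono_left nhdsWithin_le_nhds
    obtain ⟨τ, h3, h4⟩ := ((ENNReal.tendsto_nhds_zero.1 h1 (ε / 2)
      (ENNReal.half_pos hε.ne')).and self_mem_nhdsWithin).exists
    exact ⟨τ, h4, h3⟩
  filter_upwards [norm_dilatedMollification_sub_le (hr := hr) hun R hτ] with n hn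
  set A := dilatedMollification r hr g n
  set B := dilatedMollification r hr h n
  have hAB : A - B = dilatedMollification r hr (g - h) n := by
    ext p; exact (dilatedMollification_sub hgl hhl n p).symm
  have hBm : AEStronglyMeasurable B volume :=
    (contDiff_dilatedMollification hhl n).continuous.aestronglyMeasurable
  have e : (fun p => A p - g p) = ((A - B) - (g - h)) + (B - h) := by
    ext p; simp only [Pi.add_apply, Pi.sub_apply]; ring
  have hm1 : AEStronglyMeasurable ((A - B) - (g - h)) (volume.restrict s) :=
    (((hmem n).1.sub hBm).sub (hg.1.sub hhm.1)).restrict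
  rw [e]
  refine (eLpNorm_add_le hm1 (hBm.sub hhm.1).restrict one_le_two).trans ?_
  rw [← ENNReal.add_halves ε]
  refine add_le_add ?_ ?_
  · refine ((eLpNorm_mono_measure _ Measure.restrict_le_self).trans
      (eLpNorm_sub_le ((hmem n).1.sub hBm) (hg.1.sub hhm.1) one_le_two)).trans
      (le_trans (add_le_add ?_ hgh) hδε)
    rw [hAB]
    refine (eLpNorm_dilatedMollification_le (hgl.sub hhl) n).trans ?_
    gcongr
  · have : ∀ᵐ p ∂(volume.restrict s), ‖(B - h) p‖ ≤ τ := by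
      filter_upwards [ae_restrict_mem hs] with p hp using hn p (hsR p hp)
    refine (eLpNorm_le_of_ae_bound this).trans ?_
    simpa using hτε

end Mollification

/-! ### Density of smooth functions in `H¹` of the stadium. -/

section Density

open scoped Convolution

variable {α β : ℝ}

/-- The contracted point `dilation n • p` is far enough from the boundary for the translated bump to
be an admissible test function, so the weak derivative may be inserted. The chain rule contributes
the factor `dilation n`. -/
lemma fderiv_dilatedMollification (hα : 0 < α) (hβ : 0 < β) {v w : ℝ × ℝ → ℂ} {e : ℝ × ℝ}
    (hv : MemLp v 2 (volume.restrict (stadium α β)))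
    (h : IsWeakPartial (stadium α β) e v w) (n : ℕ) {p : ℝ × ℝ} (hp : p ∈ stadium α β) :
    fderiv ℝ (dilatedMollification (min α β) (lt_min hα hβ) ((stadium α β).indicator v) n) p e =
      dilation n • dilatedMollification (min α β) (lt_min hα hβ)
        ((stadium α β).indicator w) n p := by
  set η := shrinkingBump (min α β) (lt_min hα hβ) n with hη
  set z := dilation n • p with hz
  have hv0 : LocallyIntegrable ((stadium α β).indicator v) :=
    ((memLp_indicator_iff_restrict measurableSet_stadium).2 hv).locallyIntegrable one_le_two
  have hd := half_le_dilation n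
  have hpos : 0 < 1 / ((n : ℝ) + 2) := by positivity
  -- The bump radius is half of `(1 - t) min α β`, the radius guaranteed by star-shapedness at `t =
  -- dilation n`.
  have hball : Metric.closedBall z η.rOut ⊆ stadium α β := by
    refine subset_trans (Metric.closedBall_subset_ball ?_)
      (ball_subset_stadium hα hβ hp (by linarith) (dilation_lt_one n))
    have e : η.rOut = min α β * (1 / ((n : ℝ) + 2)) / 2 := by
      simp [hη, shrinkingBump, div_eq_mul_inv]
    have := mul_pos (lt_min hα hβ) hpos
    rw [e, dilation]; linarith
  have hcd : ContDiff ℝ ∞ (η.normed volume) := η.contDiff_normed (n := ⊤)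
  have hcs : HasCompactSupport (η.normed volume) := η.hasCompactSupport_normed
  have h1 := hcs.hasFDerivAt_convolution_left (μ := volume)
    (ContinuousLinearMap.lsmul ℝ ℝ) (hcd.of_le (by simp)) hv0 z
  have h2 : HasFDerivAt (fun q : ℝ × ℝ => dilation n • q)
    (dilation n • ContinuousLinearMap.id ℝ (ℝ × ℝ)) p := by
    exact (hasFDerivAt_id p).const_smul (dilation n)
  have h3 : fderiv ℝ (dilatedMollification (min α β) (lt_min hα hβ)
      ((stadium α β).indicator v) n) p = _ := (h1.comp p h2).fderiv
  have h5 := (hcs.fderiv (𝕜 := ℝ)).convolutionExists_left (μ := volume)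
    ((ContinuousLinearMap.lsmul ℝ ℝ).precompL (ℝ × ℝ)) (hcd.continuous_fderiv (by simp)) hv0 z
  set ψ : ℝ × ℝ → ℝ := fun q => η.normed volume (z - q) with hψ
  have hψd : ∀ q, fderiv ℝ ψ q e = -fderiv ℝ (η.normed volume) (z - q) e := by
    intro q
    have := ((hcd.differentiable (by simp) (z - q)).hasFDerivAt.comp q
      ((hasFDerivAt_id q).const_sub z)).fderiv
    change fderiv ℝ ψ q = _ at this
    rw [this]; simp
  have hψs : tsupport ψ ⊆ stadium α β := by
    refine subset_trans (closure_minimal (fun q hq => ?_) Metric.isClosed_closedBall) hball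
    have : z - q ∈ Function.support (η.normed volume) := hq
    rw [η.support_normed_eq] at this
    rw [Metric.mem_closedBall, dist_eq_norm, norm_sub_rev]
    simpa using (Metric.mem_ball.1 this).le
  have hψc : HasCompactSupport ψ := by
    refine HasCompactSupport.of_support_subset_isCompact (isCompact_closedBall z η.rOut) ?_
    intro q hq
    have : z - q ∈ Function.support (η.normed volume) := hq
    rw [η.support_normed_eq] at this
    rw [Metric.mem_closedBall, dist_eq_norm, norm_sub_rev]
    simpa using (Metric.mem_ball.1 this).le
  have hweak := h ψ (hcd.comp (contDiff_const.sub contDiff_id)) hψc hψs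
  simp only [hψd, neg_smul, integral_neg, neg_inj] at hweak
  rw [h3, ContinuousLinearMap.comp_apply, _root_.smul_apply,
    ContinuousLinearMap.id_apply, map_smul]
  congr 1
  have hind : ∀ (c : ℝ × ℝ → ℝ) (g : ℝ × ℝ → ℂ),
      ∫ q, c q • (stadium α β).indicator g (z - q) = ∫ q in stadium α β, c (z - q) • g q := by
    intro c g
    rw [← integral_indicator measurableSet_stadium,
      ← integral_sub_left_eq_self _ (volume : Measure (ℝ × ℝ)) z]
    refine integral_congr_ae (Eventually.of_forall fun q => ?_)
    simp only [sub_sub_cancel]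
    by_cases hq : q ∈ stadium α β <;> simp [hq]
  rw [dilatedMollification, convolution_def, ContinuousLinearMap.integral_apply h5,
    convolution_def]
  simp only [ContinuousLinearMap.precompL_apply, ContinuousLinearMap.lsmul_apply]
  rw [hind (fun q => fderiv ℝ (η.normed volume) q e) v, hweak, hind]

/-- Functions which are smooth up to the boundary are dense in `H¹` of the stadium. -/
theorem HasWeakGrad.exists_smooth_approx (hα : 0 < α) (hβ : 0 < β) {v vx vy : ℝ × ℝ → ℂ}
    (h : HasWeakGrad (stadium α β) v vx vy) :
    ∃ φ : ℕ → ℝ × ℝ → ℂ, (∀ n, ContDiff ℝ ∞ (φ n)) ∧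
      TendstoL2 (volume.restrict (stadium α β)) φ v ∧
      TendstoL2 (volume.restrict (stadium α β)) (fun n p => fderiv ℝ (φ n) p (1, 0)) vx ∧
      TendstoL2 (volume.restrict (stadium α β)) (fun n p => fderiv ℝ (φ n) p (0, 1)) vy := by
  have hmem : ∀ {g : ℝ × ℝ → ℂ}, MemLp g 2 (volume.restrict (stadium α β)) →
      MemLp ((stadium α β).indicator g) 2 volume := fun hg =>
    (memLp_indicator_iff_restrict measurableSet_stadium).2 hg
  have hlim : ∀ {g : ℝ × ℝ → ℂ}, MemLp g 2 (volume.restrict (stadium α β)) →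
      TendstoL2 (volume.restrict (stadium α β))
        (dilatedMollification (min α β) (lt_min hα hβ) ((stadium α β).indicator g)) g := fun hg =>
    (tendsto_dilatedMollification (hmem hg) measurableSet_stadium
      fun p hp => norm_le_of_mem hα hβ hp).congr
      (indicator_ae_eq_restrict measurableSet_stadium)
  have hderiv : ∀ {e : ℝ × ℝ} {w : ℝ × ℝ → ℂ}, MemLp w 2 (volume.restrict (stadium α β)) →
      IsWeakPartial (stadium α β) e v w →
      TendstoL2 (volume.restrict (stadium α β)) (fun n p => fderiv ℝ
        (dilatedMollification (min α β) (lt_min hα hβ) ((stadium α β).indicator v) n) p e) w := by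
    intro e w hw hweak
    refine TendstoL2.congr_seq (TendstoL2.smul_seq tendsto_dilation (hlim hw)) fun n => ?_
    filter_upwards [ae_mem_stadium] with p hp
    exact (fderiv_dilatedMollification hα hβ h.memLp hweak n hp).symm
  exact ⟨_, fun n => contDiff_dilatedMollification ((hmem h.memLp).locallyIntegrable one_le_two) n,
    hlim h.memLp, hderiv h.memLp_x h.partial_x, hderiv h.memLp_y h.partial_y⟩

end Density

end Stadium

end

noncomputable section

namespace Stadium

open scoped RealInnerProductSpace

variable {α β : ℝ}

/-! ### Gradients and traces by approximation. -/

/-- The pair `(fx, fy)` is the gradient of `f` and `t` is the boundary trace of `f`, in the sense of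
approximation by functions with bounded partial derivatives. -/
def HasH1Trace (α β : ℝ) (f fx fy t : ℝ × ℝ → ℂ) : Prop :=
  ∃ F Fx Fy : ℕ → ℝ × ℝ → ℂ, (∀ n, HasPartials α (F n) (Fx n) (Fy n)) ∧
    TendstoL2 (volume.restrict (stadium α β)) F f ∧
    TendstoL2 (volume.restrict (stadium α β)) Fx fx ∧
    TendstoL2 (volume.restrict (stadium α β)) Fy fy ∧
    TendstoL2 (boundaryMeasure α β) F t

section Weights

variable {c cx cy : ℝ × ℝ → ℝ}

lemma isBddWeight_stadium_of_bounded (hα : 0 < α) (hβ : 0 < β) (hc : StronglyMeasurable c)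
    (hb : ∃ M, ∀ p, ‖p‖ ≤ α + β → ‖c p‖ ≤ M) :
    ∃ M, IsBddWeight (volume.restrict (stadium α β)) c M := by
  obtain ⟨M, hM⟩ := hb
  refine ⟨M, hc.aestronglyMeasurable, ?_⟩
  filter_upwards [ae_mem_stadium] with p hp using hM p (norm_le_of_mem hα hβ hp)

lemma isBddWeight_boundary_of_bounded (hα : 0 < α) (hβ : 0 < β) (hc : StronglyMeasurable c)
    (hb : ∃ M, ∀ p, ‖p‖ ≤ α + β → ‖c p‖ ≤ M) :
    ∃ M, IsBddWeight (boundaryMeasure α β) c M := by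
  obtain ⟨M, hM⟩ := hb
  refine ⟨M, hc.aestronglyMeasurable, ?_⟩
  filter_upwards [ae_boundaryMeasure hα] with p hp using hM p (norm_le_of_le hα hβ hp.le)

lemma isBddWeight_stadium (hα : 0 < α) (hβ : 0 < β) (hc : Continuous c) :
    ∃ M, IsBddWeight (volume.restrict (stadium α β)) c M :=
  isBddWeight_stadium_of_bounded hα hβ hc.stronglyMeasurable (exists_bound_of_continuous hc _)

lemma isBddWeight_boundary (hα : 0 < α) (hβ : 0 < β) (hc : Continuous c) :
    ∃ M, IsBddWeight (boundaryMeasure α β) c M :=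
  isBddWeight_boundary_of_bounded hα hβ hc.stronglyMeasurable (exists_bound_of_continuous hc _)

lemma HasPartials.isBddWeight_x (hα : 0 < α) (hβ : 0 < β) (h : HasPartials α c cx cy) :
    ∃ M, IsBddWeight (volume.restrict (stadium α β)) cx M :=
  isBddWeight_stadium_of_bounded hα hβ h.meas_x <| by
    obtain ⟨M, hM⟩ := h.bounded (α + β)
    exact ⟨M, fun p hp => (hM p hp).1⟩

lemma HasPartials.isBddWeight_y (hα : 0 < α) (hβ : 0 < β) (h : HasPartials α c cx cy) :
    ∃ M, IsBddWeight (volume.restrict (stadium α β)) cy M :=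
  isBddWeight_stadium_of_bounded hα hβ h.meas_y <| by
    obtain ⟨M, hM⟩ := h.bounded (α + β)
    exact ⟨M, fun p hp => (hM p hp).2⟩

end Weights

section Basic

variable {f fx fy t g gx gy s : ℝ × ℝ → ℂ}

lemma HasH1Trace.memLp (h : HasH1Trace α β f fx fy t) :
    MemLp f 2 (volume.restrict (stadium α β)) := by
  obtain ⟨F, Fx, Fy, -, h1, -, -, -⟩ := h; exact h1.memLp_lim

lemma HasH1Trace.memLp_x (h : HasH1Trace α β f fx fy t) :
    MemLp fx 2 (volume.restrict (stadium α β)) := by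
  obtain ⟨F, Fx, Fy, -, -, h1, -, -⟩ := h; exact h1.memLp_lim

lemma HasH1Trace.memLp_y (h : HasH1Trace α β f fx fy t) :
    MemLp fy 2 (volume.restrict (stadium α β)) := by
  obtain ⟨F, Fx, Fy, -, -, -, h1, -⟩ := h; exact h1.memLp_lim

lemma HasH1Trace.memLp_trace (h : HasH1Trace α β f fx fy t) :
    MemLp t 2 (boundaryMeasure α β) := by
  obtain ⟨F, Fx, Fy, -, -, -, -, h1⟩ := h; exact h1.memLp_lim

lemma HasH1Trace.add (hf : HasH1Trace α β f fx fy t) (hg : HasH1Trace α β g gx gy s) :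
    HasH1Trace α β (fun p => f p + g p) (fun p => fx p + gx p) (fun p => fy p + gy p)
      (fun p => t p + s p) := by
  obtain ⟨F, Fx, Fy, h0, h1, h2, h3, h4⟩ := hf
  obtain ⟨G, Gx, Gy, k0, k1, k2, k3, k4⟩ := hg
  exact ⟨_, _, _, fun n => (h0 n).add (k0 n), h1.add k1, h2.add k2, h3.add k3, h4.add k4⟩

lemma HasH1Trace.sub (hf : HasH1Trace α β f fx fy t) (hg : HasH1Trace α β g gx gy s) :
    HasH1Trace α β (fun p => f p - g p) (fun p => fx p - gx p) (fun p => fy p - gy p)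
      (fun p => t p - s p) := by
  obtain ⟨F, Fx, Fy, h0, h1, h2, h3, h4⟩ := hf
  obtain ⟨G, Gx, Gy, k0, k1, k2, k3, k4⟩ := hg
  exact ⟨_, _, _, fun n => (h0 n).sub (k0 n), h1.sub k1, h2.sub k2, h3.sub k3, h4.sub k4⟩

/-- Approximants that may have kinks at `|x| = α` are stable under the Lipschitz weights built from
`σ`; smooth approximants would not be. -/
lemma HasH1Trace.smul (hα : 0 < α) (hβ : 0 < β) (hf : HasH1Trace α β f fx fy t)
    {c cx cy : ℝ × ℝ → ℝ} (hc : HasPartials α c cx cy) :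
    HasH1Trace α β (fun p => c p • f p) (fun p => c p • fx p + cx p • f p)
      (fun p => c p • fy p + cy p • f p) (fun p => c p • t p) := by
  obtain ⟨F, Fx, Fy, h0, h1, h2, h3, h4⟩ := hf
  obtain ⟨M, hM⟩ := isBddWeight_stadium hα hβ hc.continuous
  obtain ⟨M', hM'⟩ := isBddWeight_boundary hα hβ hc.continuous
  obtain ⟨Mx, hMx⟩ := hc.isBddWeight_x hα hβ
  obtain ⟨My, hMy⟩ := hc.isBddWeight_y hα hβ
  exact ⟨_, _, _, fun n => hc.smul (h0 n), h1.smul hM, (h2.smul hM).add (h1.smul hMx),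
    (h3.smul hM).add (h1.smul hMy), h4.smul hM'⟩

lemma HasH1Trace.congr {f' fx' fy' t' : ℝ × ℝ → ℂ} (h : HasH1Trace α β f fx fy t)
    (hf : f =ᵐ[volume.restrict (stadium α β)] f')
    (hx : fx =ᵐ[volume.restrict (stadium α β)] fx')
    (hy : fy =ᵐ[volume.restrict (stadium α β)] fy')
    (ht : t =ᵐ[boundaryMeasure α β] t') : HasH1Trace α β f' fx' fy' t' := by
  obtain ⟨F, Fx, Fy, h0, h1, h2, h3, h4⟩ := h
  exact ⟨F, Fx, Fy, h0, h1.congr hf, h2.congr hx, h3.congr hy, h4.congr ht⟩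

lemma HasPartials.memLp (hα : 0 < α) (hβ : 0 < β) (h : HasPartials α f fx fy) :
    MemLp f 2 (volume.restrict (stadium α β)) ∧ MemLp fx 2 (volume.restrict (stadium α β)) ∧
      MemLp fy 2 (volume.restrict (stadium α β)) ∧ MemLp f 2 (boundaryMeasure α β) := by
  have := isFiniteMeasure_stadium hα hβ
  obtain ⟨M, hM⟩ := exists_bound_of_continuous h.continuous (α + β)
  obtain ⟨M', hM'⟩ := h.bounded (α + β)
  refine ⟨MemLp.of_bound h.continuous.aestronglyMeasurable M ?_,
    MemLp.of_bound h.meas_x.aestronglyMeasurable M' ?_,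
    MemLp.of_bound h.meas_y.aestronglyMeasurable M' ?_,
    MemLp.of_bound h.continuous.aestronglyMeasurable M ?_⟩
  · filter_upwards [ae_mem_stadium] with p hp using hM p (norm_le_of_mem hα hβ hp)
  · filter_upwards [ae_mem_stadium] with p hp using (hM' p (norm_le_of_mem hα hβ hp)).1
  · filter_upwards [ae_mem_stadium] with p hp using (hM' p (norm_le_of_mem hα hβ hp)).2
  · filter_upwards [ae_boundaryMeasure hα] with p hp using hM p (norm_le_of_le hα hβ hp.le)

lemma HasPartials.hasH1Trace (hα : 0 < α) (hβ : 0 < β) (h : HasPartials α f fx fy) :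
    HasH1Trace α β f fx fy f := by
  obtain ⟨h1, h2, h3, h4⟩ := h.memLp hα hβ
  exact ⟨fun _ => f, fun _ => fx, fun _ => fy, fun _ => h, .const h1, .const h2, .const h3,
    .const h4⟩

end Basic

/-! ### Integration by parts with weights. -/

section Green

variable {f fx fy t g gx gy s : ℝ × ℝ → ℂ} {b bx by' : ℝ × ℝ → ℝ}

lemma integral_add_three {μ : Measure (ℝ × ℝ)} {F₁ F₂ F₃ : ℝ × ℝ → ℝ} (h₁ : Integrable F₁ μ)
    (h₂ : Integrable F₂ μ) (h₃ : Integrable F₃ μ) :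
    (∫ p, F₁ p ∂μ) + (∫ p, F₂ p ∂μ) + (∫ p, F₃ p ∂μ) = ∫ p, F₁ p + F₂ p + F₃ p ∂μ := by
  rw [integral_add (f := fun p => F₁ p + F₂ p) (h₁.add h₂) h₃, integral_add h₁ h₂]

/-- Integration by parts in the horizontal direction with a weight. -/
theorem HasH1Trace.green_x (hα : 0 < α) (hβ : 0 < β) (hf : HasH1Trace α β f fx fy t)
    (hg : HasH1Trace α β g gx gy s) (hb : HasPartials α b bx by') :
    pairing (volume.restrict (stadium α β)) bx f g
      + pairing (volume.restrict (stadium α β)) b fx g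
      + pairing (volume.restrict (stadium α β)) b f gx =
    pairing (boundaryMeasure α β) (fun p => (outwardNormal α β p).1 * b p) t s := by
  obtain ⟨F, Fx, Fy, h0, h1, h2, h3, h4⟩ := hf
  obtain ⟨G, Gx, Gy, k0, k1, k2, k3, k4⟩ := hg
  obtain ⟨M, hM⟩ := isBddWeight_stadium hα hβ hb.continuous
  obtain ⟨M', hM'⟩ := isBddWeight_boundary (c := fun p => (outwardNormal α β p).1 * b p) hα hβ
    (continuous_outwardNormal_fst.mul hb.continuous)
  obtain ⟨Mx, hMx⟩ := hb.isBddWeight_x hα hβ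
  -- Both sides are continuous under the `L²` convergences in the definition of `HasH1Trace`, so the
  -- identity is needed for the approximants only.
  refine tendsto_nhds_unique
    (((h1.pairing k1 hMx).add (h2.pairing k1 hM)).add (h1.pairing k2 hM)) ?_
  refine (h4.pairing k4 hM').congr fun n => ?_
  have := (hb.smul ((h0 n).inner (k0 n))).green_x hα hβ
  simp only [smul_eq_mul] at this
  simp only [pairing]
  rw [integral_add_three (integrable_pairing hMx (h1.memLp n) (k1.memLp n))
    (integrable_pairing hM (h2.memLp n) (k1.memLp n))
    (integrable_pairing hM (h1.memLp n) (k2.memLp n))]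
  simp only [mul_assoc]
  rw [← this]
  refine integral_congr_ae (Eventually.of_forall fun p => ?_)
  simp only
  ring

/-- Integration by parts in the vertical direction with a weight. -/
theorem HasH1Trace.green_y (hα : 0 < α) (hβ : 0 < β) (hf : HasH1Trace α β f fx fy t)
    (hg : HasH1Trace α β g gx gy s) (hb : HasPartials α b bx by') :
    pairing (volume.restrict (stadium α β)) by' f g
      + pairing (volume.restrict (stadium α β)) b fy g
      + pairing (volume.restrict (stadium α β)) b f gy =
    pairing (boundaryMeasure α β) (fun p => (outwardNormal α β p).2 * b p) t s := by
  obtain ⟨F, Fx, Fy, h0, h1, h2, h3, h4⟩ := hf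
  obtain ⟨G, Gx, Gy, k0, k1, k2, k3, k4⟩ := hg
  obtain ⟨M, hM⟩ := isBddWeight_stadium hα hβ hb.continuous
  obtain ⟨M', hM'⟩ := isBddWeight_boundary (c := fun p => (outwardNormal α β p).2 * b p) hα hβ
    (continuous_outwardNormal_snd.mul hb.continuous)
  obtain ⟨My, hMy⟩ := hb.isBddWeight_y hα hβ
  refine tendsto_nhds_unique
    (((h1.pairing k1 hMy).add (h3.pairing k1 hM)).add (h1.pairing k3 hM)) ?_
  refine (h4.pairing k4 hM').congr fun n => ?_
  have := (hb.smul ((h0 n).inner (k0 n))).green_y hα hβ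
  simp only [smul_eq_mul] at this
  simp only [pairing]
  rw [integral_add_three (integrable_pairing hMy (h1.memLp n) (k1.memLp n))
    (integrable_pairing hM (h3.memLp n) (k1.memLp n))
    (integrable_pairing hM (h1.memLp n) (k3.memLp n))]
  simp only [mul_assoc]
  rw [← this]
  refine integral_congr_ae (Eventually.of_forall fun p => ?_)
  simp only
  ring

/-- A regularization of `wingIndicator`. -/
def wingCutoff (α : ℝ) (k : ℕ) (x : ℝ) : ℝ := 1 - Real.exp (-(k * |wingOffset α x|))

lemma wingCutoff_mem (k : ℕ) (x : ℝ) : 0 ≤ wingCutoff α k x ∧ wingCutoff α k x ≤ 1 := by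
  have h1 : Real.exp (-(k * |wingOffset α x|)) ≤ 1 := by
    rw [Real.exp_le_one_iff]
    have : 0 ≤ (k : ℝ) * |wingOffset α x| := by positivity
    linarith
  have h2 := Real.exp_pos (-(k * |wingOffset α x|))
  unfold wingCutoff
  constructor <;> linarith

lemma abs_wingCutoff_le (k : ℕ) (x : ℝ) : |wingCutoff α k x| ≤ 1 := by
  obtain ⟨h1, h2⟩ := wingCutoff_mem (α := α) k x
  rwa [abs_of_nonneg h1]

lemma tendsto_wingCutoff (hα : 0 < α) (x : ℝ) :
    Tendsto (fun k => wingCutoff α k x) atTop (𝓝 (wingIndicator α x)) := by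
  unfold wingIndicator
  split_ifs with h
  · have h0 := abs_pos.2 ((wingOffset_ne_zero_iff hα).2 h)
    have h1 : Tendsto (fun k : ℕ => (k : ℝ) * |wingOffset α x|) atTop atTop :=
      tendsto_natCast_atTop_atTop.atTop_mul_const h0
    have h2 := (Real.tendsto_exp_neg_atTop_nhds_zero.comp h1).const_sub 1
    rw [sub_zero] at h2
    exact h2
  · simp [wingCutoff, wingOffset_of_abs_le (not_lt.1 h)]

lemma hasPartials_wingCutoff (hα : 0 < α) (k : ℕ) :
    HasPartials α (fun p => wingCutoff α k p.1)
      (fun p => k * wingSign α p.1 * Real.exp (-(k * |wingOffset α p.1|))) (fun _ => 0) := by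
  have hw := continuous_wingOffset (α := α)
  have hd : ∀ x, |x| ≠ α → HasDerivAt (wingCutoff α k)
      (k * wingSign α x * Real.exp (-(k * |wingOffset α x|))) x := by
    intro x hx
    have h1 : HasDerivAt (fun x => |wingOffset α x|) (wingSign α x) x :=
      (hasPartials_abs_wingOffset hα).deriv_x x 0 hx
    refine (((h1.const_mul (k : ℝ)).fun_neg.exp).const_sub 1).congr_deriv ?_
    ring
  refine HasPartials.of_fst (c' := fun x => k * wingSign α x * Real.exp (-(k * |wingOffset α x|)))
    (M := k) ?_ hd ?_ fun x => ?_
  · unfold wingCutoff; fun_prop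
  · exact (measurable_const.mul measurable_wingSign).mul
      (by fun_prop : Continuous fun x => Real.exp (-(k * |wingOffset α x|))).measurable
  · have h1 : Real.exp (-(k * |wingOffset α x|)) ≤ 1 := by
      rw [Real.exp_le_one_iff]
      have : 0 ≤ (k : ℝ) * |wingOffset α x| := by positivity
      linarith
    rw [abs_mul, abs_mul, Nat.abs_cast, abs_of_pos (Real.exp_pos _), mul_assoc]
    refine mul_le_of_le_one_right (Nat.cast_nonneg k) ?_
    exact mul_le_one₀ (abs_wingSign_le x) (Real.exp_pos _).le h1

lemma tendsto_pairing_weight {μ : Measure (ℝ × ℝ)} {c : ℕ → ℝ × ℝ → ℝ} {c' : ℝ × ℝ → ℝ} {M : ℝ}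
    (hc : ∀ n, IsBddWeight μ (c n) M) (hlim : ∀ p, Tendsto (fun n => c n p) atTop (𝓝 (c' p)))
    (hf : MemLp f 2 μ) (hg : MemLp g 2 μ) :
    Tendsto (fun n => pairing μ (c n) f g) atTop (𝓝 (pairing μ c' f g)) := by
  have h1 := integrable_pairing (isBddWeight_one (μ := μ)) hf hg
  refine tendsto_integral_of_dominated_convergence (fun p => M * ‖(1 : ℝ) * ⟪f p, g p⟫‖)
    (fun n => (integrable_pairing (hc n) hf hg).1) (h1.norm.const_mul M) (fun n => ?_)
    (Eventually.of_forall fun p => (hlim p).mul_const _)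
  filter_upwards [(hc n).bound] with p hp
  rw [one_mul, norm_mul]
  exact mul_le_mul_of_nonneg_right hp (norm_nonneg _)

lemma IsBddWeight.mul_left_of_abs_le_one {μ : Measure (ℝ × ℝ)} {c d : ℝ × ℝ → ℝ} {M : ℝ}
    (hd : IsBddWeight μ d M) (hc : AEStronglyMeasurable c μ) (h : ∀ p, |c p| ≤ 1) :
    IsBddWeight μ (fun p => c p * d p) M := by
  refine ⟨hc.mul hd.meas, ?_⟩
  filter_upwards [hd.bound] with p hp
  rw [abs_mul]
  exact (mul_le_of_le_one_left (abs_nonneg _) (h p)).trans hp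

/-- Integration by parts in the vertical direction over the wings only. -/
theorem HasH1Trace.green_y_wing (hα : 0 < α) (hβ : 0 < β) (hf : HasH1Trace α β f fx fy t)
    (hg : HasH1Trace α β g gx gy s) (hb : HasPartials α b bx by') :
    pairing (volume.restrict (stadium α β)) (fun p => wingIndicator α p.1 * by' p) f g
      + pairing (volume.restrict (stadium α β)) (fun p => wingIndicator α p.1 * b p) fy g
      + pairing (volume.restrict (stadium α β)) (fun p => wingIndicator α p.1 * b p) f gy =
    pairing (boundaryMeasure α β)
      (fun p => wingIndicator α p.1 * ((outwardNormal α β p).2 * b p)) t s := by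
  obtain ⟨M, hM⟩ := isBddWeight_stadium hα hβ hb.continuous
  obtain ⟨M', hM'⟩ := isBddWeight_boundary (c := fun p => (outwardNormal α β p).2 * b p) hα hβ
    (continuous_outwardNormal_snd.mul hb.continuous)
  obtain ⟨My, hMy⟩ := hb.isBddWeight_y hα hβ
  have hk : ∀ (k : ℕ) {μ : Measure (ℝ × ℝ)}, AEStronglyMeasurable
      (fun p : ℝ × ℝ => wingCutoff α k p.1) μ := fun k _ =>
    (hasPartials_wingCutoff hα k).continuous.aestronglyMeasurable
  have hle : ∀ (k : ℕ) (p : ℝ × ℝ), |wingCutoff α k p.1| ≤ 1 := fun k p => abs_wingCutoff_le k p.1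
  refine tendsto_nhds_unique (((tendsto_pairing_weight
    (fun k => hMy.mul_left_of_abs_le_one (hk k) (hle k))
      (fun p => (tendsto_wingCutoff hα p.1).mul_const _) hf.memLp hg.memLp).add
    (tendsto_pairing_weight (fun k => hM.mul_left_of_abs_le_one (hk k) (hle k))
      (fun p => (tendsto_wingCutoff hα p.1).mul_const _) hf.memLp_y hg.memLp)).add
    (tendsto_pairing_weight (fun k => hM.mul_left_of_abs_le_one (hk k) (hle k))
      (fun p => (tendsto_wingCutoff hα p.1).mul_const _) hf.memLp hg.memLp_y)) ?_
  refine (tendsto_pairing_weight (fun k => hM'.mul_left_of_abs_le_one (hk k) (hle k))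
      (fun p => (tendsto_wingCutoff hα p.1).mul_const _) hf.memLp_trace hg.memLp_trace).congr
      fun k => ?_
  -- The cutoff depends on `x` alone, so its vertical derivative vanishes and the lines `|x| = α`
  -- add no term. As `k → ∞`, dominated convergence gives the indicator of the wings.
  have := hf.green_y hα hβ hg ((hasPartials_wingCutoff hα k).smul hb)
  simp only [smul_eq_mul, zero_mul, add_zero] at this
  rw [this]
  simp only [mul_left_comm]

end Green

end Stadium

end

noncomputable section

namespace Stadium

open scoped RealInnerProductSpace

variable {α β : ℝ}

/-! ### The normal field as a weight. -/

section Normal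

/-- The formula `(σ, y)/β` extends the unit normal to a Lipschitz field on the whole plane, so its
components may be used as weights in Green's formula. -/
lemma hasPartials_normal_fst (hα : 0 < α) :
    HasPartials α (fun p => (outwardNormal α β p).1) (fun p => β⁻¹ * wingIndicator α p.1)
      (fun _ => 0) :=
  ((hasPartials_const β⁻¹).smul (hasPartials_wingOffset hα)).congr
    (fun p => by simp [outwardNormal_fst, div_eq_inv_mul]) (by simp) (by simp)

lemma hasPartials_normal_snd :
    HasPartials α (fun p => (outwardNormal α β p).2) (fun _ => 0) (fun _ => β⁻¹) :=
  ((hasPartials_const β⁻¹).smul hasPartials_snd).congr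
    (fun p => by simp [outwardNormal_snd, div_eq_inv_mul]) (by simp) (by simp)

lemma abs_outwardNormal_le (hα : 0 < α) (hβ : 0 < β) {p : ℝ × ℝ}
    (h : wingOffset α p.1 ^ 2 + p.2 ^ 2 ≤ β ^ 2) :
    |(outwardNormal α β p).1| ≤ 1 ∧ |(outwardNormal α β p).2| ≤ 1 := by
  obtain ⟨h1, -, h2⟩ := bounds_of_le hα hβ h
  rw [outwardNormal_fst, outwardNormal_snd, abs_div, abs_div, abs_of_pos hβ, div_le_one hβ,
    div_le_one hβ]
  exact ⟨h1, h2⟩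

lemma isBddWeight_normal_fst (hα : 0 < α) (hβ : 0 < β) :
    IsBddWeight (volume.restrict (stadium α β)) (fun p => (outwardNormal α β p).1) 1 := by
  refine ⟨continuous_outwardNormal_fst.aestronglyMeasurable, ?_⟩
  filter_upwards [ae_mem_stadium] with p hp
  exact (abs_outwardNormal_le hα hβ ((mem_stadium_iff hα hβ p).1 hp).le).1

lemma isBddWeight_normal_snd (hα : 0 < α) (hβ : 0 < β) :
    IsBddWeight (volume.restrict (stadium α β)) (fun p => (outwardNormal α β p).2) 1 := by
  refine ⟨continuous_outwardNormal_snd.aestronglyMeasurable, ?_⟩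
  filter_upwards [ae_mem_stadium] with p hp
  exact (abs_outwardNormal_le hα hβ ((mem_stadium_iff hα hβ p).1 hp).le).2

lemma ae_normal_sq (hα : 0 < α) (hβ : 0 < β) : ∀ᵐ p ∂(boundaryMeasure α β),
    (outwardNormal α β p).1 ^ 2 + (outwardNormal α β p).2 ^ 2 = 1 := by
  filter_upwards [ae_boundaryMeasure hα] with p hp
  rw [outwardNormal_fst, outwardNormal_snd, div_pow, div_pow, ← add_div, hp]
  field_simp

lemma isBddWeight_wingIndicator (μ : Measure (ℝ × ℝ)) :
    IsBddWeight μ (fun p => wingIndicator α p.1) 1 :=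
  ⟨(measurable_wingIndicator.comp measurable_fst).aestronglyMeasurable,
    Eventually.of_forall fun p => abs_wingIndicator_le p.1⟩

lemma isBddWeight_const (μ : Measure (ℝ × ℝ)) (a : ℝ) : IsBddWeight μ (fun _ => a) |a| :=
  ⟨aestronglyMeasurable_const, by simp⟩

lemma pairing_const {μ : Measure (ℝ × ℝ)} (a : ℝ) {f : ℝ × ℝ → ℂ} (hf : MemLp f 2 μ) :
    pairing μ (fun _ => a) f f = a * l2Norm μ f ^ 2 := by
  have := pairing_const_mul (μ := μ) a (fun _ => 1) f f
  rwa [mul_one, pairing_one_self hf] at this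

end Normal

/-! ### The trace inequality and existence of traces. -/

section TraceInequality

variable {f fx fy t : ℝ × ℝ → ℂ}

/-- The trace inequality on the stadium. -/
theorem HasH1Trace.trace_sq_le (hα : 0 < α) (hβ : 0 < β) (h : HasH1Trace α β f fx fy t) :
    l2Norm (boundaryMeasure α β) t ^ 2 ≤
      2 * β⁻¹ * l2Norm (volume.restrict (stadium α β)) f ^ 2
      + 2 * (l2Norm (volume.restrict (stadium α β)) f * l2Norm (volume.restrict (stadium α β)) fx)
      + 2 * (l2Norm (volume.restrict (stadium α β)) f *
        l2Norm (volume.restrict (stadium α β)) fy) := by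
  set μ := volume.restrict (stadium α β)
  -- This is the divergence theorem for `|f|²` times the extended normal field, whose normal
  -- component on the boundary is `n₁² + n₂² = 1`.
  have h1 := h.green_x hα hβ h (hasPartials_normal_fst (β := β) hα)
  have h2 := h.green_y hα hβ h (hasPartials_normal_snd (β := β))
  obtain ⟨M, hM⟩ := isBddWeight_boundary (α := α) (β := β) (c := fun p => (outwardNormal α β p).1 *
    (outwardNormal α β p).1) hα hβ (continuous_outwardNormal_fst.mul continuous_outwardNormal_fst)
  obtain ⟨M', hM'⟩ := isBddWeight_boundary (α := α) (β := β) (c := fun p => (outwardNormal α β p).2 *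
    (outwardNormal α β p).2) hα hβ (continuous_outwardNormal_snd.mul continuous_outwardNormal_snd)
  have h3 := pairing_add_weight hM hM' h.memLp_trace h.memLp_trace
  rw [pairing_congr (c' := fun _ => 1) (f' := t) (g' := t) ?_ (ae_eq_refl _) (ae_eq_refl _),
    pairing_one_self h.memLp_trace, ← h1, ← h2] at h3
  · rw [pairing_comm _ f fx, pairing_comm _ f fy] at h3
    have e1 := (le_abs_self _).trans
      (abs_pairing_le zero_le_one (isBddWeight_normal_fst hα hβ) h.memLp_x h.memLp)
    have e2 := (le_abs_self _).trans
      (abs_pairing_le zero_le_one (isBddWeight_normal_snd hα hβ) h.memLp_y h.memLp)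
    have e3 := pairing_const β⁻¹ h.memLp
    have e4 : pairing μ (fun p => β⁻¹ * wingIndicator α p.1) f f ≤ β⁻¹ * l2Norm μ f ^ 2 := by
      rw [pairing_const_mul]
      refine mul_le_mul_of_nonneg_left ?_ (by positivity)
      rw [← pairing_one_self h.memLp]
      exact pairing_mono (isBddWeight_wingIndicator _) isBddWeight_one h.memLp
        (Eventually.of_forall fun p => (le_abs_self _).trans (abs_wingIndicator_le _))
    nlinarith
  · filter_upwards [ae_normal_sq hα hβ] with p hp
    rw [← hp]; ring

lemma TendstoL2.tendsto_l2Norm_sub {μ : Measure (ℝ × ℝ)} {F : ℕ → ℝ × ℝ → ℂ}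
    (h : TendstoL2 μ F f) :
    Tendsto (fun n : ℕ × ℕ => l2Norm μ (fun p => F n.1 p - F n.2 p)) atTop (𝓝 0) := by
  have h1 := cauchySeq_iff_tendsto_dist_atTop_0.1 h.tendsto_toLp.cauchySeq
  refine h1.congr fun n => ?_
  rw [dist_eq_norm, ← MemLp.toLp_sub, Lp.norm_toLp]
  rfl

lemma exists_tendstoL2_of_cauchy {μ : Measure (ℝ × ℝ)} {F : ℕ → ℝ × ℝ → ℂ}
    (hF : ∀ n, MemLp (F n) 2 μ)
    (h : Tendsto (fun n : ℕ × ℕ => l2Norm μ (fun p => F n.1 p - F n.2 p)) atTop (𝓝 0)) :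
    ∃ f, TendstoL2 μ F f := by
  have h1 : CauchySeq fun n => (hF n).toLp := by
    refine cauchySeq_iff_tendsto_dist_atTop_0.2 (h.congr fun n => ?_)
    rw [dist_eq_norm, ← MemLp.toLp_sub, Lp.norm_toLp]
    rfl
  obtain ⟨f, hf⟩ := cauchySeq_tendsto_of_complete h1
  refine ⟨f, hF, Lp.memLp f, ?_⟩
  refine (Lp.tendsto_Lp_iff_tendsto_eLpNorm'' _ hF _ (Lp.memLp f)).1 ?_
  rwa [Lp.toLp_coeFn]

/-- Every `H¹` function on the stadium has a boundary trace. -/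
theorem HasWeakGrad.exists_trace (hα : 0 < α) (hβ : 0 < β)
    (h : HasWeakGrad (stadium α β) f fx fy) :
    ∃ t, HasTrace α β f t ∧ HasH1Trace α β f fx fy t := by
  obtain ⟨φ, hφ, h1, h2, h3⟩ := h.exists_smooth_approx hα hβ
  have hp : ∀ n, HasPartials α (φ n) (fun p => fderiv ℝ (φ n) p (1, 0))
      (fun p => fderiv ℝ (φ n) p (0, 1)) := fun n =>
    HasPartials.of_contDiff ((hφ n).of_le (by simp))
  have hm : ∀ n, MemLp (φ n) 2 (boundaryMeasure α β) := fun n => ((hp n).memLp hα hβ).2.2.2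
  -- Applied to differences of the smooth approximants, the trace inequality makes their boundary
  -- values Cauchy in `L²`.
  have hbound : ∀ n m, l2Norm (boundaryMeasure α β) (fun p => φ n p - φ m p) ^ 2 ≤ _ := fun n m =>
    (((hp n).sub (hp m)).hasH1Trace hα hβ).trace_sq_le hα hβ
  obtain ⟨t, ht⟩ := exists_tendstoL2_of_cauchy hm <| by
    have k1 := h1.tendsto_l2Norm_sub
    have k2 := h2.tendsto_l2Norm_sub
    have k3 := h3.tendsto_l2Norm_sub
    have k := (((k1.pow 2).const_mul (2 * β⁻¹)).add ((k1.mul k2).const_mul 2)).add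
      ((k1.mul k3).const_mul 2)
    have k' := k.sqrt
    simp only [ne_eq, OfNat.ofNat_ne_zero, not_false_eq_true, zero_pow, mul_zero, add_zero,
      Real.sqrt_zero] at k'
    refine squeeze_zero (fun _ => l2Norm_nonneg _) (fun n => ?_) k'
    exact Real.le_sqrt_of_sq_le (hbound n.1 n.2)
  exact ⟨t, ⟨ht.memLp_lim, fx, fy, h, φ, hφ, h1.tendsto, h2.tendsto, h3.tendsto, ht.tendsto⟩,
    φ, _, _, hp, h1, h2, h3, ht⟩

lemma HasTrace.hasH1Trace (hα : 0 < α) (hβ : 0 < β) (h : HasTrace α β f t) :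
    ∃ fx fy, HasWeakGrad (stadium α β) f fx fy ∧ HasH1Trace α β f fx fy t := by
  obtain ⟨ht, fx, fy, hw, φ, hφ, h1, h2, h3, h4⟩ := h
  have hp : ∀ n, HasPartials α (φ n) (fun p => fderiv ℝ (φ n) p (1, 0))
      (fun p => fderiv ℝ (φ n) p (0, 1)) := fun n =>
    HasPartials.of_contDiff ((hφ n).of_le (by simp))
  have hm := fun n => (hp n).memLp hα hβ
  exact ⟨fx, fy, hw, φ, _, _, hp, ⟨fun n => (hm n).1, hw.memLp, h1⟩,
    ⟨fun n => (hm n).2.1, hw.memLp_x, h2⟩, ⟨fun n => (hm n).2.2.1, hw.memLp_y, h3⟩,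
    ⟨fun n => (hm n).2.2.2, ht, h4⟩⟩

end TraceInequality

/-! ### Uniqueness of weak derivatives and traces. -/

section WeakDerivatives

variable {f fx fy t f' fx' fy' t' : ℝ × ℝ → ℂ}

lemma memLp_two_integrable {μ : Measure (ℝ × ℝ)} [IsFiniteMeasure μ] (hf : MemLp f 2 μ) :
    Integrable f μ := hf.integrable one_le_two

lemma pairing_const_right {μ : Measure (ℝ × ℝ)} [IsFiniteMeasure μ] {c : ℝ × ℝ → ℝ} {M : ℝ}
    (hc : IsBddWeight μ c M) (hf : MemLp f 2 μ) (e : ℂ) :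
    pairing μ c f (fun _ => e) = ⟪e, ∫ p, c p • f p ∂μ⟫ := by
  rw [← integral_inner (memLp_two_integrable (hc.memLp_smul hf))]
  simp only [pairing, real_inner_smul_right, real_inner_comm]

/-- The pairing sees only real parts; testing against every constant `e : ℂ` recovers the
complex-valued identity. -/
lemma integral_eq_of_pairing_const {μ : Measure (ℝ × ℝ)} [IsFiniteMeasure μ]
    {c c' : ℝ × ℝ → ℝ} {M M' : ℝ} (hc : IsBddWeight μ c M) (hc' : IsBddWeight μ c' M')
    (hf : MemLp f 2 μ) (hf' : MemLp f' 2 μ)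
    (h : ∀ e : ℂ, pairing μ c f (fun _ => e) + pairing μ c' f' (fun _ => e) = 0) :
    ∫ p, c p • f p ∂μ = -∫ p, c' p • f' p ∂μ := by
  rw [eq_neg_iff_add_eq_zero]
  refine ext_inner_left ℝ fun e => ?_
  rw [inner_add_right, ← pairing_const_right hc hf, ← pairing_const_right hc' hf', h,
    inner_zero_right]

lemma hasH1Trace_const (hα : 0 < α) (hβ : 0 < β) (e : ℂ) :
    HasH1Trace α β (fun _ => e) (fun _ => 0) (fun _ => 0) (fun _ => e) :=
  (hasPartials_const e).hasH1Trace hα hβ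

lemma pairing_zero_right {μ : Measure (ℝ × ℝ)} (c : ℝ × ℝ → ℝ) (f : ℝ × ℝ → ℂ) :
    pairing μ c f (fun _ => 0) = 0 := by simp [pairing]

lemma pairing_zero_left {μ : Measure (ℝ × ℝ)} (c : ℝ × ℝ → ℝ) (f : ℝ × ℝ → ℂ) :
    pairing μ c (fun _ => 0) f = 0 := by simp [pairing]

lemma pairing_eq_zero_of_weight {μ : Measure (ℝ × ℝ)} {c : ℝ × ℝ → ℝ} (h : ∀ᵐ p ∂μ, c p = 0)
    (f g : ℝ × ℝ → ℂ) : pairing μ c f g = 0 := by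
  rw [pairing, ← integral_zero (ℝ × ℝ) ℝ (μ := μ)]
  refine integral_congr_ae ?_
  filter_upwards [h] with p hp
  rw [hp, zero_mul]

lemma ae_eq_zero_of_tsupport_subset (hα : 0 < α) (hβ : 0 < β) {φ : ℝ × ℝ → ℝ}
    (h : tsupport φ ⊆ stadium α β) : ∀ᵐ p ∂(boundaryMeasure α β), φ p = 0 := by
  filter_upwards [ae_boundaryMeasure hα] with p hp
  by_contra h0
  have := (mem_stadium_iff hα hβ p).1 (h (subset_tsupport φ h0))
  linarith

/-- Limits of functions with bounded partial derivatives are weakly differentiable. -/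
theorem HasH1Trace.hasWeakGrad (hα : 0 < α) (hβ : 0 < β) (h : HasH1Trace α β f fx fy t) :
    HasWeakGrad (stadium α β) f fx fy := by
  have := isFiniteMeasure_stadium hα hβ
  refine ⟨h.memLp, h.memLp_x, h.memLp_y, fun φ hφ _ hs => ?_, fun φ hφ _ hs => ?_⟩
  · have hp := HasPartials.of_contDiff (α := α) (hφ.of_le (by simp) : ContDiff ℝ 1 φ)
    obtain ⟨M, hM⟩ := isBddWeight_stadium hα hβ hφ.continuous
    obtain ⟨M', hM'⟩ := hp.isBddWeight_x hα hβ
    refine integral_eq_of_pairing_const hM' hM h.memLp h.memLp_x fun e => ?_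
    have := h.green_x hα hβ (hasH1Trace_const hα hβ e) hp
    rw [pairing_zero_right, add_zero] at this
    rw [this]
    refine pairing_eq_zero_of_weight ?_ _ _
    filter_upwards [ae_eq_zero_of_tsupport_subset hα hβ hs] with p hp
    rw [hp, mul_zero]
  · have hp := HasPartials.of_contDiff (α := α) (hφ.of_le (by simp) : ContDiff ℝ 1 φ)
    obtain ⟨M, hM⟩ := isBddWeight_stadium hα hβ hφ.continuous
    obtain ⟨M', hM'⟩ := hp.isBddWeight_y hα hβ
    refine integral_eq_of_pairing_const hM' hM h.memLp h.memLp_y fun e => ?_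
    have := h.green_y hα hβ (hasH1Trace_const hα hβ e) hp
    rw [pairing_zero_right, add_zero] at this
    rw [this]
    refine pairing_eq_zero_of_weight ?_ _ _
    filter_upwards [ae_eq_zero_of_tsupport_subset hα hβ hs] with p hp
    rw [hp, mul_zero]

lemma ae_eq_of_integral_smul_eq (hα : 0 < α) (hβ : 0 < β) {g g' : ℝ × ℝ → ℂ}
    (hg : MemLp g 2 (volume.restrict (stadium α β)))
    (hg' : MemLp g' 2 (volume.restrict (stadium α β)))
    (h : ∀ φ : ℝ × ℝ → ℝ, ContDiff ℝ ∞ φ → HasCompactSupport φ → tsupport φ ⊆ stadium α β →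
      ∫ p in stadium α β, φ p • g p = ∫ p in stadium α β, φ p • g' p) :
    g =ᵐ[volume.restrict (stadium α β)] g' := by
  have := isFiniteMeasure_stadium hα hβ
  have hi := memLp_two_integrable (hg.sub hg')
  have h0 := isOpen_stadium.ae_eq_zero_of_integral_contDiff_smul_eq_zero
    (μ := volume.restrict (stadium α β)) (f := g - g') (U := stadium α β)
    (hi.locallyIntegrable.locallyIntegrableOn _) ?_
  · filter_upwards [h0, ae_mem_stadium] with p h1 h2
    exact sub_eq_zero.1 (h1 h2)
  · intro φ hφ hc hs
    obtain ⟨M, hM⟩ := isBddWeight_stadium hα hβ hφ.continuous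
    simp only [Pi.sub_apply, smul_sub]
    rw [integral_sub (memLp_two_integrable (hM.memLp_smul hg))
      (memLp_two_integrable (hM.memLp_smul hg')), h φ hφ hc hs, sub_self]

lemma IsWeakPartial.unique (hα : 0 < α) (hβ : 0 < β) {e : ℝ × ℝ} {g g' : ℝ × ℝ → ℂ}
    (hf : f =ᵐ[volume.restrict (stadium α β)] f')
    (hg : MemLp g 2 (volume.restrict (stadium α β)))
    (hg' : MemLp g' 2 (volume.restrict (stadium α β)))
    (h : IsWeakPartial (stadium α β) e f g) (h' : IsWeakPartial (stadium α β) e f' g') :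
    g =ᵐ[volume.restrict (stadium α β)] g' := by
  refine ae_eq_of_integral_smul_eq hα hβ hg hg' fun φ h1 h2 h3 => ?_
  rw [← neg_inj, ← h φ h1 h2 h3, ← h' φ h1 h2 h3]
  refine integral_congr_ae ?_
  filter_upwards [hf] with p hp
  rw [hp]

lemma HasWeakGrad.unique (hα : 0 < α) (hβ : 0 < β)
    (hf : f =ᵐ[volume.restrict (stadium α β)] f')
    (h : HasWeakGrad (stadium α β) f fx fy) (h' : HasWeakGrad (stadium α β) f' fx' fy') :
    fx =ᵐ[volume.restrict (stadium α β)] fx' ∧ fy =ᵐ[volume.restrict (stadium α β)] fy' :=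
  ⟨h.partial_x.unique hα hβ hf h.memLp_x h'.memLp_x h'.partial_x,
    h.partial_y.unique hα hβ hf h.memLp_y h'.memLp_y h'.partial_y⟩

/-- Boundary traces are unique. -/
theorem HasH1Trace.trace_unique (hα : 0 < α) (hβ : 0 < β)
    (hf : f =ᵐ[volume.restrict (stadium α β)] f') (h : HasH1Trace α β f fx fy t)
    (h' : HasH1Trace α β f' fx' fy' t') : t =ᵐ[boundaryMeasure α β] t' := by
  have hsub := (h.sub h').trace_sq_le hα hβ
  have h0 : l2Norm (volume.restrict (stadium α β)) (fun p => f p - f' p) = 0 := by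
    rw [l2Norm_congr (g := fun _ => 0)]
    · simp [l2Norm]
    · filter_upwards [hf] with p hp
      rw [hp, sub_self]
  simp only [h0, ne_eq, OfNat.ofNat_ne_zero, not_false_eq_true, zero_pow, mul_zero, zero_mul,
    add_zero] at hsub
  have h1 : l2Norm (boundaryMeasure α β) (fun p => t p - t' p) = 0 :=
    pow_eq_zero_iff two_ne_zero |>.1 (le_antisymm hsub (sq_nonneg _))
  have hm : MemLp (fun p => t p - t' p) 2 (boundaryMeasure α β) :=
    h.memLp_trace.sub h'.memLp_trace
  rw [l2Norm, ENNReal.toReal_eq_zero_iff, or_iff_left hm.2.ne,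
    eLpNorm_eq_zero_iff hm.1 two_ne_zero] at h1
  filter_upwards [h1] with p hp
  exact sub_eq_zero.1 hp

lemma fderiv_fderiv_comm {E : Type*} [NormedAddCommGroup E] [NormedSpace ℝ E] {φ : ℝ × ℝ → E}
    (hφ : ContDiff ℝ ∞ φ) (p e e' : ℝ × ℝ) :
    fderiv ℝ (fun q => fderiv ℝ φ q e) p e' = fderiv ℝ (fun q => fderiv ℝ φ q e') p e := by
  have hd : DifferentiableAt ℝ (fderiv ℝ φ) p :=
    (hφ.fderiv_right (m := ∞) (by simp)).differentiable (by simp) p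
  have hsymm : IsSymmSndFDerivAt ℝ φ p :=
    hφ.contDiffAt.isSymmSndFDerivAt <| by
      rw [minSmoothness_of_isRCLikeNormedField]; exact WithTop.coe_le_coe.2 le_top
  have key : ∀ e e' : ℝ × ℝ, fderiv ℝ (fun q => fderiv ℝ φ q e) p e' =
      fderiv ℝ (fderiv ℝ φ) p e' e := by
    intro e e'
    rw [fderiv_clm_apply hd (differentiableAt_const e)]
    simp
  rw [key, key]
  exact hsymm.eq e' e

lemma contDiff_fderiv_apply {E : Type*} [NormedAddCommGroup E] [NormedSpace ℝ E] {φ : ℝ × ℝ → E}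
    (hφ : ContDiff ℝ ∞ φ) (e : ℝ × ℝ) : ContDiff ℝ ∞ fun q => fderiv ℝ φ q e :=
  (hφ.fderiv_right (m := ∞) (by simp)).clm_apply contDiff_const

/-- Weak second derivatives commute. -/
lemma weak_mixed_partials (hα : 0 < α) (hβ : 0 < β) {fxx fxy fyx fyy : ℝ × ℝ → ℂ}
    (h : HasWeakGrad (stadium α β) f fx fy) (hx : HasWeakGrad (stadium α β) fx fxx fxy)
    (hy : HasWeakGrad (stadium α β) fy fyx fyy) :
    fxy =ᵐ[volume.restrict (stadium α β)] fyx := by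
  refine ae_eq_of_integral_smul_eq hα hβ hx.memLp_y hy.memLp_x fun φ h1 h2 h3 => ?_
  have hd : ∀ e, ContDiff ℝ ∞ fun q => fderiv ℝ φ q e := contDiff_fderiv_apply h1
  have hs : ∀ e, tsupport (fun q => fderiv ℝ φ q e) ⊆ stadium α β := fun e =>
    (tsupport_fderiv_apply_subset ℝ e).trans h3
  have hc : ∀ e, HasCompactSupport (fun q => fderiv ℝ φ q e) := fun e =>
    h2.fderiv_apply (𝕜 := ℝ) e
  have e1 := hx.partial_y φ h1 h2 h3
  have e2 := hy.partial_x φ h1 h2 h3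
  -- Testing the first derivatives of `f` against derivatives of `φ` puts both derivatives on `φ`,
  -- where they commute.
  have e3 := h.partial_x _ (hd (0, 1)) (hc _) (hs _)
  have e4 := h.partial_y _ (hd (1, 0)) (hc _) (hs _)
  rw [e1] at e3
  rw [e2] at e4
  simp only [fderiv_fderiv_comm h1 _ (0, 1) (1, 0)] at e3
  rw [e4] at e3
  simpa using e3.symm

end WeakDerivatives

end Stadium

end

noncomputable section

namespace Stadium

open scoped RealInnerProductSpace

variable {α β : ℝ}

/-! ### Dirichlet functions: the gradient is normal on the boundary. -/

/-- An `H²` function which vanishes on the boundary, with its derivatives up to second order and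
the traces of its gradient. -/
structure DirichletData (α β : ℝ) (u ux uy uxx uxy uyy tx ty : ℝ × ℝ → ℂ) : Prop where
  trace : HasH1Trace α β u ux uy fun _ => 0
  trace_x : HasH1Trace α β ux uxx uxy tx
  trace_y : HasH1Trace α β uy uxy uyy ty

section Tangency

variable {u ux uy uxx uxy uyy tx ty : ℝ × ℝ → ℂ}

/-- The tangential derivative of a function vanishing on the boundary is zero. -/
theorem DirichletData.tangency (hα : 0 < α) (hβ : 0 < β)
    (D : DirichletData α β u ux uy uxx uxy uyy tx ty) :
    ∀ᵐ p ∂(boundaryMeasure α β),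
      (outwardNormal α β p).2 • tx p = (outwardNormal α β p).1 • ty p := by
  obtain ⟨M₁, hM₁⟩ := isBddWeight_boundary (α := α) (β := β) hα hβ
    (continuous_outwardNormal_fst (α := α) (β := β))
  obtain ⟨M₂, hM₂⟩ := isBddWeight_boundary (α := α) (β := β) hα hβ
    (continuous_outwardNormal_snd (α := α) (β := β))
  have m₁ := hM₂.memLp_smul D.trace_x.memLp_trace
  have m₂ := hM₁.memLp_smul D.trace_y.memLp_trace
  have hm := m₁.sub m₂
  have h0 := ae_eq_zero_of_integral_contDiff_smul_eq_zero
    (memLp_two_integrable hm).locallyIntegrable fun ψ hψ _ => ?_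
  · filter_upwards [h0] with p hp
    exact sub_eq_zero.1 hp
  obtain ⟨M, hM⟩ := isBddWeight_boundary (α := α) (β := β) hα hβ hψ.continuous
  refine ext_inner_left ℝ fun e => ?_
  rw [← pairing_const_right hM hm e, inner_zero_right]
  have hp : ∀ {φ : ℝ × ℝ → ℝ}, ContDiff ℝ ∞ φ → HasPartials α φ
      (fun p => fderiv ℝ φ p (1, 0)) (fun p => fderiv ℝ φ p (0, 1)) := fun hφ =>
    HasPartials.of_contDiff (hφ.of_le (by simp))
  have he := hasH1Trace_const hα hβ e
  -- By Green's formula `∫ ψ (n₂ ∂ₓu - n₁ ∂_yu)` over the boundary is the integral of `∂_yψ ∂ₓu -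
  -- ∂ₓψ ∂_yu` over the stadium, the terms with `uxy` cancelling. A second integration by parts,
  -- without boundary terms since `u` has zero trace, leaves `u` times the commutator of derivatives
  -- of `ψ`, which is zero.
  have h1 := D.trace_x.green_y hα hβ he (hp hψ)
  have h2 := D.trace_y.green_x hα hβ he (hp hψ)
  have h3 := D.trace.green_x hα hβ he (hp (contDiff_fderiv_apply hψ (0, 1)))
  have h4 := D.trace.green_y hα hβ he (hp (contDiff_fderiv_apply hψ (1, 0)))
  simp only [pairing_zero_left, pairing_zero_right, add_zero] at h1 h2 h3 h4
  simp only [fderiv_fderiv_comm hψ _ (0, 1) (1, 0)] at h3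
  have h5 := pairing_sub_left hM m₁ m₂ he.memLp_trace
  rw [pairing_smul_left, pairing_smul_left] at h5
  simp only [mul_comm (ψ _)] at h5
  rw [← h1, ← h2] at h5
  refine h5.trans ?_
  linarith

/-- The normal component of the trace of the gradient. -/
def normalTrace (α β : ℝ) (tx ty : ℝ × ℝ → ℂ) (p : ℝ × ℝ) : ℂ :=
  (outwardNormal α β p).1 • tx p + (outwardNormal α β p).2 • ty p

lemma memLp_normalTrace (hα : 0 < α) (hβ : 0 < β) (hx : MemLp tx 2 (boundaryMeasure α β))
    (hy : MemLp ty 2 (boundaryMeasure α β)) :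
    MemLp (normalTrace α β tx ty) 2 (boundaryMeasure α β) := by
  obtain ⟨M₁, hM₁⟩ := isBddWeight_boundary (α := α) (β := β) hα hβ
    (continuous_outwardNormal_fst (α := α) (β := β))
  obtain ⟨M₂, hM₂⟩ := isBddWeight_boundary (α := α) (β := β) hα hβ
    (continuous_outwardNormal_snd (α := α) (β := β))
  exact (hM₁.memLp_smul hx).add (hM₂.memLp_smul hy)

/-- Since the tangential component vanishes and `N` has length one, the trace of the gradient is
`∂_N u` times `N`. -/
lemma DirichletData.trace_eq (hα : 0 < α) (hβ : 0 < β)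
    (D : DirichletData α β u ux uy uxx uxy uyy tx ty) :
    tx =ᵐ[boundaryMeasure α β]
        (fun p => (outwardNormal α β p).1 • normalTrace α β tx ty p) ∧
      ty =ᵐ[boundaryMeasure α β]
        (fun p => (outwardNormal α β p).2 • normalTrace α β tx ty p) := by
  constructor
  · filter_upwards [D.tangency hα hβ, ae_normal_sq hα hβ] with p h1 h2
    rw [normalTrace, smul_add, smul_comm _ _ (ty p), ← h1, smul_smul, smul_smul, ← add_smul,
      ← sq, ← sq, h2, one_smul]
  · filter_upwards [D.tangency hα hβ, ae_normal_sq hα hβ] with p h1 h2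
    rw [normalTrace, smul_add, smul_comm _ _ (tx p), h1, smul_smul, smul_smul, ← add_smul,
      ← sq, ← sq, h2, one_smul]

end Tangency

/-! ### Convexity and the second derivative estimate. -/

section ConvexEstimate

variable {T Tx Ty B Bx By : ℝ × ℝ → ℂ}

/-- The integral of a Jacobian determinant vanishes if one of the functions vanishes on the
boundary. -/
theorem HasH1Trace.integral_jacobian_eq_zero (hα : 0 < α) (hβ : 0 < β)
    (hT : HasH1Trace α β T Tx Ty fun _ => 0) (hB : HasWeakGrad (stadium α β) B Bx By) :
    pairing (volume.restrict (stadium α β)) (fun _ => 1) Tx By =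
      pairing (volume.restrict (stadium α β)) (fun _ => 1) Ty Bx := by
  -- With `B` smooth, two integrations by parts move the derivatives off `T`, and the mixed second
  -- derivatives of `B` cancel. Only first derivatives of `B` appear in the statement, so `H¹`
  -- density suffices.
  obtain ⟨φ, hφ, -, h1, h2⟩ := hB.exists_smooth_approx hα hβ
  refine tendsto_nhds_unique ((TendstoL2.const hT.memLp_x).pairing h2 isBddWeight_one) ?_
  refine ((TendstoL2.const hT.memLp_y).pairing h1 isBddWeight_one).congr fun n => ?_
  have hp : ∀ e, HasH1Trace α β (fun q => fderiv ℝ (φ n) q e)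
      (fun p => fderiv ℝ (fun q => fderiv ℝ (φ n) q e) p (1, 0))
      (fun p => fderiv ℝ (fun q => fderiv ℝ (φ n) q e) p (0, 1))
      (fun q => fderiv ℝ (φ n) q e) := fun e =>
    (HasPartials.of_contDiff ((contDiff_fderiv_apply (hφ n) e).of_le (by simp))).hasH1Trace hα hβ
  have h3 := hT.green_x hα hβ (hp (0, 1)) (hasPartials_const 1)
  have h4 := hT.green_y hα hβ (hp (1, 0)) (hasPartials_const 1)
  rw [pairing_zero_left, pairing_eq_zero_of_weight (by simp)] at h3 h4
  simp only [fderiv_fderiv_comm (hφ n) _ (0, 1) (1, 0)] at h3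
  linarith

variable {u ux uy uxx uxy uyy tx ty : ℝ × ℝ → ℂ}

/-- For a function which vanishes on the boundary, the integral of the Hessian determinant is
nonnegative: this expresses the convexity of the stadium. -/
theorem DirichletData.hessian_nonneg (hα : 0 < α) (hβ : 0 < β)
    (D : DirichletData α β u ux uy uxx uxy uyy tx ty) :
    pairing (volume.restrict (stadium α β)) (fun _ => 1) uxy uxy ≤
      pairing (volume.restrict (stadium α β)) (fun _ => 1) uxx uyy := by
  set μ := volume.restrict (stadium α β)
  set n₁ : ℝ × ℝ → ℝ := fun p => (outwardNormal α β p).1 with hn₁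
  set n₂ : ℝ × ℝ → ℝ := fun p => (outwardNormal α β p).2 with hn₂
  have k₁ : HasPartials α n₁ _ _ := hasPartials_normal_fst (β := β) hα
  have k₂ : HasPartials α n₂ _ _ := hasPartials_normal_snd (β := β)
  obtain ⟨Gx, Gy, hG⟩ : ∃ Gx Gy, HasH1Trace α β (fun p => n₁ p • ux p + n₂ p • uy p) Gx Gy
      (normalTrace α β tx ty) :=
    ⟨_, _, (D.trace_x.smul hα hβ k₁).add (D.trace_y.smul hα hβ k₂)⟩
  set G : ℝ × ℝ → ℂ := fun p => n₁ p • ux p + n₂ p • uy p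
  -- With `G = n · ∇u`, the functions `P = n₁ G` and `Q = n₂ G` have the boundary traces of `ux` and
  -- `uy`. The integral of a Jacobian determinant depends on boundary values only, so `(ux, uy)` may
  -- be replaced by `(P, Q)`, one entry at a time.
  have hP := hG.smul hα hβ k₁
  have hQ := hG.smul hα hβ k₂
  simp only [zero_smul, add_zero] at hP hQ
  obtain ⟨e₁, e₂⟩ := D.trace_eq hα hβ
  have hT₁ := (D.trace_x.sub hP).congr (ae_eq_refl _) (ae_eq_refl _) (ae_eq_refl _)
    (t' := fun _ => 0) (by filter_upwards [e₁] with p hp; exact sub_eq_zero.2 hp)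
  have hT₂ := (D.trace_y.sub hQ).congr (ae_eq_refl _) (ae_eq_refl _) (ae_eq_refl _)
    (t' := fun _ => 0) (by filter_upwards [e₂] with p hp; exact sub_eq_zero.2 hp)
  have j₁ := hT₁.integral_jacobian_eq_zero hα hβ (D.trace_y.hasWeakGrad hα hβ)
  have j₂ := hT₂.integral_jacobian_eq_zero hα hβ (hP.hasWeakGrad hα hβ)
  have b1 : IsBddWeight μ (fun _ => 1) 1 := isBddWeight_one
  have bn₁ : IsBddWeight μ n₁ 1 := isBddWeight_normal_fst hα hβ
  have bn₂ : IsBddWeight μ n₂ 1 := isBddWeight_normal_snd hα hβ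
  have bχ : IsBddWeight μ (fun p => β⁻¹ * wingIndicator α p.1) _ :=
    ⟨(measurable_const.mul (measurable_wingIndicator.comp measurable_fst)).aestronglyMeasurable,
      Eventually.of_forall fun p => by
        rw [abs_mul]; exact mul_le_of_le_one_right (abs_nonneg _) (abs_wingIndicator_le p.1)⟩
  have bβ : IsBddWeight μ (fun _ => β⁻¹) _ := isBddWeight_const μ β⁻¹
  have mG := hG.memLp
  have mx := hG.memLp_x
  have my := hG.memLp_y
  rw [pairing_sub_left b1 D.trace_x.memLp_x hP.memLp_x D.trace_y.memLp_y,
    pairing_sub_left b1 D.trace_x.memLp_y hP.memLp_y D.trace_y.memLp_x] at j₁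
  rw [pairing_sub_left b1 D.trace_y.memLp_x hQ.memLp_x hP.memLp_y,
    pairing_sub_left b1 D.trace_y.memLp_y hQ.memLp_y hP.memLp_x,
    pairing_comm _ uxy, pairing_comm _ uyy] at j₂
  rw [pairing_comm (fun _ => 1) (fun p => n₂ p • Gy p + _)] at j₂
  rw [pairing_comm (fun _ => 1) (fun p => n₂ p • Gx p)] at j₂
  -- In the determinant of `(P, Q)` the term `n₁ n₂ ⟪Gx, Gy⟫` occurs here and in `i₂` and cancels.
  -- What remains has at most one derivative of `G`.
  have i₁ : pairing μ (fun _ => 1) (fun p => n₁ p • Gx p + (β⁻¹ * wingIndicator α p.1) • G p)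
      (fun p => n₂ p • Gy p + β⁻¹ • G p) =
      pairing μ (fun p => n₁ p * n₂ p) Gx Gy + β⁻¹ * pairing μ n₁ Gx G
      + β⁻¹ * pairing μ (fun p => wingIndicator α p.1 * n₂ p) G Gy
      + β⁻¹ * (β⁻¹ * pairing μ (fun p => wingIndicator α p.1) G G) := by
    have hs : MemLp (fun p => n₂ p • Gy p + β⁻¹ • G p) 2 μ :=
      (bn₂.memLp_smul my).add (bβ.memLp_smul mG)
    rw [pairing_add_left b1 (bn₁.memLp_smul mx) (bχ.memLp_smul mG) hs,
      pairing_add_right b1 (bn₁.memLp_smul mx) (bn₂.memLp_smul my) (bβ.memLp_smul mG),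
      pairing_add_right b1 (bχ.memLp_smul mG) (bn₂.memLp_smul my) (bβ.memLp_smul mG)]
    simp only [pairing_smul_left, pairing_smul_right, one_mul]
    have q : pairing μ (fun p => n₂ p * (β⁻¹ * wingIndicator α p.1)) G Gy =
        β⁻¹ * pairing μ (fun p => wingIndicator α p.1 * n₂ p) G Gy := by
      rw [← pairing_const_mul]; congr 1; ext p; ring
    simp only [pairing_const_mul, q, mul_comm (n₂ _) (n₁ _)]
    ring
  have i₂ : pairing μ (fun _ => 1) (fun p => n₁ p • Gy p) (fun p => n₂ p • Gx p) =
      pairing μ (fun p => n₁ p * n₂ p) Gx Gy := by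
    simp only [pairing_smul_left, pairing_smul_right, one_mul]
    rw [pairing_comm]
    simp only [mul_comm]
  -- By these two identities the remaining terms add up to `1/(2β)` times the boundary integral of
  -- `(n₁² + χ n₂²)|∂_N u|²`, where `χ` is the indicator of `|x| > α`. This is half the curvature
  -- integral of `|∂_N u|²`: curvature `1/β` on the arcs and zero on the sides.
  have g₁ := hG.green_x hα hβ hG k₁
  have g₂ := hG.green_y_wing hα hβ hG k₂
  have p₁ : 0 ≤ pairing (boundaryMeasure α β)
      (fun p => (outwardNormal α β p).1 * n₁ p) (normalTrace α β tx ty) (normalTrace α β tx ty) :=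
    pairing_nonneg (Eventually.of_forall fun p => mul_self_nonneg _)
  have p₂ : 0 ≤ pairing (boundaryMeasure α β)
      (fun p => wingIndicator α p.1 * ((outwardNormal α β p).2 * n₂ p))
      (normalTrace α β tx ty) (normalTrace α β tx ty) :=
    pairing_nonneg (Eventually.of_forall fun p =>
      mul_nonneg (wingIndicator_nonneg _) (mul_self_nonneg _))
  rw [← g₁, pairing_comm _ G Gx, pairing_const_mul] at p₁
  simp only [mul_comm _ β⁻¹, pairing_const_mul] at g₂
  rw [← g₂, pairing_comm _ Gy G] at p₂
  have hβi : 0 < β⁻¹ := inv_pos.2 hβ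
  have := mul_nonneg hβi.le p₁
  have := mul_nonneg hβi.le p₂
  rw [i₁, i₂] at j₂
  change pairing μ (fun _ => 1) uxx uyy - _ = pairing μ (fun _ => 1) uxy uxy - _ at j₁
  nlinarith

/-- The second derivatives of a function vanishing on the boundary are controlled by its
Laplacian. -/
theorem DirichletData.l2Norm_le_laplacian (hα : 0 < α) (hβ : 0 < β)
    (D : DirichletData α β u ux uy uxx uxy uyy tx ty) :
    l2Norm (volume.restrict (stadium α β)) uyy ≤
      l2Norm (volume.restrict (stadium α β)) (fun p => uxx p + uyy p) := by
  set μ := volume.restrict (stadium α β)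
  have mx := D.trace_x.memLp_x
  have my := D.trace_y.memLp_y
  have mxy : MemLp uxy 2 μ := D.trace_x.memLp_y
  have hs : MemLp (fun p => uxx p + uyy p) 2 μ := mx.add my
  have h1 := pairing_one_self hs
  have h2 := pairing_add_left (isBddWeight_one (μ := μ)) mx my hs
  rw [pairing_add_right isBddWeight_one mx mx my, pairing_add_right isBddWeight_one my mx my,
    pairing_one_self mx, pairing_one_self my, pairing_comm _ uyy uxx] at h2
  -- Expanding the square of `uxx + uyy`, the cross term is at least `2‖uxy‖²`, so each pure second
  -- derivative is bounded by the Laplacian.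
  have h3 := D.hessian_nonneg hα hβ
  rw [pairing_one_self mxy] at h3
  refine (sq_le_sq₀ (l2Norm_nonneg _) (l2Norm_nonneg _)).1 ?_
  have h4 : l2Norm μ (fun p => uxx p + uyy p) ^ 2 = _ := h1.symm.trans h2
  rw [h4]
  nlinarith [sq_nonneg (l2Norm μ uxx), sq_nonneg (l2Norm μ uxy)]

end ConvexEstimate

end Stadium

end

noncomputable section

namespace Stadium

open scoped RealInnerProductSpace

variable {α β lam : ℝ} {u ux uy uxx uxy uyy tx ty f : ℝ × ℝ → ℂ}

/-! ### Rellich, Green and energy identities. -/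

section Rellich

/-- Because the gradient is `∂_N u` times `N` on the boundary, a quadratic form in its components is
a scalar weight times `|∂_N u|²`. -/
lemma DirichletData.boundary_form (hα : 0 < α) (hβ : 0 < β)
    (D : DirichletData α β u ux uy uxx uxy uyy tx ty) {c₁ c₂ c₃ d : ℝ × ℝ → ℝ}
    (h₁ : Continuous c₁) (h₂ : Continuous c₂) (h₃ : Continuous c₃)
    (hd : ∀ᵐ p ∂(boundaryMeasure α β), c₁ p * (outwardNormal α β p).1 ^ 2
      + c₂ p * (outwardNormal α β p).2 ^ 2
      + c₃ p * ((outwardNormal α β p).1 * (outwardNormal α β p).2) = d p) :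
    pairing (boundaryMeasure α β) c₁ tx tx + pairing (boundaryMeasure α β) c₂ ty ty
      + pairing (boundaryMeasure α β) c₃ tx ty =
    pairing (boundaryMeasure α β) d (normalTrace α β tx ty) (normalTrace α β tx ty) := by
  obtain ⟨M₁, hM₁⟩ := isBddWeight_boundary (α := α) (β := β) hα hβ h₁
  obtain ⟨M₂, hM₂⟩ := isBddWeight_boundary (α := α) (β := β) hα hβ h₂
  obtain ⟨M₃, hM₃⟩ := isBddWeight_boundary (α := α) (β := β) hα hβ h₃
  have mx := D.trace_x.memLp_trace
  have my := D.trace_y.memLp_trace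
  obtain ⟨e₁, e₂⟩ := D.trace_eq hα hβ
  simp only [pairing]
  rw [integral_add_three (integrable_pairing hM₁ mx mx) (integrable_pairing hM₂ my my)
    (integrable_pairing hM₃ mx my)]
  refine integral_congr_ae ?_
  filter_upwards [hd, e₁, e₂] with p hp h1 h2
  rw [← hp, h1, h2]
  simp only [real_inner_smul_left, real_inner_smul_right]
  ring

/-- The Rellich identity for the horizontal vector field with coefficient `b`. -/
theorem DirichletData.rellich_x (hα : 0 < α) (hβ : 0 < β)
    (D : DirichletData α β u ux uy uxx uxy uyy tx ty) {b b' : ℝ × ℝ → ℝ}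
    (hb : HasPartials α b b' (fun _ => 0)) :
    pairing (volume.restrict (stadium α β)) b' ux ux
      - pairing (volume.restrict (stadium α β)) b' uy uy
      + 2 * pairing (volume.restrict (stadium α β)) b ux (fun p => uxx p + uyy p) =
    pairing (boundaryMeasure α β) (fun p => (outwardNormal α β p).1 * b p)
      (normalTrace α β tx ty) (normalTrace α β tx ty) := by
  obtain ⟨M, hM⟩ := isBddWeight_stadium hα hβ hb.continuous
  -- The identity is the divergence theorem for `(b(|ux|² - |uy|²), 2b ux·uy)`. Its boundary density
  -- is `b n₁(n₁² - n₂² + 2n₂²)|∂_N u|² = b n₁|∂_N u|²`.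
  have h1 := D.trace_x.green_x hα hβ D.trace_x hb
  have h2 := D.trace_y.green_x hα hβ D.trace_y hb
  have h3 := D.trace_x.green_y hα hβ D.trace_y hb
  rw [pairing_eq_zero_of_weight (by simp), zero_add] at h3
  have k := D.boundary_form hα hβ (c₁ := fun p => (outwardNormal α β p).1 * b p)
    (c₂ := fun p => (-1) * ((outwardNormal α β p).1 * b p))
    (c₃ := fun p => 2 * ((outwardNormal α β p).2 * b p))
    (d := fun p => (outwardNormal α β p).1 * b p)
    (continuous_outwardNormal_fst.mul hb.continuous)
    (continuous_const.mul (continuous_outwardNormal_fst.mul hb.continuous))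
    (continuous_const.mul (continuous_outwardNormal_snd.mul hb.continuous)) <| by
      filter_upwards [ae_normal_sq hα hβ] with p hp
      linear_combination (outwardNormal α β p).1 * b p * hp
  rw [pairing_const_mul, pairing_const_mul] at k
  rw [← k, ← h1, ← h2, ← h3, pairing_add_right hM D.trace_x.memLp D.trace_x.memLp_x
    D.trace_y.memLp_y, pairing_comm _ ux uxx, pairing_comm _ uy uxy]
  ring

/-- The Rellich identity for the vertical vector field with coefficient `b`. -/
theorem DirichletData.rellich_y (hα : 0 < α) (hβ : 0 < β)
    (D : DirichletData α β u ux uy uxx uxy uyy tx ty) {b bx by' : ℝ × ℝ → ℝ}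
    (hb : HasPartials α b bx by') :
    pairing (volume.restrict (stadium α β)) by' uy uy
      - pairing (volume.restrict (stadium α β)) by' ux ux
      + 2 * pairing (volume.restrict (stadium α β)) bx ux uy
      + 2 * pairing (volume.restrict (stadium α β)) b uy (fun p => uxx p + uyy p) =
    pairing (boundaryMeasure α β) (fun p => (outwardNormal α β p).2 * b p)
      (normalTrace α β tx ty) (normalTrace α β tx ty) := by
  obtain ⟨M, hM⟩ := isBddWeight_stadium hα hβ hb.continuous
  have h1 := D.trace_y.green_y hα hβ D.trace_y hb
  have h2 := D.trace_x.green_y hα hβ D.trace_x hb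
  have h3 := D.trace_x.green_x hα hβ D.trace_y hb
  have k := D.boundary_form hα hβ (c₁ := fun p => (-1) * ((outwardNormal α β p).2 * b p))
    (c₂ := fun p => (outwardNormal α β p).2 * b p)
    (c₃ := fun p => 2 * ((outwardNormal α β p).1 * b p))
    (d := fun p => (outwardNormal α β p).2 * b p)
    (continuous_const.mul (continuous_outwardNormal_snd.mul hb.continuous))
    (continuous_outwardNormal_snd.mul hb.continuous)
    (continuous_const.mul (continuous_outwardNormal_fst.mul hb.continuous)) <| by
      filter_upwards [ae_normal_sq hα hβ] with p hp
      linear_combination (outwardNormal α β p).2 * b p * hp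
  rw [pairing_const_mul, pairing_const_mul] at k
  rw [← k, ← h1, ← h2, ← h3, pairing_add_right hM D.trace_y.memLp D.trace_x.memLp_x
    D.trace_y.memLp_y, pairing_comm _ uy uxx, pairing_comm _ uy uyy, pairing_comm _ uxy ux]
  ring

/-- This turns the cross term of `ux` and `u`, which enters the Rellich identity with the factor
`λ²`, into a weighted mass of `u`. -/
lemma DirichletData.green_self_x (hα : 0 < α) (hβ : 0 < β)
    (D : DirichletData α β u ux uy uxx uxy uyy tx ty) {b bx by' : ℝ × ℝ → ℝ}
    (hb : HasPartials α b bx by') :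
    pairing (volume.restrict (stadium α β)) bx u u
      + 2 * pairing (volume.restrict (stadium α β)) b ux u = 0 := by
  have h := D.trace.green_x hα hβ D.trace hb
  rw [pairing_zero_left, pairing_comm _ u ux] at h
  linarith

lemma DirichletData.green_self_y (hα : 0 < α) (hβ : 0 < β)
    (D : DirichletData α β u ux uy uxx uxy uyy tx ty) {b bx by' : ℝ × ℝ → ℝ}
    (hb : HasPartials α b bx by') :
    pairing (volume.restrict (stadium α β)) by' u u
      + 2 * pairing (volume.restrict (stadium α β)) b uy u = 0 := by
  have h := D.trace.green_y hα hβ D.trace hb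
  rw [pairing_zero_left, pairing_comm _ u uy] at h
  linarith

/-- The weighted energy identity. -/
theorem DirichletData.energy (hα : 0 < α) (hβ : 0 < β)
    (D : DirichletData α β u ux uy uxx uxy uyy tx ty) {b b' : ℝ × ℝ → ℝ}
    (hb : HasPartials α b b' (fun _ => 0)) :
    pairing (volume.restrict (stadium α β)) b ux ux
      + pairing (volume.restrict (stadium α β)) b uy uy
      + pairing (volume.restrict (stadium α β)) b' ux u
      + pairing (volume.restrict (stadium α β)) b u (fun p => uxx p + uyy p) = 0 := by
  obtain ⟨M, hM⟩ := isBddWeight_stadium hα hβ hb.continuous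
  have h1 := D.trace_x.green_x hα hβ D.trace hb
  have h2 := D.trace_y.green_y hα hβ D.trace hb
  rw [pairing_zero_right] at h1 h2
  rw [pairing_eq_zero_of_weight (by simp), zero_add] at h2
  rw [pairing_add_right hM D.trace.memLp D.trace_x.memLp_x D.trace_y.memLp_y,
    pairing_comm _ u uxx, pairing_comm _ u uyy]
  linarith

end Rellich

/-! ### Restriction to the wings. -/

section Weights

variable {μ : Measure (ℝ × ℝ)}

lemma isBddWeight_of_le {c : ℝ × ℝ → ℝ} {M : ℝ} (hα : 0 < α) (hβ : 0 < β) (hc : Measurable c)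
    (h : ∀ p : ℝ × ℝ, |wingOffset α p.1| ≤ β → |p.1| ≤ α + β → |p.2| ≤ β → |c p| ≤ M) :
    IsBddWeight (volume.restrict (stadium α β)) c M := by
  refine ⟨hc.aestronglyMeasurable, ?_⟩
  filter_upwards [ae_mem_stadium] with p hp
  obtain ⟨h1, h2, h3⟩ := bounds_of_mem hα hβ hp
  exact h p h1 h2 h3

/-- The restriction of `f` to the wings. -/
def wingPart (α : ℝ) (f : ℝ × ℝ → ℂ) (p : ℝ × ℝ) : ℂ := wingIndicator α p.1 • f p

lemma memLp_wingPart (hf : MemLp f 2 μ) : MemLp (wingPart α f) 2 μ :=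
  (isBddWeight_wingIndicator μ).memLp_smul hf

/-- A weight that vanishes off the wings sees only the wing part, so Cauchy–Schwarz yields norms
over the wings. -/
lemma pairing_wingPart_right {c : ℝ × ℝ → ℝ} (hc : ∀ p, wingIndicator α p.1 * c p = c p)
    (f g : ℝ × ℝ → ℂ) : pairing μ c f (wingPart α g) = pairing μ c f g := by
  unfold wingPart
  rw [pairing_smul_right]
  congr 1
  ext p
  rw [mul_comm, hc]

lemma wingIndicator_sq (x : ℝ) : wingIndicator α x * wingIndicator α x = wingIndicator α x := by
  rcases wingIndicator_mem (α := α) x with h | h <;> simp [h]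

lemma wingIndicator_mul_abs (x : ℝ) :
    wingIndicator α x * |wingOffset α x| = |wingOffset α x| := by
  rw [← wingSign_mul_wingOffset, mul_left_comm, wingIndicator_mul_wingOffset]

lemma pairing_wingIndicator_self (hf : MemLp f 2 μ) :
    pairing μ (fun p => wingIndicator α p.1) f f = l2Norm μ (wingPart α f) ^ 2 := by
  rw [← pairing_one_self (memLp_wingPart hf)]
  unfold wingPart
  rw [pairing_smul_left, pairing_smul_right]
  simp only [one_mul, wingIndicator_sq]

lemma l2Norm_wingPart_le (hf : MemLp f 2 μ) : l2Norm μ (wingPart α f) ≤ l2Norm μ f := by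
  refine (sq_le_sq₀ (l2Norm_nonneg _) (l2Norm_nonneg _)).1 ?_
  rw [← pairing_wingIndicator_self hf, ← pairing_one_self hf]
  exact pairing_mono (isBddWeight_wingIndicator _) isBddWeight_one hf
    (Eventually.of_forall fun p => (le_abs_self _).trans (abs_wingIndicator_le _))

lemma normW_eq_l2Norm_wingPart (hα : 0 < α) (hβ : 0 < β) (f : ℝ × ℝ → ℂ) :
    normW α β f = l2Norm (volume.restrict (stadium α β)) (wingPart α f) := by
  have hm : MeasurableSet {p : ℝ × ℝ | α < |p.1|} :=
    (isOpen_lt continuous_const continuous_fst.abs).measurableSet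
  have e : wingPart α f = {p : ℝ × ℝ | α < |p.1|}.indicator f := by
    ext p
    by_cases h : α < |p.1| <;> simp [wingPart, wingIndicator, h]
  rw [normW, l2Norm, l2Norm, e, eLpNorm_indicator_eq_eLpNorm_restrict hm,
    Measure.restrict_restrict hm, Set.inter_comm, Measure.restrict_congr_set (wings_inter_ae hα hβ)]

lemma l2Norm_add_le {g : ℝ × ℝ → ℂ} (hf : MemLp f 2 μ) (hg : MemLp g 2 μ) :
    l2Norm μ (fun p => f p + g p) ≤ l2Norm μ f + l2Norm μ g := by
  unfold l2Norm
  rw [← ENNReal.toReal_add hf.2.ne hg.2.ne]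
  exact ENNReal.toReal_mono (ENNReal.add_ne_top.2 ⟨hf.2.ne, hg.2.ne⟩)
    (eLpNorm_add_le hf.1 hg.1 one_le_two)

lemma l2Norm_const_smul {a : ℝ} (ha : 0 ≤ a) (f : ℝ × ℝ → ℂ) :
    l2Norm μ (fun p => a • f p) = a * l2Norm μ f := by
  unfold l2Norm
  have := eLpNorm_const_smul (μ := μ) (p := 2) a f
  change eLpNorm (fun p => a • f p) 2 μ = _ at this
  rw [this, ENNReal.toReal_mul]
  simp [abs_of_nonneg ha]

lemma l2Norm_neg (f : ℝ × ℝ → ℂ) : l2Norm μ (fun p => -f p) = l2Norm μ f := by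
  unfold l2Norm
  have := eLpNorm_neg f 2 μ
  change eLpNorm (fun p => -f p) 2 μ = _ at this
  rw [this]

end Weights

/-! ### The a priori estimates for quasimodes. -/

/-- A normalized quasimode together with its derivatives and traces. -/
structure QuasimodeData (α β lam : ℝ) (u f ux uy uxx uxy uyy tx ty : ℝ × ℝ → ℂ) : Prop
    extends DirichletData α β u ux uy uxx uxy uyy tx ty where
  memLp_f : MemLp f 2 (volume.restrict (stadium α β))
  equation : (fun p => uxx p + uyy p) =ᵐ[volume.restrict (stadium α β)]
    fun p => -(f p + lam ^ 2 • u p)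
  normalized : l2Norm (volume.restrict (stadium α β)) u = 1

section Estimates

lemma QuasimodeData.pairing_laplacian
    (Q : QuasimodeData α β lam u f ux uy uxx uxy uyy tx ty) {c : ℝ × ℝ → ℝ} {M : ℝ}
    (hc : IsBddWeight (volume.restrict (stadium α β)) c M) {v : ℝ × ℝ → ℂ}
    (hv : MemLp v 2 (volume.restrict (stadium α β))) :
    pairing (volume.restrict (stadium α β)) c v (fun p => uxx p + uyy p) =
      -pairing (volume.restrict (stadium α β)) c v f
        - lam ^ 2 * pairing (volume.restrict (stadium α β)) c v u := by
  have hu : MemLp u 2 (volume.restrict (stadium α β)) := Q.trace.memLp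
  have hlu : MemLp (fun p => lam ^ 2 • u p) 2 (volume.restrict (stadium α β)) :=
    hu.const_smul (lam ^ 2)
  rw [pairing_congr (ae_eq_refl c) (ae_eq_refl v) Q.equation]
  have e : pairing (volume.restrict (stadium α β)) c v (fun p => -(f p + lam ^ 2 • u p)) =
      -pairing (volume.restrict (stadium α β)) c v (fun p => f p + lam ^ 2 • u p) := by
    simp only [pairing, inner_neg_right, mul_neg, integral_neg]
  rw [e, pairing_add_right hc hv Q.memLp_f hlu, pairing_smul_right]
  simp only [mul_comm _ (lam ^ 2), pairing_const_mul]
  ring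

variable (hα : 0 < α) (hβ : 0 < β) (Q : QuasimodeData α β lam u f ux uy uxx uxy uyy tx ty)

include hα hβ Q

/-- The Poincaré inequality in the horizontal direction. -/
lemma QuasimodeData.poincare :
    1 ≤ 2 * (α + β) * l2Norm (volume.restrict (stadium α β)) ux := by
  -- With weight `x` this reads `‖u‖² = -2⟨x ux, u⟩`, and `|x| ≤ α + β`.
  have h := Q.green_self_x hα hβ hasPartials_fst
  have b : IsBddWeight (volume.restrict (stadium α β)) (fun p => p.1) (α + β) :=
    isBddWeight_of_le hα hβ measurable_fst fun p _ h _ => h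
  have h1 := abs_pairing_le (by linarith) b Q.trace.memLp_x Q.trace.memLp
  rw [pairing_one_self Q.trace.memLp, Q.normalized] at h
  rw [Q.normalized] at h1
  have := neg_abs_le (pairing (volume.restrict (stadium α β)) (fun p => p.1) ux u)
  linarith

/-- Together with the Poincaré inequality this keeps `λ²` away from zero unless `f` is large. -/
lemma QuasimodeData.energy_le : l2Norm (volume.restrict (stadium α β)) ux ^ 2 ≤
    lam ^ 2 + l2Norm (volume.restrict (stadium α β)) f := by
  have h := Q.energy hα hβ (hasPartials_const 1)
  rw [Q.pairing_laplacian isBddWeight_one Q.trace.memLp,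
    pairing_eq_zero_of_weight (c := fun _ => 0) (by simp), pairing_one_self Q.trace.memLp_x,
    pairing_one_self Q.trace.memLp_y, pairing_one_self Q.trace.memLp, Q.normalized] at h
  have h1 := abs_pairing_le zero_le_one isBddWeight_one Q.trace.memLp Q.memLp_f
  rw [Q.normalized] at h1
  have := le_abs_self (pairing (volume.restrict (stadium α β)) (fun _ => 1) u f)
  nlinarith [sq_nonneg (l2Norm (volume.restrict (stadium α β)) uy)]

/-- The horizontal derivative is controlled by the weighted normal derivative on the wings. -/
lemma QuasimodeData.sq_le_boundary : l2Norm (volume.restrict (stadium α β)) ux ^ 2 ≤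
    (α + β) / β * pairing (boundaryMeasure α β) (fun p => |wingOffset α p.1|)
      (normalTrace α β tx ty) (normalTrace α β tx ty)
    + 4 * (α + β) ^ 2 * l2Norm (volume.restrict (stadium α β)) f ^ 2 := by
  set A := l2Norm (volume.restrict (stadium α β)) ux with hA
  set F := l2Norm (volume.restrict (stadium α β)) f with hF
  have hA0 : 0 ≤ A := l2Norm_nonneg _
  have hF0 : 0 ≤ F := l2Norm_nonneg _
  have b : IsBddWeight (volume.restrict (stadium α β)) (fun p => p.1) (α + β) :=
    isBddWeight_of_le hα hβ measurable_fst fun p _ h _ => h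
  -- Eliminating `λ²` and `‖uy‖²` among the three identities gives `2‖ux‖² - ⟨u, f⟩ - 2⟨x ux, f⟩ = ∫
  -- n₁ x |∂_N u|²`.
  have h1 := Q.rellich_x hα hβ hasPartials_fst
  have h2 := Q.energy hα hβ (hasPartials_const 1)
  have h3 := Q.green_self_x hα hβ hasPartials_fst
  rw [Q.pairing_laplacian b Q.trace.memLp_x] at h1
  rw [Q.pairing_laplacian isBddWeight_one Q.trace.memLp,
    pairing_eq_zero_of_weight (c := fun _ => 0) (by simp)] at h2
  have e1 := pairing_one_self Q.trace.memLp_x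
  have e2 := pairing_one_self Q.trace.memLp
  rw [Q.normalized] at e2
  have e3 := abs_pairing_le zero_le_one isBddWeight_one Q.trace.memLp Q.memLp_f
  rw [Q.normalized] at e3
  have e4 := abs_pairing_le (by linarith) b Q.trace.memLp_x Q.memLp_f
  have e3' := neg_abs_le (pairing (volume.restrict (stadium α β)) (fun _ => 1) u f)
  have e3'' := le_abs_self (pairing (volume.restrict (stadium α β)) (fun _ => 1) u f)
  have e4' := le_abs_self (pairing (volume.restrict (stadium α β)) (fun p => p.1) ux f)
  have hP := Q.poincare hα hβ
  have mg := memLp_normalTrace hα hβ Q.trace_x.memLp_trace Q.trace_y.memLp_trace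
  obtain ⟨M, hM⟩ := isBddWeight_boundary (α := α) (β := β) hα hβ
    (c := fun p => (outwardNormal α β p).1 * p.1) (continuous_outwardNormal_fst.mul continuous_fst)
  obtain ⟨M', hM'⟩ := isBddWeight_boundary (α := α) (β := β) hα hβ
    (c := fun p => (α + β) / β * |wingOffset α p.1|)
    (continuous_const.mul (continuous_wingOffset.comp continuous_fst).abs)
  have hB : pairing (boundaryMeasure α β) (fun p => (outwardNormal α β p).1 * p.1)
      (normalTrace α β tx ty) (normalTrace α β tx ty) ≤
      (α + β) / β * pairing (boundaryMeasure α β) (fun p => |wingOffset α p.1|)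
      (normalTrace α β tx ty) (normalTrace α β tx ty) := by
    rw [← pairing_const_mul]
    refine pairing_mono hM hM' mg ?_
    filter_upwards [ae_boundaryMeasure hα] with p hp
    obtain ⟨-, h5, -⟩ := bounds_of_le hα hβ hp.le
    rw [outwardNormal_fst]
    calc wingOffset α p.1 / β * p.1 ≤ |wingOffset α p.1 / β * p.1| := le_abs_self _
      _ = |p.1| / β * |wingOffset α p.1| := by
        rw [abs_mul, abs_div, abs_of_pos hβ]; ring
      _ ≤ (α + β) / β * |wingOffset α p.1| := by gcongr
  -- Poincaré makes the linear term `F` from `⟨u, f⟩` comparable with `A F`, so that half of `2A²`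
  -- absorbs everything containing `A`.
  have hFA : F ≤ 2 * (α + β) * A * F := by nlinarith
  nlinarith [sq_nonneg (A - 2 * (α + β) * F)]

lemma QuasimodeData.l2Norm_yy_le : l2Norm (volume.restrict (stadium α β)) uyy ≤
    l2Norm (volume.restrict (stadium α β)) f + lam ^ 2 := by
  have h0 := Q.l2Norm_le_laplacian hα hβ
  have h1 := l2Norm_congr Q.equation
  have h2 := l2Norm_neg (μ := volume.restrict (stadium α β)) (fun p => f p + lam ^ 2 • u p)
  have hu : MemLp u 2 (volume.restrict (stadium α β)) := Q.trace.memLp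
  have hlu : MemLp (fun p => lam ^ 2 • u p) 2 (volume.restrict (stadium α β)) :=
    hu.const_smul (lam ^ 2)
  have h3 := l2Norm_add_le Q.memLp_f hlu
  have h4 := l2Norm_const_smul (μ := volume.restrict (stadium α β)) (sq_nonneg lam) u
  rw [Q.normalized, mul_one] at h4
  linarith

/-- Vertical integration by parts gives `‖uy‖² = -⟨u, uyy⟩` over the wings: `u` vanishes on the
arcs, and the lines `|x| = α` have horizontal normals. The factor `uyy` is bounded on the whole
stadium by convexity. -/
lemma QuasimodeData.wing_uy_sq_le :
    l2Norm (volume.restrict (stadium α β)) (wingPart α uy) ^ 2 ≤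
    (l2Norm (volume.restrict (stadium α β)) f + lam ^ 2) *
      l2Norm (volume.restrict (stadium α β)) (wingPart α u) := by
  have h := Q.trace.green_y_wing hα hβ Q.trace_y (hasPartials_const 1)
  rw [pairing_zero_left, pairing_eq_zero_of_weight (by simp), zero_add] at h
  simp only [mul_one] at h
  rw [pairing_wingIndicator_self Q.trace.memLp_y] at h
  have hu : MemLp u 2 (volume.restrict (stadium α β)) := Q.trace.memLp
  have h1 : pairing (volume.restrict (stadium α β)) (fun p => wingIndicator α p.1) u uyy =
      pairing (volume.restrict (stadium α β)) (fun _ => 1) (wingPart α u) uyy := by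
    unfold wingPart
    rw [pairing_smul_left]
    simp only [one_mul]
  rw [h1] at h
  have h2 := abs_pairing_le zero_le_one isBddWeight_one (memLp_wingPart (α := α) hu)
    Q.trace_y.memLp_y
  have h3 := neg_abs_le (pairing (volume.restrict (stadium α β)) (fun _ => 1) (wingPart α u) uyy)
  have h4 := Q.l2Norm_yy_le hα hβ
  have h5 := mul_le_mul_of_nonneg_right h4
    (l2Norm_nonneg (μ := volume.restrict (stadium α β)) (wingPart α u))
  linarith

/-- The weighted normal derivative on the wings is controlled by quantities on the wings and by the
horizontal derivative. -/
lemma QuasimodeData.boundary_le :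
    β * pairing (boundaryMeasure α β) (fun p => |wingOffset α p.1|)
      (normalTrace α β tx ty) (normalTrace α β tx ty) ≤
    β * l2Norm (volume.restrict (stadium α β)) f *
        l2Norm (volume.restrict (stadium α β)) (wingPart α u)
      + 4 * lam ^ 2 * β * l2Norm (volume.restrict (stadium α β)) (wingPart α u) ^ 2
      + l2Norm (volume.restrict (stadium α β)) ux *
        l2Norm (volume.restrict (stadium α β)) (wingPart α u)
      + 2 * β * l2Norm (volume.restrict (stadium α β)) ux *
        l2Norm (volume.restrict (stadium α β)) (wingPart α uy)
      + 2 * β ^ 2 * l2Norm (volume.restrict (stadium α β)) ux *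
        l2Norm (volume.restrict (stadium α β)) f
      + 2 * β ^ 2 * l2Norm (volume.restrict (stadium α β)) (wingPart α uy) *
        l2Norm (volume.restrict (stadium α β)) f := by
  have hβ0 := hβ.le
  have mu : MemLp u 2 (volume.restrict (stadium α β)) := Q.trace.memLp
  have mux : MemLp ux 2 (volume.restrict (stadium α β)) := Q.trace.memLp_x
  have muy : MemLp uy 2 (volume.restrict (stadium α β)) := Q.trace.memLp_y
  have mf : MemLp f 2 (volume.restrict (stadium α β)) := Q.memLp_f
  have mχu := memLp_wingPart (α := α) mu
  have mχuy := memLp_wingPart (α := α) muy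
  have hws : Measurable fun p : ℝ × ℝ => wingSign α p.1 := measurable_wingSign.comp measurable_fst
  have hwo : Measurable fun p : ℝ × ℝ => wingOffset α p.1 :=
    continuous_wingOffset.measurable.comp measurable_fst
  have hwa : Measurable fun p : ℝ × ℝ => |wingOffset α p.1| :=
    (continuous_wingOffset.comp continuous_fst).abs.measurable
  have bw : IsBddWeight (volume.restrict (stadium α β)) (fun p => |wingOffset α p.1|) β :=
    isBddWeight_of_le hα hβ hwa fun p h _ _ => by rwa [abs_abs]
  have bs : IsBddWeight (volume.restrict (stadium α β)) (fun p => wingSign α p.1) 1 :=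
    isBddWeight_of_le hα hβ hws fun p _ _ _ => abs_wingSign_le _
  have bsy : IsBddWeight (volume.restrict (stadium α β)) (fun p => wingSign α p.1 * p.2) β :=
    isBddWeight_of_le hα hβ (hws.mul measurable_snd) fun p _ _ h => by
      rw [abs_mul]; exact (mul_le_of_le_one_left (abs_nonneg _) (abs_wingSign_le _)).trans h
  have bσ : IsBddWeight (volume.restrict (stadium α β)) (fun p => wingOffset α p.1 * |wingOffset α p.1|) (β ^ 2) :=
    isBddWeight_of_le hα hβ (hwo.mul hwa) fun p h _ _ => by
      rw [abs_mul, abs_abs, sq]; exact mul_le_mul h h (abs_nonneg _) hβ0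
  have bwy : IsBddWeight (volume.restrict (stadium α β)) (fun p => |wingOffset α p.1| * p.2) (β ^ 2) :=
    isBddWeight_of_le hα hβ (hwa.mul measurable_snd) fun p h _ h' => by
      rw [abs_mul, abs_abs, sq]; exact mul_le_mul h h' (abs_nonneg _) hβ0
  have pw := hasPartials_abs_wingOffset hα
  have pσ := hasPartials_wingOffset_mul_abs hα
  have pwy : HasPartials α (fun p => |wingOffset α p.1| * p.2) (fun p => wingSign α p.1 * p.2)
      (fun p => |wingOffset α p.1|) :=
    (pw.smul hasPartials_snd).congr (fun _ => rfl) (by simp) (by simp)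
  -- The two components of the multiplier `|σ|(σ, y)`. On the boundary its normal component is
  -- `|σ|(σ² + y²)/β = β|σ|`, which is the content of `hI`.
  have r1 := Q.rellich_x hα hβ pσ
  have r2 := Q.rellich_y hα hβ pwy
  have g1 := Q.green_self_x hα hβ pσ
  have g2 := Q.green_self_y hα hβ pwy
  have en := Q.energy hα hβ pw
  rw [Q.pairing_laplacian bσ mux, pairing_const_mul, pairing_const_mul] at r1
  rw [Q.pairing_laplacian bwy muy] at r2
  rw [Q.pairing_laplacian bw mu] at en
  rw [pairing_const_mul] at g1
  have cw : ∀ p : ℝ × ℝ, wingIndicator α p.1 * |wingOffset α p.1| = |wingOffset α p.1| :=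
    fun p => wingIndicator_mul_abs p.1
  have cs : ∀ p : ℝ × ℝ, wingIndicator α p.1 * wingSign α p.1 = wingSign α p.1 :=
    fun p => wingIndicator_mul_wingSign p.1
  have t1 := abs_pairing_le zero_le_one bs mux mχu
  rw [pairing_wingPart_right cs] at t1
  have t2 := abs_pairing_le hβ0 bw mf mχu
  rw [pairing_wingPart_right cw, pairing_comm] at t2
  have t3 := abs_pairing_le hβ0 bw mχu mχu
  rw [pairing_wingPart_right cw, pairing_comm, pairing_wingPart_right cw] at t3
  have t4 := abs_pairing_le hβ0 bsy mux mχuy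
  rw [pairing_wingPart_right (fun p => by rw [← mul_assoc, cs])] at t4
  have t5 := abs_pairing_le (sq_nonneg β) bσ mux mf
  have t6 := abs_pairing_le (sq_nonneg β) bwy mf mχuy
  rw [pairing_wingPart_right (fun p => by rw [← mul_assoc, cw]), pairing_comm] at t6
  -- After the energy identity eliminates the weighted norm of `ux`, the weighted norm of `uy`
  -- appears with coefficient `-2` and is discarded.
  have p1 : 0 ≤ pairing (volume.restrict (stadium α β)) (fun p => |wingOffset α p.1|) uy uy :=
    pairing_nonneg (Eventually.of_forall fun p => abs_nonneg _)
  have hI : pairing (boundaryMeasure α β) (fun p => (outwardNormal α β p).1 *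
        (wingOffset α p.1 * |wingOffset α p.1|)) (normalTrace α β tx ty) (normalTrace α β tx ty)
      + pairing (boundaryMeasure α β) (fun p => (outwardNormal α β p).2 *
        (|wingOffset α p.1| * p.2)) (normalTrace α β tx ty) (normalTrace α β tx ty)
      = β * pairing (boundaryMeasure α β) (fun p => |wingOffset α p.1|)
      (normalTrace α β tx ty) (normalTrace α β tx ty) := by
    have mg := memLp_normalTrace hα hβ Q.trace_x.memLp_trace Q.trace_y.memLp_trace
    obtain ⟨M, hM⟩ := isBddWeight_boundary (α := α) (β := β) hα hβ
      (continuous_outwardNormal_fst.mul pσ.continuous)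
    obtain ⟨M', hM'⟩ := isBddWeight_boundary (α := α) (β := β) hα hβ
      (continuous_outwardNormal_snd.mul pwy.continuous)
    have h0 := pairing_add_weight hM hM' mg mg
    refine h0.symm.trans ?_
    rw [← pairing_const_mul]
    refine pairing_congr ?_ (ae_eq_refl _) (ae_eq_refl _)
    filter_upwards [ae_boundaryMeasure hα] with p hp
    simp only [Pi.mul_apply]
    rw [outwardNormal_fst, outwardNormal_snd]
    field_simp
    linear_combination |wingOffset α p.1| * hp
  have a1 := (abs_le.1 t1)
  have a2 := (abs_le.1 t2)
  have a3 := (abs_le.1 t3)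
  have a4 := (abs_le.1 t4)
  have a5 := (abs_le.1 t5)
  have a6 := (abs_le.1 t6)
  have a3' := mul_le_mul_of_nonneg_left a3.2 (sq_nonneg lam)
  have g1' := congrArg (lam ^ 2 * ·) g1
  have g2' := congrArg (lam ^ 2 * ·) g2
  simp only [mul_zero] at g1' g2'
  rw [← hI, ← r1, ← r2]
  linarith only [g1', g2', en, a1.1, a2.2, a3', a4.2, a5.1, a6.1, p1]

end Estimates

end Stadium

end

noncomputable section

namespace Stadium

open scoped RealInnerProductSpace

/-! ### Dimensionless inequalities. -/

section Algebra

variable {l a y m i φ Λ : ℝ}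

/-- The variables stand for `l = (α + β)/β`, `a = β‖ux‖`, `y = β‖uy‖_W`, `m = ‖u‖_W`, `φ = β²‖f‖`,
`Λ = βλ` and `i = β² ∫ w|∂_N u|²`. Here `h₁` is Poincaré and `h₂` is the boundary control. -/
lemma boundary_lower_bound (hl : 1 ≤ l) (hi : 0 ≤ i) (h₁ : 1 ≤ 2 * l * a)
    (h₂ : a ^ 2 ≤ l * i + 4 * l ^ 2 * φ ^ 2) : 1 ≤ 16 * l ^ 4 * (φ ^ 2 + i) := by
  have h : 1 ≤ (2 * l * a) ^ 2 := one_le_pow₀ h₁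
  have h3 : 4 * l ^ 2 * a ^ 2 ≤ 4 * l ^ 2 * (l * i + 4 * l ^ 2 * φ ^ 2) := by gcongr
  have h4 : l ^ 3 * i ≤ l ^ 4 * i := by
    gcongr
    norm_num
  have h5 : 0 ≤ l ^ 4 * i := by positivity
  linarith

/-- Inserting `h₃` into `h₂` leaves three terms linear in `a`, which Young's inequality absorbs.
Since `m² ≤ m`, all remaining wing terms become linear in `m`. -/
lemma wing_lower_bound (hl : 1 ≤ l) (hm : 0 ≤ m) (hm1 : m ≤ 1)
    (h₁ : 1 ≤ 2 * l * a) (h₂ : a ^ 2 ≤ l * i + 4 * l ^ 2 * φ ^ 2)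
    (h₃ : i ≤ φ * m + 4 * Λ ^ 2 * m ^ 2 + a * m + 2 * a * y + 2 * a * φ + 2 * y * φ)
    (h₄ : y ^ 2 ≤ (φ + Λ ^ 2) * m) : 1 ≤ 120 * l ^ 4 * (φ ^ 2 + (1 + Λ ^ 2) * m) := by
  have h : 1 ≤ (2 * l * a) ^ 2 := one_le_pow₀ h₁
  have hmm : m ^ 2 ≤ m := by nlinarith
  have hy : y ^ 2 ≤ Λ ^ 2 * m + φ ^ 2 / 2 + m / 2 := by nlinarith [sq_nonneg (φ - m)]
  have hll : l ≤ l ^ 2 := by nlinarith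
  have e1 : l * i ≤ l * (φ * m + 4 * Λ ^ 2 * m ^ 2 + a * m + 2 * a * y + 2 * a * φ + 2 * y * φ) := by
    gcongr
  have q1 : l * (a * m) ≤ a ^ 2 / 8 + 2 * l ^ 2 * m ^ 2 := by nlinarith [sq_nonneg (a - 4 * l * m)]
  have q2 : l * (2 * a * y) ≤ a ^ 2 / 8 + 8 * l ^ 2 * y ^ 2 := by
    nlinarith [sq_nonneg (a - 8 * l * y)]
  have q3 : l * (2 * a * φ) ≤ a ^ 2 / 8 + 8 * l ^ 2 * φ ^ 2 := by
    nlinarith [sq_nonneg (a - 8 * l * φ)]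
  have q4 : l * (2 * y * φ) ≤ l ^ 2 * (y ^ 2 + φ ^ 2) :=
    (mul_le_mul_of_nonneg_left (two_mul_le_add_sq y φ) (by linarith)).trans
      (mul_le_mul_of_nonneg_right hll (by positivity))
  have q5 : l * (φ * m) ≤ l ^ 2 * ((φ ^ 2 + m ^ 2) / 2) :=
    (mul_le_mul_of_nonneg_left (by linarith [two_mul_le_add_sq φ m]) (by linarith)).trans
      (mul_le_mul_of_nonneg_right hll (by positivity))
  have q6 : l * (4 * Λ ^ 2 * m ^ 2) ≤ l ^ 2 * (4 * Λ ^ 2 * m) :=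
    mul_le_mul hll (by gcongr) (by positivity) (by positivity)
  have q7 := mul_le_mul_of_nonneg_left hmm (sq_nonneg l)
  have q8 := mul_le_mul_of_nonneg_left hy (sq_nonneg l)
  -- The terms `q1`, `q2`, `q3` cost `3a²/8`. The coefficients left on the right are at most `18
  -- l²`, and `18 · 8/5 < 30`.
  have key : a ^ 2 ≤ 30 * l ^ 2 * (φ ^ 2 + (1 + Λ ^ 2) * m) := by
    have p1 : 0 ≤ l ^ 2 * m := by positivity
    have p2 : 0 ≤ l ^ 2 * (Λ ^ 2 * m) := by positivity
    have p3 : 0 ≤ l ^ 2 * φ ^ 2 := by positivity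
    linarith
  have h3 : 4 * l ^ 2 * a ^ 2 ≤ 4 * l ^ 2 * (30 * l ^ 2 * (φ ^ 2 + (1 + Λ ^ 2) * m)) := by gcongr
  linarith

/-- One of the two terms of `h` is at least `1/2`. In the first case the factor `Λ² ≥ 1` is inserted
freely; in the second `1 + Λ² ≤ 2Λ²`, and squaring gives `Λ⁴ m²`. -/
lemma high_frequency_lower_bound (hl : 1 ≤ l) (hm : 0 ≤ m) (hΛ : 1 ≤ Λ)
    (h : 1 ≤ 120 * l ^ 4 * (φ ^ 2 + (1 + Λ ^ 2) * m)) :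
    1 ≤ 10 ^ 9 * l ^ 16 * (Λ ^ 2 * φ ^ 2 + Λ ^ 4 * m ^ 2) := by
  have hΛ2 : 1 ≤ Λ ^ 2 := one_le_pow₀ hΛ
  have hp4 : l ^ 4 ≤ l ^ 16 := pow_le_pow_right₀ hl (by norm_num)
  have hp8 : l ^ 8 ≤ l ^ 16 := pow_le_pow_right₀ hl (by norm_num)
  have n1 : 0 ≤ l ^ 16 * (Λ ^ 2 * φ ^ 2) := by positivity
  have n2 : 0 ≤ l ^ 16 * (Λ ^ 4 * m ^ 2) := by positivity
  rcases le_total (1 / 2) (120 * l ^ 4 * φ ^ 2) with h1 | h1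
  · have : l ^ 4 * φ ^ 2 ≤ l ^ 16 * (Λ ^ 2 * φ ^ 2) :=
      mul_le_mul hp4 (le_mul_of_one_le_left (sq_nonneg _) hΛ2) (sq_nonneg _) (by positivity)
    linarith
  · have h2 : l ^ 4 * m ≤ l ^ 4 * (Λ ^ 2 * m) := by
      gcongr; exact le_mul_of_one_le_left hm hΛ2
    have h3 : 1 ≤ (480 * (l ^ 4 * (Λ ^ 2 * m))) ^ 2 := one_le_pow₀ (by linarith)
    have h4 : l ^ 8 * (Λ ^ 4 * m ^ 2) ≤ l ^ 16 * (Λ ^ 4 * m ^ 2) := by gcongr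
    linarith

/-- If `φ` is not bounded below, `h₁` and `h₂` bound `l²Λ²` below. This both absorbs the `1` in `1 +
Λ²` and supplies additional powers of `Λ`. -/
lemma all_frequency_lower_bound (hl : 1 ≤ l) (hm : 0 ≤ m)
    (h₁ : 1 ≤ 2 * l * a) (h₂ : a ^ 2 ≤ Λ ^ 2 + φ)
    (h : 1 ≤ 120 * l ^ 4 * (φ ^ 2 + (1 + Λ ^ 2) * m)) :
    1 ≤ 10 ^ 9 * l ^ 16 * (φ ^ 2 + Λ ^ 8 * m ^ 2) := by
  have hp4 : l ^ 4 ≤ l ^ 16 := pow_le_pow_right₀ hl (by norm_num)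
  have n1 : 0 ≤ l ^ 16 * φ ^ 2 := by positivity
  have n2 : 0 ≤ l ^ 16 * (Λ ^ 8 * m ^ 2) := by positivity
  have h4 : l ^ 4 * φ ^ 2 ≤ l ^ 16 * φ ^ 2 := by gcongr
  have h0 : 1 ≤ (2 * l * a) ^ 2 := one_le_pow₀ h₁
  have h5 : l ^ 2 * a ^ 2 ≤ l ^ 2 * (Λ ^ 2 + φ) := by gcongr
  rcases le_total 1 (8 * l ^ 2 * φ) with h6 | h6
  · have h7 : 1 ≤ (8 * l ^ 2 * φ) ^ 2 := one_le_pow₀ h6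
    linarith
  rcases le_total (1 / 2) (120 * l ^ 4 * φ ^ 2) with h1 | h1
  · linarith
  have h7 : 1 ≤ 8 * (l ^ 2 * Λ ^ 2) := by linarith
  have h8 : m ≤ 8 * (l ^ 2 * Λ ^ 2) * m := le_mul_of_one_le_left hm h7
  have h9 : 1 * (Λ ^ 2 * m) ≤ l ^ 2 * (Λ ^ 2 * m) := by gcongr; exact one_le_pow₀ hl
  have h10 : l ^ 4 * ((1 + Λ ^ 2) * m) ≤ l ^ 4 * (9 * (l ^ 2 * (Λ ^ 2 * m))) := by
    refine mul_le_mul_of_nonneg_left ?_ (by positivity)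
    linarith
  have h11 : 1 ≤ (2160 * (l ^ 6 * (Λ ^ 2 * m))) ^ 2 := one_le_pow₀ (by linarith)
  have h12 : 1 ≤ (8 * (l ^ 2 * Λ ^ 2)) ^ 2 := one_le_pow₀ h7
  -- The product is `2160² · 8² · l¹⁶ Λ⁸ m²`. It accounts for the constant: `2160² · 64 < 10⁹`, and
  -- the exponent of `l` is `12 + 4`.
  have h13 := one_le_mul_of_one_le_of_one_le h11 h12
  linarith

end Algebra

/-! ### From quasimodes to derivatives and traces. -/

section Construction

variable {α β lam : ℝ} {u f g : ℝ × ℝ → ℂ}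

/-- The weak gradients in the hypotheses are chosen independently of each other; uniqueness
identifies them, and the two mixed second derivatives agree. That `f` is square integrable follows
from the equation. -/
theorem IsDirichletQuasimode.exists_data (hα : 0 < α) (hβ : 0 < β)
    (h : IsDirichletQuasimode α β lam u f) :
    ∃ ux uy uxx uxy uyy tx ty, QuasimodeData α β lam u f ux uy uxx uxy uyy tx ty ∧
      HasWeakGrad (stadium α β) u ux uy ∧ HasTrace α β ux tx ∧ HasTrace α β uy ty := by
  obtain ⟨ux, uy, uxx, uxy, uyx, uyy, h0, hx, hy, he⟩ := h.equation
  obtain ⟨tx, htx, htx'⟩ := hx.exists_trace hα hβ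
  obtain ⟨ty, hty, hty'⟩ := hy.exists_trace hα hβ
  obtain ⟨vx, vy, hv, hv'⟩ := h.dirichlet.hasH1Trace hα hβ
  obtain ⟨e1, e2⟩ := hv.unique hα hβ (ae_eq_refl u) h0
  have e3 := weak_mixed_partials hα hβ h0 hx hy
  have heq : (fun p => uxx p + uyy p) =ᵐ[volume.restrict (stadium α β)]
      fun p => -(f p + lam ^ 2 • u p) := by
    filter_upwards [he] with p hp
    rw [← hp, Complex.real_smul]
    push_cast
    ring
  have hu : MemLp u 2 (volume.restrict (stadium α β)) := h0.memLp
  have hlu : MemLp (fun p => (lam : ℂ) ^ 2 * u p) 2 (volume.restrict (stadium α β)) :=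
    hu.const_mul ((lam : ℂ) ^ 2)
  have hf : MemLp f 2 (volume.restrict (stadium α β)) :=
    (memLp_congr_ae he).1 ((hx.memLp_x.neg.sub hy.memLp_y).sub hlu)
  exact ⟨ux, uy, uxx, uxy, uyy, tx, ty,
    { trace := hv'.congr (ae_eq_refl _) e1 e2 (ae_eq_refl _)
      trace_x := htx'
      trace_y := hty'.congr (ae_eq_refl _) e3.symm (ae_eq_refl _) (ae_eq_refl _)
      memLp_f := hf
      equation := heq
      normalized := h.normalized }, h0, htx, hty⟩

lemma isNormalDeriv_normalTrace {ux uy tx ty : ℝ × ℝ → ℂ}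
    (h : HasWeakGrad (stadium α β) u ux uy) (hx : HasTrace α β ux tx) (hy : HasTrace α β uy ty) :
    IsNormalDeriv α β u (normalTrace α β tx ty) :=
  ⟨ux, uy, tx, ty, h, hx, hy, Eventually.of_forall fun p => by
    simp only [normalTrace, Complex.real_smul]⟩

/-- Uniqueness of weak gradients and of traces makes the normal derivative independent of all
choices. -/
lemma IsNormalDeriv.ae_eq {ux uy tx ty : ℝ × ℝ → ℂ} (hα : 0 < α) (hβ : 0 < β)
    (h : HasWeakGrad (stadium α β) u ux uy) (hx : HasTrace α β ux tx) (hy : HasTrace α β uy ty)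
    (hg : IsNormalDeriv α β u g) : g =ᵐ[boundaryMeasure α β] normalTrace α β tx ty := by
  obtain ⟨vx, vy, sx, sy, hv, hsx, hsy, he⟩ := hg
  obtain ⟨e1, e2⟩ := hv.unique hα hβ (ae_eq_refl u) h
  obtain ⟨_, _, -, h1⟩ := hx.hasH1Trace hα hβ
  obtain ⟨_, _, -, h2⟩ := hy.hasH1Trace hα hβ
  obtain ⟨_, _, -, h3⟩ := hsx.hasH1Trace hα hβ
  obtain ⟨_, _, -, h4⟩ := hsy.hasH1Trace hα hβ
  filter_upwards [he, h3.trace_unique hα hβ e1 h1, h4.trace_unique hα hβ e2 h2] with p hp hp1 hp2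
  rw [hp, hp1, hp2]
  simp only [normalTrace, Complex.real_smul]

/-- The weight `|σ|` vanishes where `|x| < α`, and almost every boundary point with `|x| ≥ α`
belongs to the wings, where `|σ| = w`. -/
lemma wing_integral_eq (hα : 0 < α) {G : ℝ × ℝ → ℂ} (hg : g =ᵐ[boundaryMeasure α β] G) :
    ∫ p in wings α β, wingCoord α p * ‖g p‖ ^ 2 ∂(boundaryMeasure α β) =
      pairing (boundaryMeasure α β) (fun p => |wingOffset α p.1|) G G := by
  rw [← integral_indicator measurableSet_wings, pairing]
  refine integral_congr_ae ?_
  filter_upwards [hg, ae_boundaryMeasure hα] with p hp hb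
  rw [real_inner_self_eq_norm_sq, ← hp]
  by_cases hw : α ≤ |p.1|
  · rw [abs_wingOffset_of_le hα hw, Set.indicator_of_mem]
    · rfl
    · refine ⟨hw, ?_⟩
      rw [← abs_wingOffset_of_le hα hw, sq_abs]
      exact hb.le
  · rw [wingOffset_of_abs_le (not_le.1 hw).le, abs_zero, zero_mul, Set.indicator_of_notMem]
    exact fun h => hw h.1

lemma normBdryW_sq (hα : 0 < α) (hβ : 0 < β) (hg : MemLp g 2 (boundaryMeasure α β)) :
    normBdryW α β (fun p => (Real.sqrt (wingCoord α p) : ℂ) * g p) ^ 2 =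
      ∫ p in wings α β, wingCoord α p * ‖g p‖ ^ 2 ∂(boundaryMeasure α β) := by
  have hc : Continuous fun p : ℝ × ℝ => Real.sqrt (wingCoord α p) := by
    unfold wingCoord; fun_prop
  obtain ⟨M, hM⟩ := isBddWeight_boundary (α := α) (β := β) hα hβ hc
  have hm : MemLp (fun p => Real.sqrt (wingCoord α p) • g p) 2
      ((boundaryMeasure α β).restrict (wings α β)) := (hM.memLp_smul hg).restrict _
  have e : (fun p => (Real.sqrt (wingCoord α p) : ℂ) * g p) =
      fun p => Real.sqrt (wingCoord α p) • g p := by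
    simp only [Complex.real_smul]
  rw [normBdryW, e, ← pairing_one_self hm, pairing]
  refine setIntegral_congr_fun measurableSet_wings fun p hp => ?_
  have h0 : 0 ≤ wingCoord α p := sub_nonneg.2 hp.1
  simp only [one_mul]
  rw [real_inner_self_eq_norm_sq, norm_smul, mul_pow, Real.norm_eq_abs, sq_abs, Real.sq_sqrt h0]

end Construction

/-! ### The lower bounds. -/

section Main

variable {α β ρ lam : ℝ} {u f : ℝ × ℝ → ℂ}

/-- The three lower bounds for a single quasimode. -/
theorem IsDirichletQuasimode.lower_bounds (hα : 0 < α) (hβ : 0 < β) (hρ : α / β = ρ)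
    (h : IsDirichletQuasimode α β lam u f) :
    (∃ g, IsNormalDeriv α β u g) ∧
    (∀ g, IsNormalDeriv α β u g → MemLp g 2 (boundaryMeasure α β) ∧
      1 ≤ 10 ^ 9 * (ρ + 1) ^ 16 * (β ^ 4 * normS α β f ^ 2 + β ^ 2 * ∫ p in wings α β,
        wingCoord α p * ‖g p‖ ^ 2 ∂(boundaryMeasure α β))) ∧
    1 ≤ 10 ^ 9 * (ρ + 1) ^ 16 * (β ^ 4 * normS α β f ^ 2 + (β * lam) ^ 8 * normW α β u ^ 2) ∧
    (1 ≤ β * lam → 1 ≤ 10 ^ 9 * (ρ + 1) ^ 16 *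
      ((β * lam) ^ 2 * (β ^ 4 * normS α β f ^ 2) + (β * lam) ^ 4 * normW α β u ^ 2)) := by
  obtain ⟨ux, uy, uxx, uxy, uyy, tx, ty, Q, h0, hx, hy⟩ := h.exists_data hα hβ
  have b1 := Q.poincare hα hβ
  have b2 := Q.energy_le hα hβ
  have b3 := Q.sq_le_boundary hα hβ
  have b4 := Q.wing_uy_sq_le hα hβ
  have b5 := Q.boundary_le hα hβ
  have b6 := l2Norm_wingPart_le (α := α) Q.trace.memLp
  rw [Q.normalized] at b6
  rw [← normW_eq_l2Norm_wingPart hα hβ u] at b4 b5 b6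
  have hm : 0 ≤ normW α β u := l2Norm_nonneg _
  have hI : 0 ≤ pairing (boundaryMeasure α β) (fun p => |wingOffset α p.1|)
      (normalTrace α β tx ty) (normalTrace α β tx ty) :=
    pairing_nonneg (Eventually.of_forall fun p => abs_nonneg _)
  have hl : 1 ≤ ρ + 1 := by rw [← hρ]; have := div_pos hα hβ; linarith
  have hαβ : α + β = (ρ + 1) * β := by rw [← hρ]; field_simp
  change _ ≤ _ + 4 * (α + β) ^ 2 * normS α β f ^ 2 at b3
  change _ ≤ _ + normS α β f at b2
  change _ ≤ (normS α β f + _) * _ at b4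
  set A := l2Norm (volume.restrict (stadium α β)) ux
  set Y := l2Norm (volume.restrict (stadium α β)) (wingPart α uy)
  set F := normS α β f with hF
  change _ ≤ β * F * _ + _ + _ + _ + 2 * β ^ 2 * A * F + 2 * β ^ 2 * Y * F at b5
  set m := normW α β u
  set I := pairing (boundaryMeasure α β) (fun p => |wingOffset α p.1|)
      (normalTrace α β tx ty) (normalTrace α β tx ty)
  rw [hαβ, mul_div_cancel_right₀ _ hβ.ne'] at b3
  rw [hαβ] at b1
  -- Multiplication by powers of `β` makes the estimates dimensionless, with `l = ρ + 1`; only the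
  -- ratio `ρ` enters the constants.
  have c1 : 1 ≤ 2 * (ρ + 1) * (β * A) := by linarith
  have c2 : (β * A) ^ 2 ≤ (β * lam) ^ 2 + β ^ 2 * F := by
    have := mul_le_mul_of_nonneg_left b2 (sq_nonneg β); linarith
  have c3 : (β * A) ^ 2 ≤ (ρ + 1) * (β ^ 2 * I) + 4 * (ρ + 1) ^ 2 * (β ^ 2 * F) ^ 2 := by
    have := mul_le_mul_of_nonneg_left b3 (sq_nonneg β); linarith
  have c4 : (β * Y) ^ 2 ≤ (β ^ 2 * F + (β * lam) ^ 2) * m := by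
    have := mul_le_mul_of_nonneg_left b4 (sq_nonneg β); linarith
  have c5 : β ^ 2 * I ≤ β ^ 2 * F * m + 4 * (β * lam) ^ 2 * m ^ 2 + β * A * m
      + 2 * (β * A) * (β * Y) + 2 * (β * A) * (β ^ 2 * F) + 2 * (β * Y) * (β ^ 2 * F) := by
    have := mul_le_mul_of_nonneg_left b5 hβ.le; linarith
  have d1 := boundary_lower_bound hl (by positivity) c1 c3
  have d2 := wing_lower_bound hl hm b6 c1 c3 c5 c4
  have d3 := all_frequency_lower_bound hl hm c1 c2 d2
  have e : (β ^ 2 * F) ^ 2 = β ^ 4 * F ^ 2 := by ring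
  rw [e] at d1 d3
  refine ⟨⟨_, isNormalDeriv_normalTrace h0 hx hy⟩, fun g hg => ?_, d3, fun hΛ => ?_⟩
  · have hgG := hg.ae_eq hα hβ h0 hx hy
    refine ⟨(memLp_congr_ae hgG).2
      (memLp_normalTrace hα hβ Q.trace_x.memLp_trace Q.trace_y.memLp_trace), ?_⟩
    rw [wing_integral_eq hα hgG]
    refine d1.trans (mul_le_mul_of_nonneg_right ?_ (by positivity))
    exact mul_le_mul (by norm_num) (pow_le_pow_right₀ hl (by norm_num)) (by positivity)
      (by norm_num)
  · have d4 := high_frequency_lower_bound hl hm hΛ d2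
    rwa [e] at d4

end Main

end Stadium

end

theorem theorem1 (ρ : ℝ) (hρ : 0 < ρ) :
    ∃ C : ℝ, 0 < C ∧ ∀ α β : ℝ, 0 < α → 0 < β → α / β = ρ →
      -- the three estimates
      (∀ (lam : ℝ) (u f : ℝ × ℝ → ℂ), Stadium.IsDirichletQuasimode α β lam u f →
        (∃ g, Stadium.IsNormalDeriv α β u g) ∧
        (∀ g, Stadium.IsNormalDeriv α β u g →
          C ≤ β ^ 4 * Stadium.normS α β f ^ 2
            + β ^ 2 * ∫ p in Stadium.wings α β,
                Stadium.wingCoord α p * ‖g p‖ ^ 2 ∂(Stadium.boundaryMeasure α β)) ∧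
        C ≤ β ^ 4 * Stadium.normS α β f ^ 2
            + (β * lam) ^ 8 * Stadium.normW α β u ^ 2 ∧
        (1 ≤ β * lam →
          C ≤ (β * lam) ^ 2 * (β ^ 4 * Stadium.normS α β f ^ 2)
            + (β * lam) ^ 4 * Stadium.normW α β u ^ 2)) ∧
      -- the consequences for quasimodes of order o(1)
      (∀ (lam : ℕ → ℝ) (u f : ℕ → ℝ × ℝ → ℂ), Stadium.IsQuasimodeSequence α β lam u f →
        (fun k => Stadium.normS α β (f k)) =o[atTop] (fun _ => (1 : ℝ)) →
        ∀ᶠ k in atTop,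
          (∀ g, Stadium.IsNormalDeriv α β (u k) g →
            C ≤ β * Stadium.normBdryW α β
              (fun p => (Real.sqrt (Stadium.wingCoord α p) : ℂ) * g p)) ∧
          C * ((β * lam k) ^ 4)⁻¹ ≤ Stadium.normW α β (u k)) ∧
      -- the consequence for quasimodes of order o(lam⁻²)
      (∀ (lam : ℕ → ℝ) (u f : ℕ → ℝ × ℝ → ℂ), Stadium.IsQuasimodeSequence α β lam u f →
        (fun k => Stadium.normS α β (f k)) =o[atTop] (fun k => ((lam k) ^ 2)⁻¹) →
        ∀ᶠ k in atTop, C * ((β * lam k) ^ 2)⁻¹ ≤ Stadium.normW α β (u k)) := by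
  have hC : (0 : ℝ) < 10 ^ 9 * (ρ + 1) ^ 16 := by positivity
  have hC1 : (1 : ℝ) ≤ 10 ^ 9 * (ρ + 1) ^ 16 := by
    have : (1 : ℝ) ≤ (ρ + 1) ^ 16 := one_le_pow₀ (by linarith)
    linarith
  set K : ℝ := 10 ^ 9 * (ρ + 1) ^ 16 with hK
  have hinv : 0 < K⁻¹ := inv_pos.2 hC
  have hinv1 : K⁻¹ ≤ 1 := inv_le_one_of_one_le₀ hC1
  have half {x : ℝ} (hx : 1 ≤ K * x) : K⁻¹ ≤ x := by
    rw [inv_le_iff_one_le_mul₀ hC]; linarith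
  -- The constant `K⁻¹ / 2` is at most one, so it survives taking square roots, and the same
  -- constant serves for the unsquared norms.
  have root {x : ℝ} (hx0 : 0 ≤ x) (hx : K⁻¹ / 2 ≤ x ^ 2) : K⁻¹ / 2 ≤ x := by
    by_contra! hlt
    nlinarith
  -- Half of `K⁻¹` is reserved for the term in `f`, which falls below `K⁻¹ / 2` along the sequences.
  refine ⟨K⁻¹ / 2, by positivity, fun α β hα hβ hρ' => ⟨fun lam u f h => ?_, ?_, ?_⟩⟩
  · obtain ⟨h1, h2, h3, h4⟩ := h.lower_bounds hα hβ hρ'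
    exact ⟨h1, fun g hg => by linarith [half (h2 g hg).2], by linarith [half h3],
      fun hΛ => by linarith [half (h4 hΛ)]⟩
  · intro lam u f h hf
    have hf0 : Tendsto (fun k => β ^ 4 * Stadium.normS α β (f k) ^ 2) atTop (𝓝 0) := by
      have := (((isLittleO_one_iff ℝ).1 hf).pow 2).const_mul (β ^ 4)
      simpa using this
    filter_upwards [hf0.eventually_lt_const (half_pos hinv), h.1.eventually_gt_atTop 0]
      with k hk hlam
    obtain ⟨h1, h2, h3, h4⟩ := (h.2 k).lower_bounds hα hβ hρ'
    have hΛ : 0 < β * lam k := mul_pos hβ hlam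
    refine ⟨fun g hg => ?_, ?_⟩
    · obtain ⟨hg2, hg1⟩ := h2 g hg
      rw [← Stadium.normBdryW_sq hα hβ hg2] at hg1
      refine root (mul_nonneg hβ.le (Stadium.l2Norm_nonneg _)) ?_
      have := half hg1
      rw [mul_pow]
      linarith
    · rw [← div_eq_mul_inv, div_le_iff₀ (by positivity)]
      refine root (mul_nonneg (Stadium.l2Norm_nonneg _) (by positivity)) ?_
      have := half h3
      linarith
  · intro lam u f h hf
    have hf0 : Tendsto (fun k => (β * lam k) ^ 2 * (β ^ 4 * Stadium.normS α β (f k) ^ 2))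
        atTop (𝓝 0) := by
      have hl : Tendsto (fun k => (lam k)⁻¹) atTop (𝓝 0) := h.1.inv_tendsto_atTop
      -- From `‖f‖ = o(λ⁻²)` one gets `λ‖f‖ = o(λ⁻¹)`, hence `λ²‖f‖² → 0`, which is the term in `f`
      -- up to the factor `β⁶`.
      have h0 : (fun k => lam k * Stadium.normS α β (f k)) =o[atTop] fun k => (lam k)⁻¹ := by
        have := (isBigO_refl lam atTop).mul_isLittleO hf
        refine this.congr' (EventuallyEq.refl _ _) ?_
        filter_upwards [h.1.eventually_gt_atTop 0] with k hk
        field_simp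
      have := ((h0.trans_tendsto hl).pow 2).const_mul (β ^ 6)
      simp only [ne_eq, OfNat.ofNat_ne_zero, not_false_eq_true, zero_pow, mul_zero] at this
      refine this.congr fun k => ?_
      ring
    filter_upwards [hf0.eventually_lt_const (half_pos hinv),
      (h.1.const_mul_atTop hβ).eventually_ge_atTop 1] with k hk hlam
    obtain ⟨-, -, -, h4⟩ := (h.2 k).lower_bounds hα hβ hρ'
    have hΛ : 0 < β * lam k := one_pos.trans_le hlam
    rw [← div_eq_mul_inv, div_le_iff₀ (by positivity)]
    refine root (mul_nonneg (Stadium.l2Norm_nonneg _) (by positivity)) ?_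
    have := half (h4 hlam)
    linarith
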